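/- **Theorem.** Let $m\ge 1$ be a fixed constant. An instance of $Rm\,|\,p_{i,j}\in\{p_j,\infty\}\,|\,C_{\max}$ consists of $n\ge 0$ jobs, where job $j$ has a processing time $p_j\in\mathbb N=\{0,1,2,\dots\}$ and a set $M(j)\subseteq\{1,\dots,m\}$ of machines that can process it; put $p_{i,j}=p_j$ if $i\in M(j)$ and $p_{i,j}=\infty$ otherwise, and $p_{\max}=\max_j p_j$ (which is $0$ if $n=0$). A schedule is a map $\sigma:\{1,\dots,n\}\to\{1,\dots,m\}$, and its makespan is $C_{\max}(\sigma)=\max_{i}\sum_{j\in\sigma^{-1}(i)}p_{i,j}\in\mathbb N\cup\{\infty\}$. The task is to compute a schedule of minimum makespan. This problem can be solved in $\widetilde O\bigl(p_{\max}^{2^{m+1}+2m-2}+n\bigr)$ time. That is, for every $m\ge1$ there are a program for the random access machine and constants $c,d$ (all depending only on $m$) such that, on every instance with $m$ machines, the program outputs a schedule of minimum makespan after time at most $c\,(f+1)\,\lfloor\log_2 (f+2)\rfloor^{d}$, where $f=p_{\max}^{2^{m+1}+2m-2}+n$. Time is measured by logarithmic cost: each elementary step (assigning a constant; adding, subtracting,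 multiplying or dividing two integers; reading or writing an array cell; testing for zero) is charged the total bit length of the numbers and addresses it handles, plus a constant. -/

import Mathlib

/-! ### Machine model: a random access machine with logarithmic cost

A program is a fixed finite text. It works on registers and on arrays of natural numbers; since
registers and arrays are named by constants in the text, a program touches only finitely many
registers and finitely many arrays, while the cells inside an array are addressed indirectly.
Every elementary step is charged the bit lengths of all numbers and addresses it handles. -/

namespace RAM

/-- Memory contents: `reg x` is the content of register `x`, and `mem A k` is the content of
cell `k` of array `A`. -/
structure State where
  reg : ℕ → ℕ
  mem : ℕ → ℕ → ℕ

/-- `s` with register `x` overwritten by `v`. -/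
def State.setReg (s : State) (x v : ℕ) : State :=
  { s with reg := Function.update s.reg x v }

/-- `s` with cell `k` of array `A` overwritten by `v`. -/
def State.setMem (s : State) (A k v : ℕ) : State :=
  { s with mem := Function.update s.mem A (Function.update (s.mem A) k v) }

/-- The arithmetic operations of the machine. -/
inductive Op where
  | add
  | sub
  | mul
  | div

/-- Subtraction is truncated at `0`; division is integer division, with `a / 0 = 0`. -/
def Op.eval : Op → ℕ → ℕ → ℕ
  | .add, a, b => a + b
  | .sub, a, b => a - b
  | .mul, a, b => a * b
  | .div, a, b => a / b

/-- Programs. All arguments of type `ℕ` are constants of the program text. -/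
inductive Prog where
  /-- do nothing -/
  | skip : Prog
  /-- `x := c` for a constant `c` -/
  | const (x c : ℕ) : Prog
  /-- `x := y o z` for registers `x`, `y`, `z` -/
  | arith (o : Op) (x y z : ℕ) : Prog
  /-- `x := A[y]` for registers `x`, `y` and an array `A` -/
  | load (x A y : ℕ) : Prog
  /-- `A[x] := y` for registers `x`, `y` and an array `A` -/
  | store (A x y : ℕ) : Prog
  /-- first `P`, then `Q` -/
  | seq (P Q : Prog) : Prog
  /-- `P` if register `x` is nonzero, otherwise `Q` -/
  | ite (x : ℕ) (P Q : Prog) : Prog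
  /-- repeat `P` as long as register `x` is nonzero -/
  | loop (x : ℕ) (P : Prog) : Prog

/-- Charge for handling the number `a`: its bit length plus one (so that no step is free). -/
def len (a : ℕ) : ℕ := Nat.size a + 1

/-- `Exec P s t s'`: started in `s`, the program `P` halts, at total cost exactly `t`,
in the state `s'`. (Execution is deterministic: `t` and `s'` are determined by `P` and `s`.) -/
inductive Exec : Prog → State → ℕ → State → Prop where
  | skip (s : State) : Exec .skip s 1 s
  | const (s : State) (x c : ℕ) : Exec (.const x c) s (len c) (s.setReg x c)
  | arith (s : State) (o : Op) (x y z : ℕ) :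
      Exec (.arith o x y z) s (len (s.reg y) + len (s.reg z))
        (s.setReg x (o.eval (s.reg y) (s.reg z)))
  | load (s : State) (x A y : ℕ) :
      Exec (.load x A y) s (len (s.reg y) + len (s.mem A (s.reg y)))
        (s.setReg x (s.mem A (s.reg y)))
  | store (s : State) (A x y : ℕ) :
      Exec (.store A x y) s (len (s.reg x) + len (s.reg y))
        (s.setMem A (s.reg x) (s.reg y))
  | seq {P Q : Prog} {s s' s'' : State} {t t' : ℕ} :
      Exec P s t s' → Exec Q s' t' s'' → Exec (.seq P Q) s (t + t') s''
  | ite_true {P Q : Prog} {s s' : State} {t x : ℕ} :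
      s.reg x ≠ 0 → Exec P s t s' → Exec (.ite x P Q) s (len (s.reg x) + t) s'
  | ite_false {P Q : Prog} {s s' : State} {t x : ℕ} :
      s.reg x = 0 → Exec Q s t s' → Exec (.ite x P Q) s (len (s.reg x) + t) s'
  | loop_done {P : Prog} {s : State} {x : ℕ} :
      s.reg x = 0 → Exec (.loop x P) s (len (s.reg x)) s
  | loop_step {P : Prog} {s s' s'' : State} {t t' x : ℕ} :
      s.reg x ≠ 0 → Exec P s t s' → Exec (.loop x P) s' t' s'' →
        Exec (.loop x P) s (len (s.reg x) + t + t') s''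

end RAM

/-- `T = Õ(f)`: up to a constant factor and a polylogarithmic factor, `T` is at most `f`.
(The summands `1` and `2` only take care of the values `f a = 0` and `f a = 1`.) -/
def IsSoftO {α : Type*} (T f : α → ℕ) : Prop :=
  ∃ c d : ℕ, ∀ a, T a ≤ c * (f a + 1) * Nat.log 2 (f a + 2) ^ d

/-- An instance of makespan minimization on `m` unrelated machines in which the processing time
of job `j` on machine `i` is either `p_j` or infinite. -/
structure EligibilityInstance (m : ℕ) where
  /-- the number of jobs -/
  n : ℕ
  /-- the processing times of the jobs -/
  p : Fin n → ℕ
  /-- the set of machines that can process a job -/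
  M : Fin n → Finset (Fin m)

namespace EligibilityInstance

variable {m : ℕ} (I : EligibilityInstance m)

/-- The processing time `p_{i,j}` of job `j` on machine `i`. -/
def time (i : Fin m) (j : Fin I.n) : ℕ∞ := if i ∈ I.M j then (I.p j : ℕ∞) else ⊤

/-- The maximum processing time `p_max` in the input (`0` if there are no jobs). -/
def pmax : ℕ := Finset.univ.sup I.p

/-- The total processing time on machine `i` under the schedule `σ`. -/
def load (σ : Fin I.n → Fin m) (i : Fin m) : ℕ∞ := ∑ j with σ j = i, I.time i j

/-- The makespan of the schedule `σ`. -/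
noncomputable def makespan (σ : Fin I.n → Fin m) : ℕ∞ := Finset.univ.sup (I.load σ)

/-- `σ` is a schedule of minimum makespan. -/
def IsOptimal (σ : Fin I.n → Fin m) : Prop := ∀ τ : Fin I.n → Fin m, I.makespan σ ≤ I.makespan τ

/-- The input as presented to the machine: register `0` holds the number of jobs, array `0` holds
the processing times, array `1` holds the `0`/`1` eligibility table (row `j` in the cells
`m * j, …, m * j + m - 1`), and everything else is `0`. -/
def input : RAM.State where
  reg x := if x = 0 then I.n else 0
  mem A k :=
    if A = 0 then (if h : k < I.n then I.p ⟨k, h⟩ else 0)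
    else if A = 1 then
      (if ∃ (j : Fin I.n) (i : Fin m), i ∈ I.M j ∧ k = m * (j : ℕ) + (i : ℕ) then 1 else 0)
    else 0

/-- The schedule `σ` stands in the first `n` cells of array `2` (machines numbered from `0`). -/
def IsOutput (s : RAM.State) (σ : Fin I.n → Fin m) : Prop :=
  ∀ j : Fin I.n, s.mem 2 (j : ℕ) = (σ j : ℕ)

end EligibilityInstance

/-- On every instance with `m` machines, the program `P` halts at cost at most `T` with an
optimal schedule as its output. -/
def SolvesInTime (m : ℕ) (P : RAM.Prog) (T : EligibilityInstance m → ℕ) : Prop :=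
  ∀ I : EligibilityInstance m, ∃ (t : ℕ) (s : RAM.State) (σ : Fin I.n → Fin m),
    RAM.Exec P I.input t s ∧ t ≤ T I ∧ I.IsOutput s σ ∧ I.IsOptimal σ

/-!
Cover the jobs with the same eligible machines by units of size `p_max + 1`, and insert the units
one at a time, each insertion being followed by a cascade of moves, so that no unit could move to
a machine carrying two units fewer. Filling the units with the jobs gives a schedule `y` in which
no job of positive size stands on a machine whose load exceeds the load of another of its eligible
machines by more than `O(p_max)`.

Let `x` be an optimal schedule as near to `y` as possible: no nonempty set of jobs can return to
its machines in `y` without raising the makespan. Call a pair `(a, b)` of machines heavy if many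
jobs of one size move from `a` in `y` to `b` in `x`. Following heavy pairs forwards from `b` leads
to a machine whose load has grown a lot, following them backwards from `a` to one whose load has
shrunk a lot. Along a trail of heavy pairs from the latter to the former, jobs of the same total
size can return on every pair: this leaves the loads of the inner machines unchanged, and since
`y` is balanced, it only shifts load from a machine with a large load in `x` to one with a small
load, contrary to the choice of `x`. The product of the job sizes along the trail serves as
the common total. Hence only `O(p_max ^ (m + 1))` jobs of each class (size, eligible machines,
machine in `y`) differ between `x` and `y`, and these may be taken to be the first of their class.

All other jobs therefore keep their machines of `y`, and the released `O(p_max ^ (m + 2))` jobs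
are scheduled by a dynamic program over the loads of `m - 1` machines, each of which takes
`O(p_max ^ (m + 3))` values.
-/

/-! ### Structured programs -/

namespace RAM

open Encodable

theorem len_mono {a b : ℕ} (h : a ≤ b) : len a ≤ len b :=
  Nat.succ_le_succ (Nat.size_le_size h)

theorem one_le_len (a : ℕ) : 1 ≤ len a := Nat.succ_pos _

theorem size_add_le (a b : ℕ) : (a + b).size ≤ a.size + b.size + 1 := by
  have ha : 2 ^ a.size ≤ 2 ^ (a.size + b.size) := Nat.pow_le_pow_right two_pos (by omega)
  have hb : 2 ^ b.size ≤ 2 ^ (a.size + b.size) := Nat.pow_le_pow_right two_pos (by omega)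
  rw [Nat.size_le, pow_succ]
  have := a.lt_size_self
  have := b.lt_size_self
  omega

theorem size_mul_le (a b : ℕ) : (a * b).size ≤ a.size + b.size := by
  rw [Nat.size_le, pow_add]
  exact Nat.mul_lt_mul'' a.lt_size_self b.lt_size_self

theorem len_eval_le (o : Op) (a b : ℕ) : len (o.eval a b) ≤ len a + len b := by
  cases o
  case add => have := size_add_le a b; simp only [Op.eval, len]; omega
  case sub => exact (len_mono (Nat.sub_le a b)).trans (Nat.le_add_right _ _)
  case mul => have := size_mul_le a b; simp only [Op.eval, len]; omega
  case div => exact (len_mono (Nat.div_le_self a b)).trans (Nat.le_add_right _ _)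

@[simp] theorem State.reg_setReg (s : State) (x v y : ℕ) :
    (s.setReg x v).reg y = if y = x then v else s.reg y :=
  Function.update_apply ..

@[simp] theorem State.mem_setMem (s : State) (A k v A' : ℕ) :
    (s.setMem A k v).mem A' = if A' = A then Function.update (s.mem A) k v else s.mem A' :=
  Function.update_apply ..

/-- The memory of a structured program whose variables form the type `V` and whose arrays form the
type `A`. -/
structure Store (V A : Type*) where
  var : V → ℕ
  arr : A → ℕ → ℕ

/-- Expressions of structured programs. -/
inductive Expr (V A : Type*) where
  | lit (k : ℕ)
  | var (x : V)
  | op (o : Op) (a b : Expr V A)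
  | cell (T : A) (a : Expr V A)

/-- Structured programs. The command `iter e P` evaluates `e` once, and then executes `P` that many
times; so structured programs always terminate. -/
inductive Cmd (V A : Type*) where
  | skip
  | assign (x : V) (e : Expr V A)
  | store (T : A) (a e : Expr V A)
  | seq (P Q : Cmd V A)
  | ite (e : Expr V A) (P Q : Cmd V A)
  | iter (e : Expr V A) (P : Cmd V A)

/-- Sequential composition of structured programs. -/
infixr:60 " ;; " => Cmd.seq

/-- Assignment to a variable. -/
infix:62 " ::= " => Cmd.assign

section Semantics

variable {V A : Type*}

namespace Expr

instance : NatCast (Expr V A) := ⟨lit⟩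
instance (k : ℕ) : OfNat (Expr V A) k := ⟨lit k⟩
instance : Add (Expr V A) := ⟨op .add⟩
instance : Sub (Expr V A) := ⟨op .sub⟩
instance : Mul (Expr V A) := ⟨op .mul⟩
instance : Div (Expr V A) := ⟨op .div⟩

/-- The value of an expression. -/
def eval (σ : Store V A) : Expr V A → ℕ
  | lit k => k
  | var x => σ.var x
  | op o a b => o.eval (a.eval σ) (b.eval σ)
  | cell T a => σ.arr T (a.eval σ)

variable (σ : Store V A) (a b : Expr V A)

@[simp] theorem eval_lit (k : ℕ) : (lit k).eval σ = k := rfl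
@[simp] theorem eval_natCast (k : ℕ) : (k : Expr V A).eval σ = k := rfl
@[simp] theorem eval_ofNat (k : ℕ) :
    (no_index (OfNat.ofNat k) : Expr V A).eval σ = OfNat.ofNat k := rfl
@[simp] theorem eval_var (x : V) : (var x).eval σ = σ.var x := rfl
@[simp] theorem eval_cell (T : A) : (cell T a).eval σ = σ.arr T (a.eval σ) := rfl
@[simp] theorem eval_add : (a + b).eval σ = a.eval σ + b.eval σ := rfl
@[simp] theorem eval_sub : (a - b).eval σ = a.eval σ - b.eval σ := rfl
@[simp] theorem eval_mul : (a * b).eval σ = a.eval σ * b.eval σ := rfl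
@[simp] theorem eval_div : (a / b).eval σ = a.eval σ / b.eval σ := rfl

end Expr

namespace Store

/-- All contents of the store are at most `B`. -/
structure Bdd (B : ℕ) (σ : Store V A) : Prop where
  var : ∀ x, σ.var x ≤ B
  arr : ∀ T k, σ.arr T k ≤ B

section setVar

variable [DecidableEq V] {σ : Store V A} {B v : ℕ}

/-- The store `σ` with the variable `x` overwritten by `v`. -/
def setVar (σ : Store V A) (x : V) (v : ℕ) : Store V A :=
  { σ with var := Function.update σ.var x v }

@[simp] theorem var_setVar (x y : V) : (σ.setVar x v).var y = if y = x then v else σ.var y :=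
  Function.update_apply ..

@[simp] theorem arr_setVar (x : V) : (σ.setVar x v).arr = σ.arr := rfl

theorem setVar_eq_self {x : V} (h : σ.var x = v) : σ.setVar x v = σ := by
  simp only [setVar, ← h, Function.update_eq_self]

theorem Bdd.setVar (hσ : σ.Bdd B) (hv : v ≤ B) (x : V) : (σ.setVar x v).Bdd B where
  var y := by rw [var_setVar]; split_ifs <;> [exact hv; exact hσ.var y]
  arr := hσ.arr

end setVar

section setArr

variable [DecidableEq A] {σ : Store V A} {B v : ℕ}

/-- The store `σ` with cell `k` of the array `T` overwritten by `v`. -/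
def setArr (σ : Store V A) (T : A) (k v : ℕ) : Store V A :=
  { σ with arr := Function.update σ.arr T (Function.update (σ.arr T) k v) }

@[simp] theorem var_setArr (T : A) (k : ℕ) : (σ.setArr T k v).var = σ.var := rfl

@[simp] theorem arr_setArr (T T' : A) (k : ℕ) :
    (σ.setArr T k v).arr T' = if T' = T then Function.update (σ.arr T) k v else σ.arr T' :=
  Function.update_apply ..

theorem Bdd.setArr (hσ : σ.Bdd B) (hv : v ≤ B) (T : A) (k : ℕ) : (σ.setArr T k v).Bdd B where
  var := hσ.var
  arr T' k' := by
    rw [arr_setArr]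
    split_ifs
    · rw [Function.update_apply]
      split_ifs <;> [exact hv; exact hσ.arr T k']
    · exact hσ.arr T' k'

end setArr

end Store

namespace Cmd

/-- The variables that a program may change. -/
def vars : Cmd V A → List V
  | assign x _ => [x]
  | seq P Q | ite _ P Q => P.vars ++ Q.vars
  | iter _ P => P.vars
  | skip | store .. => []

/-- The arrays that a program may change. -/
def arrays : Cmd V A → List A
  | store T _ _ => [T]
  | seq P Q | ite _ P Q => P.arrays ++ Q.arrays
  | iter _ P => P.arrays
  | skip | assign .. => []

/-- The stores `σ` and `τ` agree on everything that the program `c` does not change. -/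
structure Frame (c : Cmd V A) (σ τ : Store V A) : Prop where
  var : ∀ x ∉ c.vars, τ.var x = σ.var x
  arr : ∀ T ∉ c.arrays, τ.arr T = σ.arr T

theorem Frame.refl (c : Cmd V A) (σ : Store V A) : Frame c σ σ := ⟨fun _ _ => rfl, fun _ _ => rfl⟩

theorem Frame.trans {c : Cmd V A} {σ τ υ : Store V A} (h : Frame c σ τ) (h' : Frame c τ υ) :
    Frame c σ υ :=
  ⟨fun x hx => (h'.var x hx).trans (h.var x hx), fun T hT => (h'.arr T hT).trans (h.arr T hT)⟩

theorem Frame.mono {c c' : Cmd V A} {σ τ : Store V A} (h : Frame c σ τ) (hv : c.vars ⊆ c'.vars)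
    (ha : c.arrays ⊆ c'.arrays) : Frame c' σ τ :=
  ⟨fun x hx => h.var x fun hx' => hx (hv hx'), fun T hT => h.arr T fun hT' => hT (ha hT')⟩

variable [DecidableEq V] [DecidableEq A]

/-- The store in which a program ends. -/
def run : Cmd V A → Store V A → Store V A
  | skip, σ => σ
  | assign x e, σ => σ.setVar x (e.eval σ)
  | store T a e, σ => σ.setArr T (a.eval σ) (e.eval σ)
  | seq P Q, σ => Q.run (P.run σ)
  | ite e P Q, σ => if e.eval σ = 0 then Q.run σ else P.run σ
  | iter e P, σ => P.run^[e.eval σ] σ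

/-- The number of elementary commands executed by a program. -/
def steps : Cmd V A → Store V A → ℕ
  | skip, _ | assign .., _ | store .., _ => 1
  | seq P Q, σ => P.steps σ + Q.steps (P.run σ)
  | ite e P Q, σ => (if e.eval σ = 0 then Q.steps σ else P.steps σ) + 1
  | iter e P, σ => ∑ i ∈ Finset.range (e.eval σ), (P.steps (P.run^[i] σ) + 1) + 1

/-- No number above `B` is stored during the execution of a program. -/
def Safe (B : ℕ) : Cmd V A → Store V A → Prop
  | skip, _ => True
  | assign _ e, σ | store _ _ e, σ => e.eval σ ≤ B
  | seq P Q, σ => P.Safe B σ ∧ Q.Safe B (P.run σ)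
  | ite e P Q, σ => if e.eval σ = 0 then Q.Safe B σ else P.Safe B σ
  | iter e P, σ => e.eval σ ≤ B ∧ ∀ i < e.eval σ, P.Safe B (P.run^[i] σ)

theorem iter_run_succ (P : Cmd V A) (i : ℕ) (σ : Store V A) :
    P.run^[i + 1] σ = P.run (P.run^[i] σ) :=
  Function.iterate_succ_apply' ..

theorem Safe.bdd_run {B : ℕ} (c : Cmd V A) {σ : Store V A} (hσ : σ.Bdd B) (h : c.Safe B σ) :
    (c.run σ).Bdd B := by
  induction c generalizing σ with
  | skip => exact hσ
  | assign x e => exact hσ.setVar h x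
  | store T a e => exact hσ.setArr h T _
  | seq P Q ihP ihQ => exact ihQ (ihP hσ h.1) h.2
  | ite e P Q ihP ihQ =>
    rw [Safe] at h
    rw [run]
    split_ifs at h ⊢ <;> [exact ihQ hσ h; exact ihP hσ h]
  | iter e P ih =>
    suffices ∀ i ≤ e.eval σ, (P.run^[i] σ).Bdd B from this _ le_rfl
    intro i hi
    induction i with
    | zero => exact hσ
    | succ i ihi => exact iter_run_succ P i σ ▸ ih (ihi (Nat.le_of_succ_le hi)) (h.2 i hi)

theorem frame_run (c : Cmd V A) (σ : Store V A) : Frame c σ (c.run σ) := by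
  induction c generalizing σ with
  | skip => exact .refl _ σ
  | assign x e => exact ⟨fun y hy => by simp_all [vars, run], fun _ _ => rfl⟩
  | store T a e => exact ⟨fun _ _ => rfl, fun T' hT' => by simp_all [arrays, run]⟩
  | seq P Q ihP ihQ =>
    exact ((ihP σ).mono (List.subset_append_left ..) (List.subset_append_left ..)).trans
      ((ihQ _).mono (List.subset_append_right ..) (List.subset_append_right ..))
  | ite e P Q ihP ihQ =>
    rw [run]
    split_ifs
    · exact (ihQ σ).mono (List.subset_append_right ..) (List.subset_append_right ..)
    · exact (ihP σ).mono (List.subset_append_left ..) (List.subset_append_left ..)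
  | iter e P ih =>
    rw [run]
    induction e.eval σ with
    | zero => exact .refl _ σ
    | succ i ihi =>
      exact iter_run_succ P i σ ▸ ihi.trans ((ih _).mono (fun _ h => h) (fun _ h => h))

end Cmd

end Semantics

section Compilation

variable {V A : Type*}

namespace Expr

/-- The length of the value of an expression is at most this multiple of `len B` if all contents of
the store are at most `B`. -/
def width : Expr V A → ℕ
  | lit k => len k
  | op _ a b => a.width + b.width
  | var _ | cell _ _ => 1

/-- The cost of evaluating an expression is at most this multiple of `len B` if all contents of the
store are at most `B`. -/
def cost : Expr V A → ℕ
  | lit k => len k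
  | var _ => 3
  | op _ a b => a.cost + b.cost + (a.width + b.width)
  | cell _ a => a.cost + a.width + 1

theorem len_eval_le {B : ℕ} {σ : Store V A} (hσ : σ.Bdd B) (e : Expr V A) :
    len (e.eval σ) ≤ e.width * len B := by
  induction e with
  | lit k => exact Nat.le_mul_of_pos_right _ (one_le_len B)
  | var x => exact (len_mono (hσ.var x)).trans_eq (one_mul _).symm
  | op o a b iha ihb =>
    rw [width, add_mul]
    exact (RAM.len_eval_le o _ _).trans (add_le_add iha ihb)
  | cell T a _ => exact (len_mono (hσ.arr T _)).trans_eq (one_mul _).symm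

end Expr

variable [Encodable V] [Encodable A]

/-- The register that holds the variable `x`. -/
def varReg (x : V) : ℕ := 3 * encode x

/-- The register that counts the remaining iterations of a loop inside `d` other loops. -/
def counterReg (d : ℕ) : ℕ := 3 * d + 1

/-- The registers that hold intermediate results. -/
def tempReg (t : ℕ) : ℕ := 3 * t + 2

theorem varReg_ne_tempReg (x : V) (t : ℕ) : varReg x ≠ tempReg t := by
  unfold varReg tempReg; omega

theorem varReg_ne_counterReg (x : V) (d : ℕ) : varReg x ≠ counterReg d := by
  unfold varReg counterReg; omega

theorem counterReg_ne_tempReg (d t : ℕ) : counterReg d ≠ tempReg t := by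
  unfold counterReg tempReg; omega

/-- The machine state `s` represents the store `σ` of a structured program. -/
structure Represents (s : State) (σ : Store V A) : Prop where
  var : ∀ x, s.reg (varReg x) = σ.var x
  arr : ∀ T, s.mem (encode T) = σ.arr T

/-- The registers other than the temporary registers `t, t + 1, …` agree. -/
def AgreeBelow (t : ℕ) (s s' : State) : Prop :=
  ∀ y, (∀ u ≥ t, y ≠ tempReg u) → s'.reg y = s.reg y

theorem AgreeBelow.trans {t t' : ℕ} {s s' s'' : State} (h : AgreeBelow t s s')
    (h' : AgreeBelow t' s' s'') (ht : t ≤ t') : AgreeBelow t s s'' := fun y hy =>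
  (h' y fun u hu => hy u (ht.trans hu)).trans (h y hy)

theorem AgreeBelow.setReg_tempReg (t : ℕ) (s : State) (v : ℕ) :
    AgreeBelow t s (s.setReg (tempReg t) v) := fun y hy => by
  rw [State.reg_setReg, if_neg (hy t le_rfl)]

theorem AgreeBelow.counterReg {t d : ℕ} {s s' : State} (h : AgreeBelow t s s') :
    s'.reg (counterReg d) = s.reg (counterReg d) :=
  h _ fun u _ => counterReg_ne_tempReg d u

theorem AgreeBelow.tempReg {t u : ℕ} {s s' : State} (h : AgreeBelow t s s') (hu : u < t) :
    s'.reg (tempReg u) = s.reg (tempReg u) :=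
  h _ fun v _ => by unfold RAM.tempReg; omega

theorem AgreeBelow.represents {t : ℕ} {s s' : State} {σ : Store V A} (h : AgreeBelow t s s')
    (hmem : s'.mem = s.mem) (hs : Represents s σ) : Represents s' σ where
  var x := (h _ fun u _ => varReg_ne_tempReg x u).trans (hs.var x)
  arr T := hmem ▸ hs.arr T

theorem Represents.setReg {s : State} {σ : Store V A} (h : Represents s σ) {y : ℕ} (v : ℕ)
    (hy : ∀ x : V, varReg x ≠ y) : Represents (s.setReg y v) σ where
  var x := by rw [State.reg_setReg, if_neg (hy x), h.var]
  arr := h.arr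

theorem Represents.setVar [DecidableEq V] {s : State} {σ : Store V A} (h : Represents s σ) (x : V)
    (v : ℕ) : Represents (s.setReg (varReg x) v) (σ.setVar x v) where
  var y := by
    have : varReg y = varReg x ↔ y = x := by simp [varReg]
    simp only [State.reg_setReg, Store.var_setVar, this, h.var]
  arr := h.arr

theorem Represents.setArr [DecidableEq A] {s : State} {σ : Store V A} (h : Represents s σ) (T : A)
    (k v : ℕ) : Represents (s.setMem (encode T) k v) (σ.setArr T k v) where
  var := h.var
  arr T' := by simp only [State.mem_setMem, Store.arr_setArr, encode_inj, h.arr]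

namespace Expr

/-- Code that puts the value of an expression into the temporary register `t`. -/
def code : Expr V A → ℕ → Prog
  | lit k, t => .const (tempReg t) k
  | var x, t => .seq (.const (tempReg t) 0) (.arith .add (tempReg t) (varReg x) (tempReg t))
  | op o a b, t =>
    .seq (a.code t) (.seq (b.code (t + 1)) (.arith o (tempReg t) (tempReg t) (tempReg (t + 1))))
  | cell T a, t => .seq (a.code t) (.load (tempReg t) (encode T) (tempReg t))

/-- Code that puts the value of an expression into the register `y`. -/
def codeInto (e : Expr V A) (y : ℕ) : Prog :=
  .seq (e.code 0) (.seq (.const (tempReg 1) 0) (.arith .add y (tempReg 0) (tempReg 1)))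

variable {B : ℕ} {σ : Store V A} {s : State}

theorem exec_code (hσ : σ.Bdd B) (e : Expr V A) (t : ℕ) (hs : Represents s σ) :
    ∃ c s', Exec (e.code t) s c s' ∧ c ≤ e.cost * len B ∧ s'.mem = s.mem ∧
      s'.reg (tempReg t) = e.eval σ ∧ AgreeBelow t s s' := by
  induction e generalizing t s with
  | lit k =>
    exact ⟨_, _, .const s _ k, Nat.le_mul_of_pos_right _ (one_le_len B), rfl, by simp,
      .setReg_tempReg t s k⟩
  | var x =>
    have hx := varReg_ne_tempReg x t
    refine ⟨_, _, (Exec.const s _ 0).seq (.arith _ .add _ _ _), ?_, rfl, ?_,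
      (AgreeBelow.setReg_tempReg t s 0).trans (.setReg_tempReg t _ _) le_rfl⟩
    · have := len_mono (hσ.var x)
      have := len_mono (Nat.zero_le B)
      simp only [State.reg_setReg, if_neg hx, if_true, hs.var, cost]
      omega
    · simp [hx, hs.var, Op.eval]
  | op o a b iha ihb =>
    obtain ⟨c₁, s₁, exec₁, cost₁, mem₁, val₁, agree₁⟩ := iha t hs
    obtain ⟨c₂, s₂, exec₂, cost₂, mem₂, val₂, agree₂⟩ :=
      ihb (t + 1) (agree₁.represents mem₁ hs)
    have val₁' : s₂.reg (tempReg t) = a.eval σ := (agree₂.tempReg t.lt_succ_self).trans val₁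
    refine ⟨_, _, exec₁.seq (exec₂.seq (.arith s₂ o _ _ _)), ?_, mem₂.trans mem₁, ?_,
      (agree₁.trans agree₂ t.le_succ).trans (.setReg_tempReg t s₂ _) le_rfl⟩
    · have := len_eval_le hσ a
      have := len_eval_le hσ b
      rw [val₁', val₂, cost, add_mul, add_mul, add_mul]
      omega
    · simp [val₁', val₂, eval]
  | cell T a iha =>
    obtain ⟨c₁, s₁, exec₁, cost₁, mem₁, val₁, agree₁⟩ := iha t hs
    refine ⟨_, _, exec₁.seq (.load s₁ _ _ _), ?_, mem₁, ?_,
      agree₁.trans (.setReg_tempReg t s₁ _) le_rfl⟩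
    · have := len_eval_le hσ a
      have := len_mono (hσ.arr T (a.eval σ))
      rw [val₁, mem₁, hs.arr, cost, add_mul, add_mul, one_mul]
      omega
    · simp [val₁, mem₁, hs.arr, eval]

theorem exec_codeInto (hσ : σ.Bdd B) (e : Expr V A) (y : ℕ) (hs : Represents s σ) :
    ∃ c s', Exec (e.codeInto y) s c (s'.setReg y (e.eval σ)) ∧
      c ≤ (e.cost + e.width + 2) * len B ∧ s'.mem = s.mem ∧ AgreeBelow 0 s s' := by
  obtain ⟨c, s', exec, cost_le, mem, val, agree⟩ := e.exec_code hσ 0 hs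
  have htemp : tempReg 0 ≠ tempReg 1 := by decide
  have hval := Exec.arith (s'.setReg (tempReg 1) 0) .add y (tempReg 0) (tempReg 1)
  simp only [State.reg_setReg, if_neg htemp, if_true, val, Op.eval, add_zero] at hval
  refine ⟨_, _, exec.seq ((Exec.const s' (tempReg 1) 0).seq hval), ?_, mem,
    agree.trans (.setReg_tempReg 1 s' 0) zero_le_one⟩
  have := len_eval_le hσ e
  have := len_mono (Nat.zero_le B)
  rw [add_mul, add_mul]
  omega

end Expr

namespace Cmd

/-- The cost of one step of a program is at most this multiple of `len B` if the program handles
no number above `B`. -/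
def cost : Cmd V A → ℕ
  | skip => 1
  | assign _ e => e.cost + e.width + 2
  | store _ a e => a.cost + e.cost + (a.width + e.width)
  | seq P Q => P.cost + Q.cost
  | ite e P Q => e.cost + e.width + (P.cost + Q.cost)
  | iter e P => e.cost + e.width + 6 + P.cost

/-- The compiler; `d` is the number of enclosing loops. -/
def code : Cmd V A → ℕ → Prog
  | skip, _ => .skip
  | assign x e, _ => e.codeInto (varReg x)
  | store T a e, _ =>
    .seq (a.code 0) (.seq (e.code 1) (.store (encode T) (tempReg 0) (tempReg 1)))
  | seq P Q, d => .seq (P.code d) (Q.code d)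
  | ite e P Q, d => .seq (e.code 0) (.ite (tempReg 0) (P.code d) (Q.code d))
  | iter e P, d =>
    .seq (e.codeInto (counterReg d)) (.loop (counterReg d) (.seq (P.code (d + 1))
      (.seq (.const (tempReg 0) 1) (.arith .sub (counterReg d) (counterReg d) (tempReg 0)))))

variable [DecidableEq V] [DecidableEq A] {B : ℕ}

/-- Started in a representation of `σ` inside `d` loops, the code of `c` computes a representation
of `c.run σ`, at the expected cost. -/
def Compiles (B : ℕ) (c : Cmd V A) (d : ℕ) (σ : Store V A) (s : State) : Prop :=
  ∃ t s', Exec (c.code d) s t s' ∧ t ≤ c.steps σ * (c.cost * len B) ∧ Represents s' (c.run σ) ∧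
    ∀ d' < d, s'.reg (counterReg d') = s.reg (counterReg d')

theorem exec_loop {P : Cmd V A} {d : ℕ} (hP : ∀ σ s, σ.Bdd B → P.Safe B σ → Represents s σ →
      P.Compiles B (d + 1) σ s) {r : ℕ} (hr : r ≤ B) {σ : Store V A} {s : State} (hσ : σ.Bdd B)
    (hsafe : ∀ i < r, P.Safe B (P.run^[i] σ)) (hs : Represents s σ)
    (hcounter : s.reg (counterReg d) = r) :
    ∃ t s', Exec (.loop (counterReg d) (.seq (P.code (d + 1)) (.seq (.const (tempReg 0) 1)
        (.arith .sub (counterReg d) (counterReg d) (tempReg 0))))) s t s' ∧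
      t ≤ (∑ i ∈ Finset.range r, (P.steps (P.run^[i] σ) + 1)) * ((P.cost + 6) * len B) + len B ∧
      Represents s' (P.run^[r] σ) ∧ ∀ d' < d, s'.reg (counterReg d') = s.reg (counterReg d') := by
  have h0 : len 0 ≤ len B := len_mono (Nat.zero_le B)
  have h1 : len 1 ≤ 2 * len B := by have := one_le_len B; have : len 1 = 2 := rfl; omega
  induction r generalizing σ s with
  | zero => exact ⟨_, s, .loop_done hcounter, by simpa [hcounter] using h0, hs, fun _ _ => rfl⟩
  | succ r ih =>
    have hlen : len (r + 1) ≤ len B := len_mono hr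
    have hct := counterReg_ne_tempReg d 0
    obtain ⟨t₁, s₁, exec₁, cost₁, repr₁, keep₁⟩ := hP σ s hσ (hsafe 0 r.succ_pos) hs
    have counter₁ : s₁.reg (counterReg d) = r + 1 := (keep₁ d d.lt_succ_self).trans hcounter
    set s₂ := (s₁.setReg (tempReg 0) 1).setReg (counterReg d) r with hs₂
    have exec₂ : Exec (.seq (.const (tempReg 0) 1)
        (.arith .sub (counterReg d) (counterReg d) (tempReg 0))) s₁
        (len 1 + (len (r + 1) + len 1)) s₂ := by
      simpa [hct, counter₁, Op.eval, hs₂] using (Exec.const s₁ (tempReg 0) 1).seq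
        (.arith _ .sub (counterReg d) (counterReg d) (tempReg 0))
    obtain ⟨t₃, s₃, exec₃, cost₃, repr₃, keep₃⟩ := ih (Nat.le_of_succ_le hr)
      (Safe.bdd_run P hσ (hsafe 0 r.succ_pos)) (fun i hi => hsafe (i + 1) (by omega))
      (s := s₂) ((repr₁.setReg _ (varReg_ne_tempReg · 0)).setReg _
        (varReg_ne_counterReg · d)) (by simp [hs₂])
    refine ⟨_, s₃, .loop_step (by omega) (exec₁.seq exec₂) exec₃, ?_, repr₃, fun d' hd' => ?_⟩
    · rw [Finset.sum_range_succ', hcounter]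
      simp only [Function.iterate_succ_apply, Function.iterate_zero, id]
      nlinarith [Nat.zero_le (P.steps σ * len B)]
    · have : counterReg d' ≠ counterReg d := by unfold counterReg; omega
      rw [keep₃ d' hd', hs₂, State.reg_setReg, if_neg this, State.reg_setReg,
        if_neg (counterReg_ne_tempReg d' 0), keep₁ d' (by omega)]

theorem compiles_ite {e : Expr V A} {P Q : Cmd V A} {d : ℕ} {σ : Store V A} {s : State}
    (hσ : σ.Bdd B) (hs : Represents s σ)
    (hP : e.eval σ ≠ 0 → ∀ s, Represents s σ → P.Compiles B d σ s)
    (hQ : e.eval σ = 0 → ∀ s, Represents s σ → Q.Compiles B d σ s) :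
    (ite e P Q).Compiles B d σ s := by
  obtain ⟨t, s₁, exec₁, cost₁, mem₁, val₁, agree₁⟩ := e.exec_code hσ 0 hs
  have hlen := e.len_eval_le hσ
  by_cases he : e.eval σ = 0
  · obtain ⟨t', s₂, exec₂, cost₂, repr₂, keep₂⟩ := hQ he s₁ (agree₁.represents mem₁ hs)
    refine ⟨_, s₂, exec₁.seq (.ite_false (val₁.trans he) exec₂), ?_, by rwa [run, if_pos he],
      fun d' hd' => (keep₂ d' hd').trans agree₁.counterReg⟩
    rw [steps, if_pos he, cost, val₁]
    nlinarith [Nat.zero_le (Q.steps σ * (len B * (e.cost + e.width + P.cost))),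
      Nat.zero_le (len B * (P.cost + Q.cost))]
  · obtain ⟨t', s₂, exec₂, cost₂, repr₂, keep₂⟩ := hP he s₁ (agree₁.represents mem₁ hs)
    refine ⟨_, s₂, exec₁.seq (.ite_true (by rwa [val₁]) exec₂), ?_, by rwa [run, if_neg he],
      fun d' hd' => (keep₂ d' hd').trans agree₁.counterReg⟩
    rw [steps, if_neg he, cost, val₁]
    nlinarith [Nat.zero_le (P.steps σ * (len B * (e.cost + e.width + Q.cost))),
      Nat.zero_le (len B * (P.cost + Q.cost))]

theorem compiles_iter {e : Expr V A} {P : Cmd V A} {d : ℕ} {σ : Store V A} {s : State}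
    (hP : ∀ σ s, σ.Bdd B → P.Safe B σ → Represents s σ → P.Compiles B (d + 1) σ s)
    (hσ : σ.Bdd B) (hsafe : (iter e P).Safe B σ) (hs : Represents s σ) :
    (iter e P).Compiles B d σ s := by
  obtain ⟨t, s₁, exec₁, cost₁, mem₁, agree₁⟩ := e.exec_codeInto hσ (counterReg d) hs
  obtain ⟨t', s₂, exec₂, cost₂, repr₂, keep₂⟩ := exec_loop hP hsafe.1 hσ hsafe.2
    ((agree₁.represents mem₁ hs).setReg (e.eval σ)
      (varReg_ne_counterReg · d)) (by simp)
  refine ⟨_, s₂, exec₁.seq exec₂, ?_, repr₂, fun d' hd' => ?_⟩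
  · rw [steps, cost]
    nlinarith [Nat.zero_le ((∑ i ∈ Finset.range (e.eval σ), (P.steps (P.run^[i] σ) + 1)) *
      ((e.cost + e.width) * len B)), Nat.zero_le (P.cost * len B)]
  · have : counterReg d' ≠ counterReg d := by unfold counterReg; omega
    rw [keep₂ d' hd', State.reg_setReg, if_neg this, agree₁.counterReg]

theorem compiles (c : Cmd V A) (d : ℕ) {σ : Store V A} {s : State} (hσ : σ.Bdd B)
    (hsafe : c.Safe B σ) (hs : Represents s σ) : c.Compiles B d σ s := by
  induction c generalizing d σ s with
  | skip => exact ⟨1, s, .skip s, by simpa [steps, cost] using one_le_len B, hs, fun _ _ => rfl⟩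
  | assign x e =>
    obtain ⟨t, s', exec, cost_le, mem, agree⟩ := e.exec_codeInto hσ (varReg x) hs
    refine ⟨t, _, exec, by simpa [steps, cost] using cost_le,
      (agree.represents mem hs).setVar x _, fun d' _ => ?_⟩
    rw [State.reg_setReg, if_neg (varReg_ne_counterReg x d').symm, agree.counterReg]
  | store T a e =>
    obtain ⟨t, s₁, exec₁, cost₁, mem₁, val₁, agree₁⟩ := a.exec_code hσ 0 hs
    obtain ⟨t', s₂, exec₂, cost₂, mem₂, val₂, agree₂⟩ :=
      e.exec_code hσ 1 (agree₁.represents mem₁ hs)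
    have val₁' : s₂.reg (tempReg 0) = a.eval σ := (agree₂.tempReg zero_lt_one).trans val₁
    have agree := agree₁.trans agree₂ zero_le_one
    have exec₃ := Exec.store s₂ (encode T) (tempReg 0) (tempReg 1)
    rw [val₁', val₂] at exec₃
    refine ⟨_, _, exec₁.seq (exec₂.seq exec₃), ?_,
      (agree.represents (mem₂.trans mem₁) hs).setArr T _ _, fun d' _ => agree.counterReg⟩
    have := e.len_eval_le hσ
    have := a.len_eval_le hσ
    rw [steps, cost, one_mul, add_mul, add_mul, add_mul]
    omega
  | seq P Q ihP ihQ =>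
    obtain ⟨t, s₁, exec₁, cost₁, repr₁, keep₁⟩ := ihP d hσ hsafe.1 hs
    obtain ⟨t', s₂, exec₂, cost₂, repr₂, keep₂⟩ := ihQ d (hsafe.1.bdd_run P hσ) hsafe.2 repr₁
    refine ⟨_, s₂, exec₁.seq exec₂, (add_le_add cost₁ cost₂).trans ?_, repr₂,
      fun d' hd' => (keep₂ d' hd').trans (keep₁ d' hd')⟩
    rw [steps, cost, add_mul]
    gcongr <;> omega
  | ite e P Q ihP ihQ =>
    rw [Safe] at hsafe
    exact compiles_ite hσ hs (fun he s hs => ihP d hσ (by rwa [if_neg he] at hsafe) hs)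
      fun he s hs => ihQ d hσ (by rwa [if_pos he] at hsafe) hs
  | iter e P ih => exact compiles_iter (fun σ s => ih (d + 1)) hσ hsafe hs

end Cmd

end Compilation

end RAM

namespace RAM.Cmd

section Triple

variable {V A : Type*} [DecidableEq V] [DecidableEq A]

omit [DecidableEq A] in
theorem Frame.var_eq {c : Cmd V A} {σ τ : Store V A} (h : Frame c σ τ) (x : V)
    (hx : decide (x ∈ c.vars) = false := by exact rfl) : τ.var x = σ.var x :=
  h.var x (of_decide_eq_false hx)

omit [DecidableEq V] in
theorem Frame.arr_eq {c : Cmd V A} {σ τ : Store V A} (h : Frame c σ τ) (T : A)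
    (hT : decide (T ∈ c.arrays) = false := by exact rfl) : τ.arr T = σ.arr T :=
  h.arr T (of_decide_eq_false hT)

/-- Total correctness with a bound on the number of steps: started in `σ`, the program `c` stops
after at most `k` steps, stores no number above `B`, and ends in a store with property `Q`. -/
def Triple (B : ℕ) (c : Cmd V A) (σ : Store V A) (k : ℕ) (Q : Store V A → Prop) : Prop :=
  σ.Bdd B → c.Safe B σ ∧ c.steps σ ≤ k ∧ Q (c.run σ)

namespace Triple

variable {B k k' N : ℕ} {σ : Store V A} {Q Q' : Store V A → Prop} {P P' : Cmd V A} {e a : Expr V A}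
  {x : V} {T : A}

theorem mono (h : Triple B P σ k Q) (hk : k ≤ k')
    (hQ : ∀ τ, τ.Bdd B → Frame P σ τ → Q τ → Q' τ) : Triple B P σ k' Q' := fun hσ =>
  have ⟨hsafe, hsteps, hrun⟩ := h hσ
  ⟨hsafe, hsteps.trans hk, hQ _ (hsafe.bdd_run P hσ) (frame_run P σ) hrun⟩

theorem of_bdd (h : σ.Bdd B → Triple B P σ k Q) : Triple B P σ k Q := fun hσ => h hσ hσ

theorem skip (h : Q σ) : Triple B skip σ 1 Q := fun _ => ⟨trivial, le_rfl, h⟩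

theorem assign (hB : e.eval σ ≤ B) (h : Q (σ.setVar x (e.eval σ))) : Triple B (x ::= e) σ 1 Q :=
  fun _ => ⟨hB, le_rfl, h⟩

theorem store (hB : e.eval σ ≤ B) (h : Q (σ.setArr T (a.eval σ) (e.eval σ))) :
    Triple B (store T a e) σ 1 Q :=
  fun _ => ⟨hB, le_rfl, h⟩

theorem seq (h : Triple B P σ k fun τ => Triple B P' τ k' Q) :
    Triple B (P ;; P') σ (k + k') Q := fun hσ =>
  have ⟨hsafe, hsteps, h'⟩ := h hσ
  have ⟨hsafe', hsteps', hrun⟩ := h' (hsafe.bdd_run P hσ)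
  ⟨⟨hsafe, hsafe'⟩, add_le_add hsteps hsteps', hrun⟩

theorem assign_seq (hB : e.eval σ ≤ B) (h : Triple B P (σ.setVar x (e.eval σ)) k Q) :
    Triple B (x ::= e ;; P) σ (1 + k) Q := seq (assign hB h)

theorem store_seq (hB : e.eval σ ≤ B) (h : Triple B P (σ.setArr T (a.eval σ) (e.eval σ)) k Q) :
    Triple B (.store T a e ;; P) σ (1 + k) Q := seq (store hB h)

theorem ite (h : e.eval σ ≠ 0 → Triple B P σ k Q) (h' : e.eval σ = 0 → Triple B P' σ k Q) :
    Triple B (ite e P P') σ (k + 1) Q := by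
  intro hσ
  rw [Safe, steps, run]
  split_ifs with he
  · exact (h' he hσ).imp_right (And.imp_left Nat.succ_le_succ)
  · exact (h he hσ).imp_right (And.imp_left Nat.succ_le_succ)

theorem iter (Inv : ℕ → Store V A → Prop) (he : e.eval σ = N) (hN : N ≤ B) (init : Inv 0 σ)
    (step : ∀ j < N, ∀ τ, τ.Bdd B → Frame P σ τ → Inv j τ → Triple B P τ k (Inv (j + 1))) :
    Triple B (iter e P) σ (N * (k + 1) + 1) (Inv N) := by
  intro hσ
  have hinv : ∀ j ≤ N, (P.run^[j] σ).Bdd B ∧ Frame P σ (P.run^[j] σ) ∧ Inv j (P.run^[j] σ) := by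
    intro j hj
    induction j with
    | zero => exact ⟨hσ, .refl P σ, init⟩
    | succ j ih =>
      obtain ⟨hbdd, hframe, hj'⟩ := ih (Nat.le_of_succ_le hj)
      obtain ⟨hsafe, -, hrun⟩ := step j hj _ hbdd hframe hj' hbdd
      rw [iter_run_succ]
      exact ⟨hsafe.bdd_run P hbdd, hframe.trans (frame_run P _), hrun⟩
  have hstep : ∀ j < N, P.Safe B (P.run^[j] σ) ∧ P.steps (P.run^[j] σ) ≤ k := fun j hj =>
    have ⟨hbdd, hframe, hj'⟩ := hinv j hj.le
    (step j hj _ hbdd hframe hj' hbdd).imp_right And.left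
  rw [Safe, steps, run, he]
  refine ⟨⟨hN, fun j hj => (hstep j hj).1⟩, Nat.succ_le_succ ?_, (hinv N le_rfl).2.2⟩
  simpa using Finset.sum_le_card_nsmul (Finset.range N) _ (k + 1)
    fun j hj => Nat.succ_le_succ (hstep j (Finset.mem_range.1 hj)).2

end Triple

/-- The loop `for x := 0, …, e - 1 do P`; its bound `e` is evaluated only once. -/
def forLt (x : V) (e : Expr V A) (P : Cmd V A) : Cmd V A :=
  x ::= 0 ;; iter e (P ;; x ::= .var x + 1)

omit [DecidableEq V] [DecidableEq A] in
@[simp] theorem vars_forLt (x : V) (e : Expr V A) (P : Cmd V A) :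
    (forLt x e P).vars = x :: (P.vars ++ [x]) := rfl

omit [DecidableEq V] [DecidableEq A] in
@[simp] theorem arrays_forLt (x : V) (e : Expr V A) (P : Cmd V A) :
    (forLt x e P).arrays = P.arrays := List.append_nil _

theorem Triple.forLt {B k N : ℕ} {σ : Store V A} {Q : Store V A → Prop} {P : Cmd V A}
    {e : Expr V A} {x : V} (Inv : ℕ → Store V A → Prop) (hx : x ∉ P.vars)
    (he : e.eval (σ.setVar x 0) = N) (hN : N ≤ B) (init : Inv 0 (σ.setVar x 0))
    (step : ∀ j < N, ∀ τ, τ.Bdd B → Frame (forLt x e P) σ τ → τ.var x = j → Inv j τ →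
      Triple B P τ k fun υ => Inv (j + 1) (υ.setVar x (j + 1)))
    (done : ∀ τ, τ.Bdd B → Frame (forLt x e P) σ τ → τ.var x = N → Inv N τ → Q τ) :
    Triple B (forLt x e P) σ (N * (k + 2) + 2) Q := by
  have hcount : N * (k + 2) + 2 = 1 + (N * (k + 1 + 1) + 1) := by ring
  have hframe₀ : Frame (Cmd.forLt x e P) σ (σ.setVar x 0) :=
    (frame_run (x ::= 0) σ).mono (by simp [vars]) (by simp [arrays])
  have hsub {c τ} (hc : c.vars = P.vars ++ [x] ∧ c.arrays = P.arrays)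
      (hτ : Frame c (σ.setVar x 0) τ) :
      Frame (Cmd.forLt x e P) σ τ :=
    hframe₀.trans (hτ.mono (by simp [hc]) (by simp [hc]))
  rw [hcount]
  refine assign_seq (Nat.zero_le B) ((iter (fun j τ => τ.var x = j ∧ Inv j τ) he hN
    ⟨by simp, init⟩ fun j hj τ hτ hframe ⟨hxj, hinv⟩ => ?_).mono le_rfl
      fun τ hτ hframe ⟨hxN, hinv⟩ => done τ hτ (hsub ⟨rfl, List.append_nil _⟩ hframe) hxN hinv)
  refine seq ((step j hj τ hτ (hsub ⟨rfl, List.append_nil _⟩ hframe) hxj hinv).mono le_rfl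
    fun υ _ hυ hinv' => ?_)
  have hυx : υ.var x = j := (hυ.var x hx).trans hxj
  refine assign (by simpa [hυx] using hj.trans_le hN) ?_
  simp only [Expr.eval_add, Expr.eval_var, Expr.eval_ofNat, hυx]
  exact ⟨by simp, hinv'⟩

end Triple

end RAM.Cmd

/-! ### Optimal assignments close to a balanced assignment -/

namespace Assignment

open Finset Relation

section Load

variable {J M : Type*} [Fintype J] [DecidableEq M]

/-- The load of machine `i` under the assignment `x`. -/
def load (p : J → ℕ) (x : J → M) (i : M) : ℕ := ∑ j with x j = i, p j

theorem sum_load (p : J → ℕ) (x : J → M) (A : Finset M) :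
    ∑ i ∈ A, load p x i = ∑ j with x j ∈ A, p j := by
  simp_rw [load, sum_filter]
  rw [sum_comm]
  exact sum_congr rfl fun j _ => sum_ite_eq A (x j) _

theorem load_piecewise_add [DecidableEq J] (p : J → ℕ) (y x : J → M) (U : Finset J) (i : M) :
    load p (U.piecewise y x) i + ∑ j ∈ U with x j = i, p j =
      load p x i + ∑ j ∈ U with y j = i, p j := by
  simp only [load, sum_filter]
  have sum_eq : ∀ f : J → ℕ, ∑ j ∈ U, f j = ∑ j, if j ∈ U then f j else 0 := fun f => by
    rw [sum_ite_mem, univ_inter]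
  rw [sum_eq, sum_eq, ← sum_add_distrib, ← sum_add_distrib]
  refine sum_congr rfl fun j _ => ?_
  by_cases hj : j ∈ U <;> simp only [piecewise, hj, if_true, if_false, add_comm]

variable [Fintype M]

/-- The largest load. -/
def maxLoad (p : J → ℕ) (x : J → M) : ℕ := univ.sup (load p x)

theorem load_le_maxLoad (p : J → ℕ) (x : J → M) (i : M) : load p x i ≤ maxLoad p x :=
  le_sup (f := load p x) (mem_univ i)

/-- Among the assignments that respect the eligibility relation `E`, the assignment `x` has the
smallest largest load. -/
structure IsOptimal (p : J → ℕ) (E : J → M → Prop) (x : J → M) : Prop where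
  eligible : ∀ j, E j (x j)
  maxLoad_le : ∀ x' : J → M, (∀ j, E j (x' j)) → maxLoad p x ≤ maxLoad p x'

theorem exists_isOptimal (p : J → ℕ) {E : J → M → Prop} {y : J → M} (hy : ∀ j, E j (y j)) :
    ∃ x, IsOptimal p E x :=
  have ⟨x, hx⟩ := exists_minimalFor_of_wellFoundedLT (fun x : J → M => ∀ j, E j (x j)) (maxLoad p)
    ⟨y, hy⟩
  ⟨x, hx.prop, fun _ => hx.le⟩

end Load

section Trail

/-- The sequence `v` walks along the relation `r` and does not repeat a vertex before its end
`v k`. -/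
structure IsTrail {M : Type*} (r : M → M → Prop) (k : ℕ) (v : ℕ → M) : Prop where
  pos : 0 < k
  rel : ∀ t < k, r (v t) (v (t + 1))
  injOn : Set.InjOn v (Set.Iio k)

variable {M : Type*} {r : M → M → Prop} {k : ℕ} {v : ℕ → M}

theorem IsTrail.le_card [Fintype M] (h : IsTrail r k v) : k ≤ Fintype.card M := by
  simpa using card_le_card_of_injOn (s := range k) v (fun _ _ => mem_univ _)
    (by simpa using h.injOn)

theorem IsTrail.drop (h : IsTrail r k v) {t : ℕ} (ht : t < k) :
    IsTrail r (k - t) fun u => v (t + u) where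
  pos := Nat.sub_pos_of_lt ht
  rel u hu := h.rel (t + u) (by omega)
  injOn u hu u' hu' huu' := by
    rw [Set.mem_Iio] at hu hu'
    exact Nat.add_left_cancel (h.injOn (Set.mem_Iio.2 (by omega)) (Set.mem_Iio.2 (by omega)) huu')

theorem IsTrail.cons (h : IsTrail r k v) {a : M} (ha : r a (v 0)) (hav : ∀ t < k, v t ≠ a) :
    IsTrail r (k + 1) fun | 0 => a | t + 1 => v t where
  pos := k.succ_pos
  rel
    | 0, _ => ha
    | t + 1, ht => h.rel t (Nat.lt_of_succ_lt_succ ht)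
  injOn
    | 0, _, 0, _, _ => rfl
    | 0, _, t + 1, ht, hat => absurd hat.symm (hav t (Nat.lt_of_succ_lt_succ ht))
    | t + 1, ht, 0, _, hta => absurd hta (hav t (Nat.lt_of_succ_lt_succ ht))
    | _ + 1, ht, _ + 1, ht', htt' =>
      congrArg _ (h.injOn (Nat.lt_of_succ_lt_succ ht) (Nat.lt_of_succ_lt_succ ht') htt')

theorem exists_isTrail {a c : M} (h : TransGen r a c) :
    ∃ k v, IsTrail r k v ∧ v 0 = a ∧ v k = c := by
  induction h using TransGen.head_induction_on with
  | @single a h =>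
    refine ⟨1, fun | 0 => a | _ + 1 => c, ⟨one_pos, fun t ht => ?_, ?_⟩, rfl, rfl⟩
    · obtain rfl := Nat.lt_one_iff.1 ht
      exact h
    · exact fun _ h _ h' _ => (Nat.lt_one_iff.1 h).trans (Nat.lt_one_iff.1 h').symm
  | @head a b hab _ ih =>
    obtain ⟨k, v, hv, rfl, hk⟩ := ih
    by_cases ha : ∃ t < k, v t = a
    · obtain ⟨t, ht, rfl⟩ := ha
      exact ⟨k - t, _, hv.drop ht, rfl, by rwa [Nat.add_sub_cancel' ht.le]⟩
    · push Not at ha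
      exact ⟨k + 1, _, hv.cons hab ha, rfl, hk⟩

end Trail

section Tight

theorem exists_subset_card_mul_eq_prod {J : Type*} {S : ℕ → Finset J} {s : ℕ → ℕ}
    {q k m : ℕ} (hk : k ≤ m)
    (hs : ∀ t < k, s t ∈ Set.Icc 1 q) (hS : ∀ t < k, q ^ (m - 1) ≤ #(S t)) {t : ℕ} (ht : t < k) :
    ∃ U ⊆ S t, #U * s t = ∏ u ∈ range k, s u := by
  have hq : 1 ≤ q := (hs t ht).1.trans (hs t ht).2
  have hprod : ∏ u ∈ (range k).erase t, s u ≤ q ^ (m - 1) := by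
    refine (prod_le_pow_card _ _ q fun u hu => ?_).trans (Nat.pow_le_pow_right hq ?_)
    · exact (hs u (mem_range.1 (mem_of_mem_erase hu))).2
    · rw [card_erase_of_mem (mem_range.2 ht), card_range]
      omega
  obtain ⟨U, hU, hcard⟩ := exists_subset_card_eq (hprod.trans (hS t ht))
  exact ⟨U, hU, by rw [hcard, prod_erase_mul _ _ (mem_range.2 ht)]⟩

variable {J M : Type*} [Fintype J] [DecidableEq M]

/-- The jobs of size `s` that `y` puts on `a` and `x` puts on `b`. -/
def moved (p : J → ℕ) (y x : J → M) (a b : M) (s : ℕ) : Finset J :=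
  {j | y j = a ∧ x j = b ∧ p j = s}

/-- For some positive size, at least `H` jobs of that size move from `a` to `b`. -/
def Heavy (p : J → ℕ) (y x : J → M) (H : ℕ) (a b : M) : Prop :=
  a ≠ b ∧ ∃ s, 1 ≤ s ∧ H ≤ #(moved p y x a b s)

variable {p : J → ℕ} {y x : J → M} {q : ℕ} {a b : M} {s : ℕ} {j : J}

theorem mem_moved : j ∈ moved p y x a b s ↔ y j = a ∧ x j = b ∧ p j = s := by
  rw [moved, mem_filter_univ]

variable [DecidableEq J]

theorem load_piecewise_biUnion_add {v : ℕ → M} {k R : ℕ} {U : ℕ → Finset J} {s : ℕ → ℕ}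
    (hv : Set.InjOn v (Set.Iio k)) (hU : ∀ t < k, U t ⊆ moved p y x (v t) (v (t + 1)) (s t))
    (hR : ∀ t < k, #(U t) * s t = R) (i : M) :
    load p (((range k).biUnion U).piecewise y x) i + (if v k = i then R else 0) =
      load p x i + (if v 0 = i then R else 0) := by
  have hdisj : Set.PairwiseDisjoint (range k : Set ℕ) U := by
    intro t ht t' ht' hne
    rw [coe_range] at ht ht'
    refine disjoint_left.2 fun j hj hj' => hne (hv ht ht' ?_)
    rw [← (mem_moved.1 (hU t ht hj)).1, ← (mem_moved.1 (hU t' ht' hj')).1]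
  have hsum {z : J → M} {w : ℕ → M} (hz : ∀ t < k, ∀ j ∈ U t, z j = w t) :
      ∑ j ∈ (range k).biUnion U with z j = i, p j = ∑ t ∈ range k, if w t = i then R else 0 := by
    rw [sum_filter, sum_biUnion hdisj]
    refine sum_congr rfl fun t ht => ?_
    rw [mem_range] at ht
    rw [sum_congr rfl fun j hj => by rw [hz t ht j hj, (mem_moved.1 (hU t ht hj)).2.2],
      sum_const, smul_eq_mul, mul_ite, mul_zero, hR t ht]
  have hundo := load_piecewise_add p y x ((range k).biUnion U) i
  rw [hsum (w := fun t => v (t + 1)) fun t ht j hj => (mem_moved.1 (hU t ht hj)).2.1,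
    hsum (w := v) fun t ht j hj => (mem_moved.1 (hU t ht hj)).1] at hundo
  have htel := (sum_range_succ (fun t => if v t = i then R else 0) k).symm.trans
    (sum_range_succ' _ k)
  omega

variable [Fintype M]

/-- No nonempty set of jobs can be moved back from `x` to `y` without increasing the makespan. -/
def Tight (p : J → ℕ) (y x : J → M) : Prop :=
  ∀ U : Finset J, U.Nonempty → (∀ j ∈ U, x j ≠ y j) → ∃ i, maxLoad p x < load p (U.piecewise y x) i

theorem Tight.pos (h : Tight p y x) (hj : x j ≠ y j) : 0 < p j := by
  by_contra h0
  obtain ⟨i, hi⟩ := h {j} (singleton_nonempty j) (by simpa using hj)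
  have hundo := load_piecewise_add p y x {j} i
  simp only [sum_filter, sum_singleton, Nat.eq_zero_of_not_pos h0, ite_self, add_zero] at hundo
  exact (hundo ▸ hi).not_ge (load_le_maxLoad p x i)

/-- Returning suitable numbers of jobs along all edges of a trail of heavy pairs cancels on the
inner machines: only `v 0` gains load and only `v k` loses load. -/
theorem IsTrail.exists_load_piecewise (hq : 1 ≤ q) (hp : ∀ j, p j ≤ q) {v : ℕ → M} {k : ℕ}
    (h : IsTrail (Heavy p y x (q ^ (Fintype.card M - 1))) k v) :
    ∃ (R : ℕ) (U : Finset J), R ≤ q ^ Fintype.card M ∧ U.Nonempty ∧ (∀ j ∈ U, x j ≠ y j) ∧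
      ∀ i, load p (U.piecewise y x) i + (if v k = i then R else 0) =
        load p x i + (if v 0 = i then R else 0) := by
  choose! s hs hcard using fun t ht => (h.rel t ht).2
  have hsq : ∀ t < k, s t ∈ Set.Icc 1 q := fun t ht => by
    obtain ⟨j, hj⟩ := card_pos.1 ((Nat.pow_pos hq).trans_le (hcard t ht))
    exact ⟨hs t ht, (mem_moved.1 hj).2.2 ▸ hp j⟩
  choose! U hU hR using fun t (ht : t < k) => exists_subset_card_mul_eq_prod h.le_card hsq hcard ht
  refine ⟨∏ t ∈ range k, s t, (range k).biUnion U, ?_, ?_, fun j hj => ?_,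
    load_piecewise_biUnion_add h.injOn hU hR⟩
  · refine (prod_le_pow_card _ _ q fun t ht => (hsq t (mem_range.1 ht)).2).trans ?_
    exact Nat.pow_le_pow_right hq (by simpa using h.le_card)
  · have hprod : 0 < ∏ t ∈ range k, s t := prod_pos fun t ht => hs t (mem_range.1 ht)
    obtain ⟨j, hj⟩ := card_pos.1 (Nat.pos_of_mul_pos_right (hR 0 h.pos ▸ hprod))
    exact ⟨j, mem_biUnion.2 ⟨0, mem_range.2 h.pos, hj⟩⟩
  · obtain ⟨t, ht, hj⟩ := mem_biUnion.1 hj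
    obtain ⟨hy, hx, -⟩ := mem_moved.1 (hU t (mem_range.1 ht) hj)
    rw [hy, hx]
    exact (h.rel t (mem_range.1 ht)).1.symm

end Tight

section Balanced

variable {J M : Type*} [Fintype J] [DecidableEq M] {p : J → ℕ} {E : J → M → Prop} {y x : J → M}
  {q D H : ℕ} {a b c : M}

/-- No job of positive size sits on a machine whose load exceeds that of another eligible machine by
more than `D`. -/
def Balanced (p : J → ℕ) (E : J → M → Prop) (y : J → M) (D : ℕ) : Prop :=
  ∀ j, 0 < p j → ∀ i, E j i → load p y (y j) ≤ load p y i + D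

theorem Balanced.load_le_of_heavy (hy : Balanced p E y D) (hE : ∀ j, E j (x j)) (hH : 0 < H)
    (h : Heavy p y x H a b) : load p y a ≤ load p y b + D := by
  obtain ⟨-, s, hs, hcard⟩ := h
  obtain ⟨j, hj⟩ := card_pos.1 (hH.trans_le hcard)
  obtain ⟨rfl, rfl, rfl⟩ := mem_moved.1 hj
  exact hy j hs (x j) (hE j)

theorem Balanced.load_le_of_isTrail (hy : Balanced p E y D) (hE : ∀ j, E j (x j)) (hH : 0 < H)
    {v : ℕ → M} {k : ℕ} (h : IsTrail (Heavy p y x H) k v) {t : ℕ} (ht : t ≤ k) :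
    load p y (v 0) ≤ load p y (v t) + t * D := by
  induction t with
  | zero => exact Nat.le_add_right _ _
  | succ t ih =>
    have := hy.load_le_of_heavy hE hH (h.rel t ht)
    have := ih (Nat.le_of_succ_le ht)
    rw [add_mul]
    omega

variable [DecidableEq J] [Fintype M]

theorem Tight.of_transGen_heavy (hT : Tight p y x) (hq : 1 ≤ q) (hp : ∀ j, p j ≤ q)
    (hE : ∀ j, E j (x j)) (hy : Balanced p E y D)
    (h : TransGen (Heavy p y x (q ^ (Fintype.card M - 1))) a c) :
    a ≠ c ∧ load p x c < load p x a + q ^ Fintype.card M ∧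
      load p y a ≤ load p y c + Fintype.card M * D := by
  obtain ⟨k, v, hv, rfl, rfl⟩ := exists_isTrail h
  obtain ⟨R, U, hR, hU, hUx, hload⟩ := hv.exists_load_piecewise hq hp
  obtain ⟨i, hi⟩ := hT U hU hUx
  have hli := hload i
  have hmax := load_le_maxLoad p x
  have h0 : v 0 = i := by
    by_contra h0
    rw [if_neg h0] at hli
    exact (hmax i).not_gt (by omega)
  have hk : v k ≠ i := fun hk => by
    rw [if_pos h0, if_pos hk] at hli
    exact (hmax i).not_gt (by omega)
  subst h0
  rw [if_pos rfl, if_neg hk] at hli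
  refine ⟨hk.symm, ?_, ?_⟩
  · have := hmax (v k)
    omega
  · refine (hy.load_le_of_isTrail hE (Nat.pow_pos hq) hv le_rfl).trans ?_
    gcongr
    exact hv.le_card

theorem Tight.sum_leaving_le (hT : Tight p y x) (hp : ∀ j, p j ≤ q) {A : Finset M}
    (hA : ∀ c ∈ A, ∀ d ∉ A, ¬ Heavy p y x H c d) :
    ∑ j with y j ∈ A ∧ x j ∉ A, p j ≤ H * (Fintype.card M * Fintype.card M * (q + 1)) * q := by
  set S : Finset J := {j | y j ∈ A ∧ x j ∉ A} with hS
  have hfiber : ∀ c ∈ (univ : Finset M) ×ˢ (univ : Finset M) ×ˢ range (q + 1),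
      #{j ∈ S | (y j, x j, p j) = c} ≤ H := by
    rintro ⟨c, d, s⟩ -
    obtain hempty | ⟨j, hj⟩ := Finset.eq_empty_or_nonempty {j ∈ S | (y j, x j, p j) = (c, d, s)}
    · exact hempty ▸ Nat.zero_le H
    rw [hS, mem_filter, mem_filter_univ, Prod.mk.injEq, Prod.mk.injEq] at hj
    obtain ⟨⟨hyA, hxA⟩, rfl, rfl, rfl⟩ := hj
    have hne : x j ≠ y j := fun h => hxA (h ▸ hyA)
    by_contra hlt
    refine hA _ hyA _ hxA ⟨hne.symm, p j, hT.pos hne, (not_le.1 hlt).le.trans (card_le_card ?_)⟩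
    intro l hl
    simpa only [mem_moved, mem_filter, Prod.mk.injEq] using (mem_filter.1 hl).2
  refine (sum_le_card_nsmul S p q fun j _ => hp j).trans ?_
  rw [smul_eq_mul]
  gcongr
  refine (card_le_mul_card_image_of_maps_to (fun j _ => ?_) H hfiber).trans_eq ?_
  · simpa using Nat.lt_succ_of_le (hp j)
  · simp only [card_product, card_univ, card_range, mul_assoc]

omit [DecidableEq J] [Fintype M] in
theorem sum_load_add_le {A : Finset M} (ha : a ∉ A) (hb : b ∈ A) :
    ∑ i ∈ A, load p y i + ∑ j with y j = a ∧ x j = b, p j ≤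
      ∑ i ∈ A, load p x i + ∑ j with y j ∈ A ∧ x j ∉ A, p j := by
  simp only [sum_load, sum_filter]
  rw [← sum_add_distrib, ← sum_add_distrib]
  refine sum_le_sum fun j _ => ?_
  by_cases hj : y j = a ∧ x j = b
  · simp [hj, ha, hb]
  · by_cases hy : y j ∈ A <;> by_cases hx : x j ∈ A <;> simp [hj, hy, hx]

theorem Tight.sum_load_add_le (hT : Tight p y x) (hp : ∀ j, p j ≤ q) {A : Finset M}
    (ha : a ∉ A) (hb : b ∈ A) (hA : ∀ c ∈ A, ∀ d ∉ A, ¬ Heavy p y x H c d) :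
    ∑ i ∈ A, load p y i + ∑ j with y j = a ∧ x j = b, p j ≤
      ∑ i ∈ A, load p x i + H * (Fintype.card M * Fintype.card M * (q + 1)) * q :=
  (Assignment.sum_load_add_le ha hb).trans (Nat.add_le_add_left (hT.sum_leaving_le hp hA) _)

/-- Upper bound for the number of jobs of one size that move from one machine to another; `D`
measures how well the original assignment is balanced. -/
def moveBound (m q D : ℕ) : ℕ :=
  m * (q ^ m + m * D) + q ^ (m - 1) * (m * m * (q + 1)) * q + q ^ (m - 1)

omit [DecidableEq J] [DecidableEq M] [Fintype J] in
theorem exists_add_le_of_card_mul_lt {A : Finset M} {f g : M → ℕ} {K L R : ℕ}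
    (hK : Fintype.card M * K + R < L) (h : ∑ i ∈ A, f i + L ≤ ∑ i ∈ A, g i + R) :
    ∃ i ∈ A, f i + K ≤ g i := by
  by_contra! hno
  have hsum := sum_le_sum fun i hi => (hno i hi).le
  rw [sum_add_distrib, sum_const, smul_eq_mul] at hsum
  have := Nat.mul_le_mul_right K (card_le_univ A)
  omega

theorem Tight.exists_gain_of_reflTransGen (hT : Tight p y x) (hp : ∀ j, p j ≤ q) {K : ℕ}
    (hab : ¬ ReflTransGen (Heavy p y x H) b a)
    (hbig : Fintype.card M * K + H * (Fintype.card M * Fintype.card M * (q + 1)) * q <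
      ∑ j with y j = a ∧ x j = b, p j) :
    ∃ t, ReflTransGen (Heavy p y x H) b t ∧ load p y t + K ≤ load p x t := by
  classical
  obtain ⟨t, ht, hle⟩ := exists_add_le_of_card_mul_lt hbig <|
    hT.sum_load_add_le hp (A := {c | ReflTransGen (Heavy p y x H) b c}) (a := a) (b := b)
      (by simpa using hab) (by simpa using .refl)
      (by simpa using fun c hc d hd hcd => hd (hc.tail hcd))
  exact ⟨t, by simpa using ht, hle⟩

theorem Tight.exists_loss_of_reflTransGen (hT : Tight p y x) (hp : ∀ j, p j ≤ q) {K : ℕ}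
    (hab : ¬ ReflTransGen (Heavy p y x H) b a)
    (hbig : Fintype.card M * K + H * (Fintype.card M * Fintype.card M * (q + 1)) * q <
      ∑ j with y j = a ∧ x j = b, p j) :
    ∃ t, ReflTransGen (Heavy p y x H) t a ∧ load p x t + K ≤ load p y t := by
  classical
  set A : Finset M := {c | ¬ ReflTransGen (Heavy p y x H) c a} with hA
  have hcut := hT.sum_load_add_le hp (A := A) (a := a) (b := b)
    (by simp [hA, ReflTransGen.refl]) (by simpa [hA] using hab)
    (by simpa [hA] using fun c hc d hd hcd => hc (.head hcd hd))
  have htotal : ∑ i, load p x i = ∑ i, load p y i := by simp only [sum_load, mem_univ]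
  rw [← sum_add_sum_compl A, ← sum_add_sum_compl A (load p y)] at htotal
  obtain ⟨t, ht, hle⟩ := exists_add_le_of_card_mul_lt (A := Aᶜ) (f := load p x) (g := load p y)
    hbig (by omega)
  exact ⟨t, by simpa [hA] using ht, hle⟩

theorem Tight.card_moved_le (hT : Tight p y x) (hq : 1 ≤ q) (hp : ∀ j, p j ≤ q)
    (hE : ∀ j, E j (x j)) (hy : Balanced p E y D) (hab : a ≠ b) {s : ℕ} (hs : 1 ≤ s) :
    #(moved p y x a b s) ≤ moveBound (Fintype.card M) q D := by
  set m := Fintype.card M with hm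
  by_contra! hlt
  have hheavy : Heavy p y x (q ^ (m - 1)) a b :=
    ⟨hab, s, hs, (Nat.le_add_left _ _).trans hlt.le⟩
  have hacyclic : ¬ ReflTransGen (Heavy p y x (q ^ (m - 1))) b a := fun h =>
    (hT.of_transGen_heavy hq hp hE hy (TransGen.head' hheavy h)).1 rfl
  have hsub : #(moved p y x a b s) ≤ ∑ j with y j = a ∧ x j = b, p j := by
    rw [card_eq_sum_ones]
    refine (sum_le_sum fun j hj => ?_).trans (sum_le_sum_of_subset fun j hj => ?_)
    · exact hs.trans_eq (mem_moved.1 hj).2.2.symm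
    · exact (mem_filter_univ j).2 ⟨(mem_moved.1 hj).1, (mem_moved.1 hj).2.1⟩
  have hbig : m * (q ^ m + m * D) + q ^ (m - 1) * (m * m * (q + 1)) * q <
      ∑ j with y j = a ∧ x j = b, p j :=
    (Nat.le_add_right _ _).trans_lt (hlt.trans_le hsub)
  obtain ⟨t, hbt, ht⟩ := hT.exists_gain_of_reflTransGen hp hacyclic hbig
  obtain ⟨u, hua, hu⟩ := hT.exists_loss_of_reflTransGen hp hacyclic hbig
  obtain ⟨-, hx, hy⟩ := hT.of_transGen_heavy hq hp hE hy
    (TransGen.trans_right hua (.head' hheavy hbt))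
  have : 1 ≤ q ^ m := Nat.one_le_pow _ _ hq
  rw [← hm] at hx hy
  omega

theorem Tight.card_moved_from_le (hT : Tight p y x) (hq : 1 ≤ q) (hp : ∀ j, p j ≤ q)
    (hE : ∀ j, E j (x j)) (hy : Balanced p E y D) (a : M) (s : ℕ) :
    #{j | y j = a ∧ p j = s ∧ x j ≠ y j} ≤ Fintype.card M * moveBound (Fintype.card M) q D := by
  rw [mul_comm]
  refine card_le_mul_card_image_of_maps_to (t := univ) (f := x) (fun _ _ => mem_univ _) _ ?_
  intro b _
  obtain hempty | ⟨j, hj⟩ :=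
    Finset.eq_empty_or_nonempty {j ∈ ({j | y j = a ∧ p j = s ∧ x j ≠ y j} : Finset J) | x j = b}
  · exact hempty ▸ Nat.zero_le _
  obtain ⟨⟨rfl, rfl, hmove⟩, rfl⟩ : (y j = a ∧ p j = s ∧ x j ≠ y j) ∧ x j = b := by simpa using hj
  refine (card_le_card fun l hl => ?_).trans
    (hT.card_moved_le hq hp hE hy hmove.symm (hT.pos hmove))
  simp only [mem_filter, mem_univ, true_and, mem_moved] at hl ⊢
  exact ⟨hl.1.1, hl.2, hl.1.2.1⟩

end Balanced

section Near

variable {M : Type*} [DecidableEq M] {n : ℕ} {p : Fin n → ℕ} {E : Fin n → M → Prop}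
  {y x : Fin n → M}

/-- Potential that decreases when a job returns from `x` to `y`, or when a job with a smaller
number moves in place of one with a larger number. -/
def displacement (y x : Fin n → M) : ℕ := ∑ j with x j ≠ y j, ((j : ℕ) + 1)

theorem displacement_piecewise_lt {U : Finset (Fin n)} (hU : U.Nonempty)
    (hUx : ∀ j ∈ U, x j ≠ y j) : displacement y (U.piecewise y x) < displacement y x := by
  obtain ⟨j, hj⟩ := hU
  refine sum_lt_sum_of_subset (i := j) (fun l hl => ?_) (by simp [hUx j hj]) (by simp [hj])
    (Nat.succ_pos _) fun _ _ _ => Nat.zero_le _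
  by_cases hlU : l ∈ U <;> simp_all

theorem displacement_comp_swap_lt {j j' : Fin n} (hlt : j' < j) (hy : y j' = y j)
    (hj : x j ≠ y j) (hj' : x j' = y j') :
    displacement y (x ∘ Equiv.swap j j') < displacement y x := by
  have hy_swap (l) : y (Equiv.swap j j' l) = y l := by
    obtain rfl | hl := eq_or_ne l j
    · rw [Equiv.swap_apply_left, hy]
    obtain rfl | hl' := eq_or_ne l j'
    · rw [Equiv.swap_apply_right, hy]
    · rw [Equiv.swap_apply_of_ne_of_ne hl hl']
  have hreindex : displacement y (x ∘ Equiv.swap j j') =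
      ∑ l with x l ≠ y l, ((Equiv.swap j j' l : ℕ) + 1) := by
    simp only [displacement, sum_filter, Function.comp_apply]
    rw [← Equiv.sum_comp (Equiv.swap j j')]
    simp only [Equiv.swap_apply_self, hy_swap]
  rw [hreindex, displacement]
  refine sum_lt_sum (fun l hl => ?_) ⟨j, by simpa using hj, by simpa using hlt⟩
  obtain rfl | hlj := eq_or_ne l j
  · simpa using hlt.le
  · have hlj' : l ≠ j' := fun h => (mem_filter_univ l).1 hl (h ▸ hj')
    rw [Equiv.swap_apply_of_ne_of_ne hlj hlj']

variable [Fintype M]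

theorem IsOptimal.tight (hx : IsOptimal p E x) (hy : ∀ j, E j (y j))
    (hmin : ∀ x', IsOptimal p E x' → displacement y x ≤ displacement y x') : Tight p y x := by
  intro U hU hUx
  by_contra! hno
  refine (hmin (U.piecewise y x) ⟨fun j => ?_, fun x' hx' => ?_⟩).not_gt
    (displacement_piecewise_lt hU hUx)
  · exact U.piecewise_cases y x (E j) (hy j) (hx.eligible j)
  · exact (Finset.sup_le fun i _ => hno i).trans (hx.maxLoad_le x' hx')

theorem IsOptimal.comp_perm {J : Type*} [Fintype J] {p : J → ℕ} {E : J → M → Prop} {x : J → M}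
    (hx : IsOptimal p E x) (π : Equiv.Perm J) (hp : ∀ j, p (π j) = p j) (hE : ∀ j, E (π j) = E j) :
    IsOptimal p E (x ∘ π) := by
  have hload : load p (x ∘ π) = load p x := by
    funext i
    simp only [load, sum_filter]
    rw [← Equiv.sum_comp π fun j => if x j = i then p j else 0]
    simp only [Function.comp_apply, hp]
  exact ⟨fun j => hE j ▸ hx.eligible (π j), fun x' hx' => by
    rw [maxLoad, hload]; exact hx.maxLoad_le x' hx'⟩

/-- Jobs of one class are interchangeable, so those that move can be taken to be the first ones. -/
theorem exists_isOptimal_near {κ : Type*} [DecidableEq κ] {q D : ℕ} (key : Fin n → κ)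
    (hkey : ∀ j j', key j = key j' → p j = p j' ∧ E j = E j' ∧ y j = y j')
    (hq : 1 ≤ q) (hp : ∀ j, p j ≤ q) (hyE : ∀ j, E j (y j)) (hy : Balanced p E y D) :
    ∃ x, IsOptimal p E x ∧ ∀ j, x j ≠ y j →
      #{j' | j' < j ∧ key j' = key j} < Fintype.card M * moveBound (Fintype.card M) q D := by
  obtain ⟨x, hx⟩ := exists_minimalFor_of_wellFoundedLT (IsOptimal p E) (displacement y)
    (exists_isOptimal p hyE)
  have hT : Tight p y x := hx.prop.tight hyE fun _ => hx.le
  refine ⟨x, hx.prop, fun j hj => ?_⟩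
  by_contra! hlarge
  obtain ⟨j', hlt, hkj, hxj'⟩ : ∃ j' < j, key j' = key j ∧ x j' = y j' := by
    by_contra! hno
    refine ((hT.card_moved_from_le hq hp hx.prop.eligible hy (y j) (p j)).trans hlarge).not_gt
      (card_lt_card ((ssubset_iff_of_subset fun l hl => ?_).2 ⟨j, by simp [hj], by simp⟩))
    simp only [mem_filter, mem_univ, true_and] at hl ⊢
    have := hkey _ _ hl.2
    exact ⟨this.2.2, this.1, hno l hl.1 hl.2⟩
  have hswap : ∀ l, key (Equiv.swap j j' l) = key l := fun l => by
    obtain rfl | hl := eq_or_ne l j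
    · rw [Equiv.swap_apply_left, hkj]
    obtain rfl | hl' := eq_or_ne l j'
    · rw [Equiv.swap_apply_right, hkj]
    · rw [Equiv.swap_apply_of_ne_of_ne hl hl']
  exact (hx.le (hx.prop.comp_perm _ (fun l => (hkey _ _ (hswap l)).1)
    fun l => (hkey _ _ (hswap l)).2.1)).not_gt
      (displacement_comp_swap_lt hlt (hkey _ _ hkj).2.2 hj hxj')

end Near

end Assignment

/-! ### Reading the instance -/

namespace Assignment

open RAM RAM.Cmd RAM.Expr Finset

section Digits

variable {b r : ℕ} {a a' : ℕ → ℕ}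

theorem sum_mul_pow_succ (a : ℕ → ℕ) (b r : ℕ) :
    ∑ i ∈ range (r + 1), a i * b ^ i = b * ∑ i ∈ range r, a (i + 1) * b ^ i + a 0 := by
  rw [sum_range_succ', pow_zero, mul_one, mul_sum]
  simp only [pow_succ', mul_left_comm]

theorem sum_mul_pow_lt (ha : ∀ i < r, a i < b) : ∑ i ∈ range r, a i * b ^ i < b ^ r := by
  induction r generalizing a with
  | zero => simp
  | succ r ih =>
    have := Nat.mul_le_mul_left b (ih (a := fun i => a (i + 1)) fun i hi => ha _ (by omega))
    have := ha 0 r.succ_pos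
    rw [sum_mul_pow_succ, pow_succ']
    grind

theorem sum_mul_pow_div_pow_mod (ha : ∀ i < r, a i < b) {i : ℕ} (hi : i < r) :
    (∑ i ∈ range r, a i * b ^ i) / b ^ i % b = a i := by
  induction r generalizing a i with
  | zero => exact absurd hi i.not_lt_zero
  | succ r ih =>
    have ha₀ : a 0 < b := ha 0 r.succ_pos
    rw [sum_mul_pow_succ]
    cases i with
    | zero => rw [pow_zero, Nat.div_one, Nat.mul_add_mod, Nat.mod_eq_of_lt ha₀]
    | succ i =>
      rw [pow_succ', ← Nat.div_div_eq_div_mul, Nat.mul_add_div (Nat.zero_lt_of_lt ha₀),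
        Nat.div_eq_of_lt ha₀, add_zero]
      exact ih (a := fun i => a (i + 1)) (fun i hi => ha _ (by omega)) (Nat.lt_of_succ_lt_succ hi)

theorem eq_of_sum_mul_pow_eq (ha : ∀ i < r, a i < b) (ha' : ∀ i < r, a' i < b)
    (h : ∑ i ∈ range r, a i * b ^ i = ∑ i ∈ range r, a' i * b ^ i) {i : ℕ} (hi : i < r) :
    a i = a' i := by
  rw [← sum_mul_pow_div_pow_mod ha hi, h, sum_mul_pow_div_pow_mod ha' hi]

end Digits

section Mask

variable {m j j' : ℕ} {e : ℕ → ℕ}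

/-- Row `j` of the eligibility table `e`, read as a binary number. -/
def eligibilityMask (m : ℕ) (e : ℕ → ℕ) (j : ℕ) : ℕ := ∑ i ∈ range m, e (m * j + i) * 2 ^ i

theorem eligibilityMask_lt (he : ∀ k, e k ≤ 1) (j : ℕ) : eligibilityMask m e j < 2 ^ m :=
  sum_mul_pow_lt fun _ _ => Nat.lt_succ_of_le (he _)

theorem eq_of_eligibilityMask_eq (he : ∀ k, e k ≤ 1)
    (h : eligibilityMask m e j = eligibilityMask m e j') {i : ℕ} (hi : i < m) :
    e (m * j + i) = e (m * j' + i) :=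
  eq_of_sum_mul_pow_eq (a := fun i => e (m * j + i)) (a' := fun i => e (m * j' + i))
    (fun _ _ => Nat.lt_succ_of_le (he _)) (fun _ _ => Nat.lt_succ_of_le (he _)) h hi

theorem eligibilityMask_ne_zero_iff : eligibilityMask m e j ≠ 0 ↔ ∃ i < m, e (m * j + i) ≠ 0 := by
  simp [eligibilityMask, sum_eq_zero_iff]

end Mask

/-- The variables of the program. -/
inductive Var
  | jobs | job | machine | maxSize | unitSize | rowMask | power | stuck | type | copy | target
  | pass | other | quota | freeCount | freeTotal | base | codes | item | code | rest | level
  | digit | found | bestLevel | bestCode | layer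
  deriving DecidableEq

/-- The arrays of the program. -/
inductive Arr
  | size | eligible | output | mask | witness | typeTotal | units | unitCount | filled
  | classCount | freeJob | fixedLoad | weight | table
  deriving DecidableEq

open Var Arr

/-- Addresses of the variables; the machine model prescribes that of `jobs`. -/
instance : Encodable Var where
  encode := Var.ctorIdx
  decode k := [jobs, job, machine, maxSize, unitSize, rowMask, power, stuck, type, copy,
    target, pass, other, quota, freeCount, freeTotal, base, codes, item, code, rest, level, digit,
    found, bestLevel, bestCode, layer][k]?
  encodek := by rintro ⟨⟩ <;> rfl

/-- Addresses of the arrays; the machine model prescribes those of `size`, `eligible` and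
`output`. -/
instance : Encodable Arr where
  encode := Arr.ctorIdx
  decode k := [size, eligible, output, mask, witness, typeTotal, units, unitCount, filled,
    classCount, freeJob, fixedLoad, weight, table][k]?
  encodek := by rintro ⟨⟩ <;> rfl

instance : Coe Var (Expr Var Arr) := ⟨.var⟩
instance : CoeFun Arr fun _ => Expr Var Arr → Expr Var Arr := ⟨.cell⟩

/-- The store holds the instance with `n` jobs of sizes `p` and the eligibility table `e`. -/
structure HasInput (n : ℕ) (p e : ℕ → ℕ) (σ : Store Var Arr) : Prop where
  jobs : σ.var jobs = n
  size : σ.arr size = p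
  eligible : σ.arr eligible = e

theorem HasInput.of_frame {n : ℕ} {p e : ℕ → ℕ} {c : Cmd Var Arr} {σ τ : Store Var Arr}
    (h : HasInput n p e σ) (hf : Frame c σ τ)
    (hc : Var.jobs ∉ c.vars ∧ Arr.size ∉ c.arrays ∧ Arr.eligible ∉ c.arrays := by
      exact of_decide_eq_true rfl) :
    HasInput n p e τ :=
  ⟨(hf.var _ hc.1).trans h.jobs, (hf.arr _ hc.2.1).trans h.size,
    (hf.arr _ hc.2.2).trans h.eligible⟩

section Scan

/-- Compute the eligibility mask of the current job. -/
def scanRow (m : ℕ) : Cmd Var Arr :=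
  rowMask ::= 0 ;; power ::= 1 ;;
  forLt machine m
    (rowMask ::= rowMask + eligible (m * job + machine) * power ;; power ::= power + power)

/-- Let `maxSize` be at least the size of the current job. -/
def updateMaxSize : Cmd Var Arr := .ite (size job - maxSize) (maxSize ::= size job) .skip

/-- Record the current job, whose eligibility mask is in `rowMask`. -/
def recordJob : Cmd Var Arr :=
  updateMaxSize ;;
  store mask job rowMask ;;
  store witness rowMask job ;;
  store typeTotal rowMask (typeTotal rowMask + size job) ;;
  .ite rowMask .skip (stuck ::= 1)

/-- Compute the maximum processing time and, for every mask, its jobs' total size and one of its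
jobs. The flag `stuck` is raised if some job has no eligible machine. -/
def scan (m : ℕ) : Cmd Var Arr :=
  forLt job jobs (scanRow m ;; recordJob) ;; unitSize ::= maxSize + 1

/-- What `scan` knows about the first `r` jobs. -/
structure Scanned (m : ℕ) (p e : ℕ → ℕ) (r : ℕ) (σ : Store Var Arr) : Prop where
  maxSize_eq : σ.var maxSize = (range r).sup p
  stuck_eq_zero_iff : σ.var stuck = 0 ↔ ∀ j < r, eligibilityMask m e j ≠ 0
  mask_eq : ∀ j < r, σ.arr mask j = eligibilityMask m e j
  mask_witness : ∀ j < r, eligibilityMask m e (σ.arr witness (eligibilityMask m e j)) =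
    eligibilityMask m e j
  typeTotal_eq : ∀ s, σ.arr typeTotal s = ∑ j ∈ range r with eligibilityMask m e j = s, p j

variable {B m n r : ℕ} {p e : ℕ → ℕ} {σ τ : Store Var Arr}

theorem Scanned.of_frame {c : Cmd Var Arr} (h : Scanned m p e r σ) (hf : Frame c σ τ)
    (hc : (.maxSize ∉ c.vars ∧ .stuck ∉ c.vars) ∧
      .mask ∉ c.arrays ∧ .witness ∉ c.arrays ∧ .typeTotal ∉ c.arrays := by
      exact of_decide_eq_true rfl) :
    Scanned m p e r τ := by
  obtain ⟨⟨hmax, hstuck⟩, hmask, hwitness, htotal⟩ := hc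
  constructor
  · rw [hf.var _ hmax, h.maxSize_eq]
  · rw [hf.var _ hstuck, h.stuck_eq_zero_iff]
  · simpa only [hf.arr _ hmask] using h.mask_eq
  · simpa only [hf.arr _ hwitness] using h.mask_witness
  · simpa only [hf.arr _ htotal] using h.typeTotal_eq

theorem scanRow_spec (hB : 2 ^ m ≤ B) (he : ∀ k, e k ≤ 1) (h : HasInput n p e σ) :
    Triple B (scanRow m) σ (4 * m + 4) fun τ =>
      τ.var rowMask = eligibilityMask m e (σ.var job) := by
  have hB₁ : 1 ≤ B := Nat.one_le_two_pow.trans hB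
  refine (Triple.assign_seq (Nat.zero_le B) (.assign_seq (by simpa using hB₁) (.forLt (N := m)
    (k := 2) (fun r τ => τ.var rowMask = eligibilityMask r (fun i => e (m * σ.var job + i)) 0 ∧
      τ.var power = 2 ^ r) (of_decide_eq_true rfl) rfl (Nat.lt_two_pow_self.le.trans hB)
    (by simp [eligibilityMask]) ?_ fun τ _ _ _ hτ => by
      simpa [eligibilityMask] using hτ.1))).mono (by omega) fun _ _ _ h => h
  rintro r hr τ - hframe hmachine ⟨hmask, hpower⟩
  have hjob : τ.var job = σ.var job := by simpa using hframe.var_eq job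
  have hτ : HasInput n p e τ := .of_frame (σ := ((σ.setVar rowMask 0).setVar power 1))
    ⟨by simpa using h.jobs, h.size, h.eligible⟩ hframe
  have hpow : 2 ^ (r + 1) ≤ B := (Nat.pow_le_pow_right two_pos hr).trans hB
  have hlt := eligibilityMask_lt (m := r + 1) (fun i => he (m * σ.var job + i)) 0
  simp only [eligibilityMask, sum_range_succ, mul_zero, zero_add] at hlt hmask ⊢
  refine .assign_seq ?_ (.assign ?_ ?_)
  · simp [hτ.eligible, hmask, hpower, hjob, hmachine]
    omega
  · simp [hpower]
    omega
  · simp [hτ.eligible, hmask, hpower, hjob, hmachine, pow_succ, mul_two]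

theorem Scanned.succ (h : Scanned m p e r σ) (hmax : τ.var maxSize = max (p r) (σ.var maxSize))
    (hstuck : τ.var stuck = if eligibilityMask m e r = 0 then 1 else σ.var stuck)
    (hmask : τ.arr mask = Function.update (σ.arr mask) r (eligibilityMask m e r))
    (hwitness : τ.arr witness = Function.update (σ.arr witness) (eligibilityMask m e r) r)
    (htotal : τ.arr typeTotal = Function.update (σ.arr typeTotal) (eligibilityMask m e r)
      (σ.arr typeTotal (eligibilityMask m e r) + p r)) :
    Scanned m p e (r + 1) τ where
  maxSize_eq := by rw [hmax, h.maxSize_eq, range_add_one, sup_insert]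
  stuck_eq_zero_iff := by
    rw [hstuck, Nat.forall_lt_succ_right]
    split_ifs with hr <;> simp [hr, h.stuck_eq_zero_iff]
  mask_eq j hj := by
    obtain rfl | hne := eq_or_ne j r
    · rw [hmask, Function.update_self]
    · rw [hmask, Function.update_of_ne hne, h.mask_eq j (by omega)]
  mask_witness j hj := by
    rw [hwitness, Function.update_apply]
    split_ifs with hjr
    · exact hjr.symm
    · refine h.mask_witness j (lt_of_le_of_ne (Nat.le_of_lt_succ hj) ?_)
      rintro rfl
      exact hjr rfl
  typeTotal_eq s := by
    rw [htotal, range_add_one, filter_insert]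
    obtain rfl | hne := eq_or_ne s (eligibilityMask m e r)
    · rw [Function.update_self, if_pos rfl, sum_insert (by simp), h.typeTotal_eq, add_comm]
    · rw [Function.update_of_ne hne, if_neg hne.symm, h.typeTotal_eq]

theorem Scanned.typeTotal_add_le (h : Scanned m p e r σ) (hr : r < n) :
    σ.arr typeTotal (eligibilityMask m e r) + p r ≤ n * (range n).sup p := by
  rw [h.typeTotal_eq, add_comm, ← sum_insert (by simp)]
  refine (sum_le_card_nsmul _ _ ((range n).sup p) fun j hj => le_sup ?_).trans ?_
  · simp only [mem_insert, mem_filter, mem_range] at hj ⊢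
    omega
  · rw [smul_eq_mul]
    gcongr
    refine (card_le_card (t := range n) fun j hj => ?_).trans_eq (card_range n)
    simp only [mem_insert, mem_filter, mem_range] at hj ⊢
    omega

theorem updateMaxSize_spec (hB : p (σ.var job) ≤ B) (h : HasInput n p e σ) :
    Triple B updateMaxSize σ 2
      fun τ => τ = σ.setVar maxSize (max (p (σ.var job)) (σ.var maxSize)) := by
  refine .ite (fun hlt => .assign ?_ ?_) (fun hle => .skip ?_)
  · simpa [h.size] using hB
  · simp only [eval_sub, eval_cell, eval_var, h.size] at hlt ⊢
    rw [max_eq_left (by omega)]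
  · simp only [eval_sub, eval_cell, eval_var, h.size] at hle
    rw [max_eq_right (by omega), Store.setVar_eq_self rfl]

theorem recordJob_spec (hB : 2 ^ m ≤ B) (hnB : n * (range n).sup p + n ≤ B) (he : ∀ k, e k ≤ 1)
    (hr : r < n) (hσ : HasInput n p e σ) (hjob : σ.var job = r)
    (hmask : σ.var rowMask = eligibilityMask m e r) (h : Scanned m p e r σ) :
    Triple B recordJob σ 7 (Scanned m p e (r + 1)) := by
  have htotal := h.typeTotal_add_le hr
  have hmlt := eligibilityMask_lt (m := m) he r
  refine (Triple.seq ((updateMaxSize_spec (by rw [hjob]; omega) hσ).mono le_rfl fun τ _ _ hτ =>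
    ?_)).mono (k := 2 + (1 + (1 + (1 + 2)))) le_rfl fun _ _ _ h => h
  subst hτ
  refine .store_seq ?_ (.store_seq ?_ (.store_seq ?_
    (.ite (fun hne => .skip (h.succ ?_ ?_ ?_ ?_ ?_)) fun h0 => .assign ?_ (h.succ ?_ ?_ ?_ ?_ ?_))))
  all_goals simp_all [hσ.size]
  all_goals omega

theorem scan_spec (hB : 2 ^ m ≤ B) (hnB : n * (range n).sup p + n ≤ B)
    (hpB : (range n).sup p + 1 ≤ B) (he : ∀ k, e k ≤ 1) (hσ : HasInput n p e σ)
    (h : Scanned m p e 0 σ) :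
    Triple B (scan m) σ (n * (4 * m + 13) + 3) fun τ =>
      Scanned m p e n τ ∧ τ.var unitSize = (range n).sup p + 1 := by
  refine Triple.seq (k := n * (4 * m + 4 + 7 + 2) + 2) (k' := 1) (.forLt (N := n)
    (Scanned m p e) (of_decide_eq_true rfl) (by simp [hσ.jobs]) (le_of_add_le_right hnB)
    ⟨h.1, h.2, h.3, h.4, h.5⟩ (fun r hr τ _ hframe hjob hτ => ?_) fun τ _ _ _ hτ =>
      .assign (by simpa [hτ.maxSize_eq]) ⟨⟨hτ.1, hτ.2, hτ.3, hτ.4, hτ.5⟩, by simp [hτ.maxSize_eq]⟩)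
  have hin := hσ.of_frame hframe
  refine Triple.seq (k := 4 * m + 4) (k' := 7) ((scanRow_spec hB he hin).mono le_rfl
    fun υ _ hscan hmask => (recordJob_spec hB hnB he hr (hin.of_frame hscan)
      ((hscan.var_eq job).trans hjob) (hjob ▸ hmask) (hτ.of_frame hscan)).mono le_rfl
        fun _ _ _ h => ⟨h.1, h.2, h.3, h.4, h.5⟩)

end Scan

end Assignment

/-! ### Spreading equal units over the machines -/

namespace Assignment

open RAM RAM.Cmd RAM.Expr Finset Var Arr

section Index

variable {m s s' i i' : ℕ}

theorem mul_add_eq_mul_add_iff (hi : i < m) (hi' : i' < m) :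
    m * s + i = m * s' + i' ↔ s = s' ∧ i = i' := by
  refine ⟨fun h => ?_, fun h => by rw [h.1, h.2]⟩
  have hdiv := congrArg (· / m) h
  have hmod := congrArg (· % m) h
  have hm := Nat.zero_lt_of_lt hi
  simp only [Nat.mul_add_div hm, Nat.mul_add_mod, Nat.div_eq_of_lt hi, Nat.div_eq_of_lt hi',
    Nat.mod_eq_of_lt hi, Nat.mod_eq_of_lt hi', add_zero] at hdiv hmod
  exact ⟨hdiv, hmod⟩

theorem mul_add_lt_mul {k : ℕ} (hs : s < k) (hi : i < m) : m * s + i < m * k :=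
  (Nat.add_lt_add_left hi _).trans_le (Nat.mul_le_mul_left m (Nat.succ_le_of_lt hs))

theorem sum_single_column {k t c : ℕ} (ht : t < k) (hc : c < m) (hi : i < m) :
    ∑ s ∈ range k, Pi.single (M := fun _ => ℕ) (m * t + c) 1 (m * s + i) =
      Pi.single (M := fun _ => ℕ) c 1 i := by
  simp [Pi.single_apply, mul_add_eq_mul_add_iff hi hc, ite_and, ht]

theorem sum_single_row {t c : ℕ} (hc : c < m) :
    ∑ i ∈ range m, Pi.single (M := fun _ => ℕ) (m * t + c) 1 (m * s + i) =
      Pi.single (M := fun _ => ℕ) t 1 s := by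
  rw [sum_eq_single_of_mem c (mem_range.2 hc) fun i hi hic => ?_]
  · simp only [Pi.single_apply, mul_add_eq_mul_add_iff hc hc, and_true]
  · rw [Pi.single_apply, if_neg]
    rintro h
    exact hic ((mul_add_eq_mul_add_iff (mem_range.1 hi) hc).1 h).2

end Index

/-- `U s` units of every type `s` have been placed on machines that are eligible for `s`: there are
`C (m * s + i)` units of type `s` on machine `i`, which holds `ρ i` units besides the `x i` units
that are still unsettled. No unit could move to a machine with at least two units fewer, the
unsettled ones not counted. -/
structure Spread (m : ℕ) (E : ℕ → ℕ → ℕ) (U ρ C x : ℕ → ℕ) : Prop where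
  eligible : ∀ s < 2 ^ m, ∀ i < m, C (m * s + i) ≠ 0 → E s i ≠ 0
  le_add_one : ∀ s < 2 ^ m, ∀ i < m, ∀ i' < m, C (m * s + i) ≠ 0 → E s i' ≠ 0 → ρ i ≤ ρ i' + 1
  column : ∀ i < m, ∑ s ∈ range (2 ^ m), C (m * s + i) = ρ i + x i
  row : ∀ s < 2 ^ m, ∑ i ∈ range m, C (m * s + i) = U s

/-- No unit on machine `c` of the type of cell `k` could move to the machine of that cell, which
has fewer units. -/
def Quiet (m : ℕ) (E : ℕ → ℕ → ℕ) (ρ C : ℕ → ℕ) (c k : ℕ) : Prop :=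
  E (k / m) (k % m) * C (m * (k / m) + c) * (ρ c - ρ (k % m)) = 0

section Spread

variable {m : ℕ} {E : ℕ → ℕ → ℕ} {U ρ C C' x : ℕ → ℕ} {c t s i : ℕ}

theorem Spread.le_sum (h : Spread m E U ρ C x) (hi : i < m) : ρ i ≤ ∑ s ∈ range (2 ^ m), U s :=
  calc ρ i ≤ ∑ s ∈ range (2 ^ m), C (m * s + i) := h.column i hi ▸ Nat.le_add_right _ _
    _ ≤ ∑ s ∈ range (2 ^ m), U s := sum_le_sum fun s hs => by
      rw [← h.row s (mem_range.1 hs)]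
      exact single_le_sum (f := fun i => C (m * s + i)) (fun _ _ => Nat.zero_le _)
        (mem_range.2 hi)

theorem Spread.cell_le_sum (h : Spread m E U ρ C x) (hs : s < 2 ^ m) (hi : i < m) :
    C (m * s + i) ≤ ∑ s ∈ range (2 ^ m), U s :=
  calc C (m * s + i) ≤ ∑ i ∈ range m, C (m * s + i) :=
        single_le_sum (f := fun i => C (m * s + i)) (fun _ _ => Nat.zero_le _) (mem_range.2 hi)
    _ = U s := h.row s hs
    _ ≤ _ := single_le_sum (f := U) (fun _ _ => Nat.zero_le _) (mem_range.2 hs)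

theorem Spread.insert (h : Spread m E U ρ C 0) (ht : t < 2 ^ m) (hc : c < m) (hE : E t c ≠ 0)
    (hleast : ∀ i < m, E t i ≠ 0 → ρ c ≤ ρ i) :
    Spread m E (U + Pi.single t 1) ρ (C + Pi.single (m * t + c) 1) (Pi.single c 1) := by
  have hcell {s i : ℕ} (hi : i < m) (hne : (C + Pi.single (m * t + c) 1 : ℕ → ℕ) (m * s + i) ≠ 0) :
      C (m * s + i) ≠ 0 ∨ s = t ∧ i = c := by
    simp only [Pi.add_apply, Pi.single_apply, mul_add_eq_mul_add_iff hi hc] at hne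
    grind
  constructor
  · intro s hs i hi hne
    obtain h' | ⟨rfl, rfl⟩ := hcell hi hne
    exacts [h.eligible s hs i hi h', hE]
  · intro s hs i hi i' hi' hne hE'
    obtain h' | ⟨rfl, rfl⟩ := hcell hi hne
    exacts [h.le_add_one s hs i hi i' hi' h' hE', (hleast i' hi' hE').trans (Nat.le_succ _)]
  · intro i hi
    simp only [Pi.add_apply, sum_add_distrib, h.column i hi, sum_single_column ht hc hi,
      Pi.zero_apply, add_zero]
  · intro s hs
    simp only [Pi.add_apply, sum_add_distrib, h.row s hs, sum_single_row hc]

theorem Spread.move (h : Spread m E U ρ C (Pi.single c 1)) (hs : s < 2 ^ m) (hc : c < m)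
    (hi : i < m) (hC : C (m * s + c) ≠ 0) (hE : E s i ≠ 0) (hlt : ρ i < ρ c)
    (hC' : C' + Pi.single (m * s + c) 1 = C + Pi.single (m * s + i) 1) :
    Spread m E U ρ C' (Pi.single i 1) := by
  have hcell {s' i' : ℕ} (hi' : i' < m) (hne : C' (m * s' + i') ≠ 0) :
      C (m * s' + i') ≠ 0 ∨ s' = s ∧ i' = i := by
    have := congrFun hC' (m * s' + i')
    simp only [Pi.add_apply, Pi.single_apply, mul_add_eq_mul_add_iff hi' hi] at this
    grind
  have hsum {ι : Type} (A : Finset ι) (f : ι → ℕ) := Finset.sum_congr (s₁ := A) rfl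
    fun a _ => congrFun hC' (f a)
  simp only [Pi.add_apply, sum_add_distrib] at hsum
  constructor
  · intro s' hs' i' hi' hne
    obtain h' | ⟨rfl, rfl⟩ := hcell hi' hne
    exacts [h.eligible s' hs' i' hi' h', hE]
  · intro s' hs' i' hi' i'' hi'' hne hE'
    obtain h' | ⟨rfl, rfl⟩ := hcell hi' hne
    · exact h.le_add_one s' hs' i' hi' i'' hi'' h' hE'
    · exact hlt.le.trans (h.le_add_one s' hs' c hc i'' hi'' hC hE')
  · intro i' hi'
    have := hsum (range (2 ^ m)) fun s => m * s + i'
    rw [sum_single_column hs hc hi', sum_single_column hs hi hi', h.column i' hi'] at this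
    omega
  · intro s' hs'
    have := hsum (range m) fun i => m * s' + i
    rw [sum_single_row hc, sum_single_row hi, h.row s' hs'] at this
    omega

theorem Spread.settle (h : Spread m E U ρ C (Pi.single c 1)) (hc : c < m)
    (hq : ∀ k < m * 2 ^ m, Quiet m E ρ C c k) : Spread m E U (ρ + Pi.single c 1) C 0 where
  eligible := h.eligible
  le_add_one s hs i hi i' hi' hne hE := by
    have hle := h.le_add_one s hs i hi i' hi' hne hE
    have := hq _ (mul_add_lt_mul hs hi')
    rw [Quiet, Nat.mul_add_div (Nat.zero_lt_of_lt hi), Nat.mul_add_mod, Nat.div_eq_of_lt hi',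
      Nat.mod_eq_of_lt hi', add_zero] at this
    simp only [Pi.add_apply, Pi.single_apply]
    obtain rfl | hic := eq_or_ne i c
    · have := (mul_eq_zero.1 this).resolve_left (mul_ne_zero hE hne)
      grind
    · grind
  column i hi := by rw [h.column i hi]; rfl
  row := h.row

end Spread

section Settling

variable {m N d d' r k : ℕ} {Q Q' : ℕ → Prop}

/-- Number of machines with fewer units than machine `c`. -/
def rank (m : ℕ) (ρ : ℕ → ℕ) (c : ℕ) : ℕ := #{i ∈ range m | ρ i < ρ c}

theorem rank_lt {ρ : ℕ → ℕ} {c : ℕ} (hc : c < m) : rank m ρ c < m :=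
  (card_lt_card (filter_ssubset (p := fun i => ρ i < ρ c).2
    ⟨c, mem_range.2 hc, lt_irrefl _⟩)).trans_eq (card_range m)

theorem rank_lt_rank {ρ : ℕ → ℕ} {c i : ℕ} (hi : i < m) (h : ρ i < ρ c) :
    rank m ρ i < rank m ρ c := by
  refine card_lt_card ⟨fun a ha => ?_, fun hsub => ?_⟩
  · rw [mem_filter] at ha ⊢
    exact ⟨ha.1, ha.2.trans h⟩
  · exact lt_irrefl _ (mem_filter.1 (hsub (mem_filter.2 ⟨mem_range.2 hi, h⟩))).2

/-- Progress of the pass `r` of a cascade over the cells `k' < N`, before it reaches cell `k`: the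
machine of the unsettled unit, of rank `d`, admits no move at all (`Q k'` says that it admits none
to cell `k'`), or a move has been made during this pass, or none was possible so far. -/
def Settling (m N : ℕ) (Q : ℕ → Prop) (d r k : ℕ) : Prop :=
  (∀ k' < N, Q k') ∨ d + r + 1 < m ∨ d + r < m ∧ ∀ k' < k, Q k'

theorem Settling.step (h : Settling m N Q d r k) (hk : Q k) : Settling m N Q d r (k + 1) :=
  h.imp_right <| Or.imp_right <| And.imp_right fun h k' hk' =>
    (Nat.lt_succ_iff_lt_or_eq.1 hk').elim (h k') fun h => h ▸ hk

theorem Settling.move (h : Settling m N Q d r k) (hkN : k < N) (hk : ¬ Q k) (hd : d' < d) :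
    Settling m N Q' d' r (k + 1) := by
  obtain h | h | h := h
  exacts [absurd (h k hkN) hk, .inr (.inl (by omega)), .inr (.inl (by omega))]

theorem Settling.next_pass (h : Settling m N Q d r N) : Settling m N Q d (r + 1) 0 := by
  obtain h | h | h := h
  exacts [.inl h, .inr (.inr ⟨by omega, by simp⟩), .inl h.2]

theorem Settling.forall_of_pass_eq (h : Settling m N Q d m 0) : ∀ k < N, Q k := by
  obtain h | h | h := h
  exacts [h, by omega, by omega]

end Settling

/-- Let `target` be the last machine at which `e` does not vanish, if there is one. -/
def pick (m : ℕ) (e : Expr Var Arr) : Cmd Var Arr :=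
  forLt machine m (.ite e (target ::= machine) .skip)

/-- Let `target` be a machine with the fewest units among those eligible for `type`. -/
def pickLeast (m : ℕ) : Cmd Var Arr :=
  pick m (eligible (m * witness type + machine)) ;;
  forLt machine m
    (.ite (eligible (m * witness type + machine) * (unitCount target - unitCount machine))
      (target ::= machine) .skip)

/-- Move a unit from `target` to the machine of the current cell, if it has the type of that cell
and that machine has fewer units. Then `target` is the machine that has received the unit. -/
def tryMove (m : ℕ) : Cmd Var Arr :=
  other ::= item / m ;; machine ::= item - m * other ;;
  .ite (eligible (m * witness other + machine) * units (m * other + target) *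
      (unitCount target - unitCount machine))
    (store units (m * other + target) (units (m * other + target) - 1) ;;
      store units (m * other + machine) (units (m * other + machine) + 1) ;;
      target ::= machine)
    .skip

/-- Move units, each from the machine that received the last one, until no move is possible. -/
def cascade (m : ℕ) : Cmd Var Arr :=
  forLt pass m (forLt item (m * 2 ^ m : ℕ) (tryMove m))

/-- Add a unit of type `type`. -/
def insertUnit (m : ℕ) : Cmd Var Arr :=
  pickLeast m ;;
  store units (m * type + target) (units (m * type + target) + 1) ;;
  cascade m ;;
  store unitCount target (unitCount target + 1)

/-- Insert as many units of type `type` as are needed to cover its total size. -/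
def insertUnits (m : ℕ) : Cmd Var Arr :=
  forLt copy ((typeTotal type + unitSize - 1) / unitSize) (insertUnit m)

/-- Insert the units of all types. -/
def placeUnits (m : ℕ) : Cmd Var Arr := forLt type (2 ^ m : ℕ) (insertUnits m)

section Spec

variable {B m n r k : ℕ} {E : ℕ → ℕ → ℕ} {U ρ : ℕ → ℕ} {σ τ : Store Var Arr}

theorem pick_spec {e : Expr Var Arr} {f : ℕ → ℕ} (hm : m ≤ B)
    (hf : ∀ τ, Frame (pick m e) σ τ → τ.var machine < m → e.eval τ = f (τ.var machine)) :
    Triple B (pick m e) σ (m * 4 + 2) fun τ =>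
      τ.var target < m ∧ f (τ.var target) ≠ 0 ∨
        τ.var target = σ.var target ∧ ∀ i < m, f i = 0 := by
  refine .forLt (N := m) (k := 2) (fun r τ => τ.var target < m ∧ f (τ.var target) ≠ 0 ∨
    τ.var target = σ.var target ∧ ∀ i < r, f i = 0) (of_decide_eq_true rfl) rfl hm (by simp) ?_
    (fun _ _ _ _ h => h)
  intro i hi τ hτ hframe hmachine h
  have he := hf τ hframe (hmachine.trans_lt hi)
  rw [hmachine] at he
  refine .ite (fun hne => .assign (hτ.var machine) (.inl ?_)) (fun h0 => .skip ?_)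
  · rw [he] at hne
    simpa [hmachine] using ⟨hi, hne⟩
  · simp only [Store.var_setVar, reduceCtorEq, if_false]
    refine h.imp_right fun h => ⟨h.1, fun i' hi' => ?_⟩
    obtain hi' | rfl := Nat.lt_succ_iff_lt_or_eq.1 hi'
    exacts [h.2 i' hi', he ▸ h0]

/-- `E` tells, by means of the witnesses, which machines are eligible for which type. -/
def HasTypes (m : ℕ) (E : ℕ → ℕ → ℕ) (σ : Store Var Arr) : Prop :=
  ∀ s i, σ.arr eligible (m * σ.arr witness s + i) = E s i

theorem HasTypes.of_frame {c : Cmd Var Arr} (h : HasTypes m E σ) (hf : Frame c σ τ)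
    (hc : .eligible ∉ c.arrays ∧ .witness ∉ c.arrays := by exact of_decide_eq_true rfl) :
    HasTypes m E τ := by
  rw [HasTypes, hf.arr _ hc.1, hf.arr _ hc.2]
  exact h

theorem pickLeast_spec (hm : m ≤ B) (hE : HasTypes m E σ) (hρ : σ.arr unitCount = ρ)
    (hex : ∃ i < m, E (σ.var type) i ≠ 0) :
    Triple B (pickLeast m) σ (8 * m + 4) fun τ =>
      τ.var target < m ∧ E (σ.var type) (τ.var target) ≠ 0 ∧
        ∀ i < m, E (σ.var type) i ≠ 0 → ρ (τ.var target) ≤ ρ i := by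
  refine (Triple.seq (k := m * 4 + 2) (k' := m * 4 + 2) ((pick_spec hm (f := E (σ.var type))
    fun τ hf _ => ?_).mono le_rfl fun τ _ hf hpick => ?_)).mono (by omega) fun _ _ _ h => h
  · have hE' := hE.of_frame hf
    simpa [hf.var_eq type] using hE' _ _
  have hpick : τ.var target < m ∧ E (σ.var type) (τ.var target) ≠ 0 :=
    hpick.resolve_right fun h => hex.elim fun i hi => hi.2 (h.2 i hi.1)
  refine .forLt (N := m) (k := 2) (fun r τ => τ.var target < m ∧
    E (σ.var type) (τ.var target) ≠ 0 ∧ ∀ i < r, E (σ.var type) i ≠ 0 → ρ (τ.var target) ≤ ρ i)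
    (of_decide_eq_true rfl) rfl hm (by simpa using hpick) ?_ (fun _ _ _ _ h => h)
  rintro i hi υ hυ hf' hmachine ⟨hlt, hne, hle⟩
  have htype : υ.var type = σ.var type := (hf'.var_eq type).trans (hf.var_eq type)
  have hE' := (hE.of_frame hf).of_frame hf'
  have hρ' : υ.arr unitCount = ρ := (hf'.arr_eq unitCount).trans ((hf.arr_eq unitCount).trans hρ)
  refine .ite (fun hc => .assign (hυ.var machine) ?_) (fun hc => .skip ?_)
  all_goals
    simp only [eval_mul, eval_cell, eval_add, eval_natCast, eval_var, eval_sub, hE' _ _, htype, hρ',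
      hmachine] at hc
    simp only [Store.var_setVar, eval_var, hmachine, reduceCtorEq, if_false, if_true]
  · obtain ⟨hEi, hlt'⟩ := mul_ne_zero_iff.1 hc
    refine ⟨hi, hEi, fun i' hi' hE'' => ?_⟩
    obtain hi' | rfl := Nat.lt_succ_iff_lt_or_eq.1 hi'
    exacts [(by omega : ρ i ≤ ρ (υ.var target)).trans (hle i' hi' hE''), le_rfl]
  · refine ⟨hlt, hne, fun i' hi' hE'' => ?_⟩
    obtain hi' | rfl := Nat.lt_succ_iff_lt_or_eq.1 hi'
    exacts [hle i' hi' hE'', Nat.sub_eq_zero_iff_le.1 ((mul_eq_zero.1 hc).resolve_left hE'')]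

/-- A cascade is at machine `target`, where the one unsettled unit is; it has reached cell `k` in
pass `r`. -/
structure Cascading (m : ℕ) (E : ℕ → ℕ → ℕ) (U ρ : ℕ → ℕ) (r k : ℕ) (σ : Store Var Arr) :
    Prop where
  target_lt : σ.var target < m
  spread : Spread m E U ρ (σ.arr units) (Pi.single (σ.var target) 1)
  settling : Settling m (m * 2 ^ m) (Quiet m E ρ (σ.arr units) (σ.var target))
    (rank m ρ (σ.var target)) r k

theorem Cascading.of_quiet (h : Cascading m E U ρ r k σ)
    (hquiet : Quiet m E ρ (σ.arr units) (σ.var target) k) (hunits : τ.arr units = σ.arr units)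
    (htarget : τ.var target = σ.var target) : Cascading m E U ρ r (k + 1) τ := by
  obtain ⟨hlt, hspread, hsettling⟩ := h
  constructor
  all_goals rw [htarget]
  exacts [hlt, hunits ▸ hspread, hunits ▸ hsettling.step hquiet]

theorem Cascading.move (h : Cascading m E U ρ r k σ) (hk : k < m * 2 ^ m)
    (hquiet : ¬ Quiet m E ρ (σ.arr units) (σ.var target) k) (htarget : τ.var target = k % m)
    (hunits : τ.arr units + Pi.single (m * (k / m) + σ.var target) 1 =
      σ.arr units + Pi.single (m * (k / m) + k % m) 1) :
    Cascading m E U ρ r (k + 1) τ := by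
  have hi : k % m < m := Nat.mod_lt k (Nat.zero_lt_of_lt h.target_lt)
  obtain ⟨⟨hE, hC⟩, hlt⟩ : (E (k / m) (k % m) ≠ 0 ∧ σ.arr units (m * (k / m) + σ.var target) ≠ 0) ∧
      ρ (σ.var target) - ρ (k % m) ≠ 0 := by rwa [Quiet, ← ne_eq, mul_ne_zero_iff,
        mul_ne_zero_iff] at hquiet
  have hlt : ρ (k % m) < ρ (σ.var target) := Nat.lt_of_sub_ne_zero hlt
  constructor
  all_goals rw [htarget]
  · exact hi
  · exact h.spread.move (Nat.div_lt_of_lt_mul hk) h.target_lt hi hC hE hlt hunits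
  · exact h.settling.move hk hquiet (rank_lt_rank hi hlt)

theorem update_succ_eq_add_single (f : ℕ → ℕ) (a : ℕ) :
    Function.update f a (f a + 1) = f + Pi.single a 1 := by
  funext k
  simp only [Pi.add_apply, Pi.single_apply, Function.update_apply]
  grind

theorem update_update_add_single {f : ℕ → ℕ} {a : ℕ} (ha : f a ≠ 0) (b : ℕ) :
    Function.update (Function.update f a (f a - 1)) b (Function.update f a (f a - 1) b + 1) +
      Pi.single a 1 = f + Pi.single b 1 := by
  funext k
  simp only [Pi.add_apply, Pi.single_apply, Function.update_apply]
  grind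

theorem tryMove_spec (hUB : ∑ s ∈ range (2 ^ m), U s < B) (hE : HasTypes m E σ)
    (hρ : σ.arr unitCount = ρ) (hitem : σ.var item = k) (hk : k < m * 2 ^ m) (hkB : k ≤ B)
    (h : Cascading m E U ρ r k σ) :
    Triple B (tryMove m) σ 6 (Cascading m E U ρ r (k + 1)) := by
  have hs : k / m < 2 ^ m := Nat.div_lt_of_lt_mul hk
  have hi : k % m < m := Nat.mod_lt k (Nat.zero_lt_of_lt h.target_lt)
  refine .assign_seq (by simpa [hitem] using (Nat.div_le_self k m).trans hkB)
    (.assign_seq (by simp [hitem]; omega) (Triple.ite (k := 3) (fun hc => ?_) fun hc => ?_))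
  all_goals
    simp only [eval_mul, eval_cell, eval_add, eval_var, eval_sub, eval_div, eval_natCast,
      Store.arr_setVar, Store.var_setVar, hitem, hρ, reduceCtorEq, if_true, if_false, hE _ _,
      ← Nat.mod_eq_sub] at hc ⊢
  · have hne := right_ne_zero_of_mul (left_ne_zero_of_mul hc)
    have hadd := update_update_add_single hne (m * (k / m) + k % m)
    have hadd' := congrFun hadd (m * (k / m) + k % m)
    have hle := h.spread.cell_le_sum hs hi
    have hle' := h.spread.cell_le_sum hs h.target_lt
    have hmod : k % m ≤ B := (Nat.mod_le k m).trans hkB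
    refine .store_seq ?_ (.store_seq ?_ (.assign ?_ (h.move hk hc ?_ ?_)))
    · simpa using hle'.trans (by omega)
    · simp at hadd' ⊢
      omega
    · simpa using hmod
    · simp
    · simpa using hadd
  · exact (Triple.skip (h.of_quiet hc (by simp) (by simp))).mono (by omega) fun _ _ _ h => h

theorem cascade_spec (hmB : m * 2 ^ m ≤ B) (hUB : ∑ s ∈ range (2 ^ m), U s < B)
    (hE : HasTypes m E σ) (hρ : σ.arr unitCount = ρ) (htarget : σ.var target < m)
    (h : Spread m E U ρ (σ.arr units) (Pi.single (σ.var target) 1)) :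
    Triple B (cascade m) σ (m * (m * 2 ^ m * 8 + 4) + 2) fun τ => τ.var target < m ∧
      Spread m E U (ρ + Pi.single (τ.var target) 1) (τ.arr units) 0 := by
  refine .forLt (N := m) (k := m * 2 ^ m * 8 + 2) (Cascading m E U ρ · 0)
    (of_decide_eq_true rfl) rfl ((Nat.le_mul_of_pos_right m (by positivity)).trans hmB)
    ⟨htarget, h, .inr (.inr ⟨rank_lt htarget, by simp⟩)⟩ (fun r _ τ _ hframe _ hτ => ?_)
    fun τ _ _ _ hτ => ⟨hτ.target_lt, hτ.spread.settle hτ.target_lt hτ.settling.forall_of_pass_eq⟩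
  refine .forLt (N := m * 2 ^ m) (k := 6) (Cascading m E U ρ r) (of_decide_eq_true rfl) rfl hmB
    ⟨hτ.1, hτ.2, hτ.3⟩ (fun k hk υ _ hframe' hitem hυ => ?_)
    fun υ _ _ _ hυ => ⟨hυ.1, hυ.2, hυ.3.next_pass⟩
  exact (tryMove_spec hUB ((hE.of_frame hframe).of_frame hframe')
    ((hframe'.arr_eq unitCount).trans ((hframe.arr_eq unitCount).trans hρ)) hitem hk
      (hk.le.trans hmB) hυ).mono le_rfl fun _ _ _ h => ⟨h.1, h.2, h.3⟩

/-- Units of every type have been placed and settled, `U s` of them for type `s`. -/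
structure HasUnits (m : ℕ) (E : ℕ → ℕ → ℕ) (U : ℕ → ℕ) (σ : Store Var Arr) : Prop where
  types : HasTypes m E σ
  spread : Spread m E U (σ.arr unitCount) (σ.arr units) 0

theorem insertUnit_spec {t : ℕ} (hmB : m * 2 ^ m ≤ B) (hUB : ∑ s ∈ range (2 ^ m), U s + 1 < B)
    (ht : t < 2 ^ m) (htype : σ.var type = t) (hex : ∃ i < m, E t i ≠ 0) (h : HasUnits m E U σ) :
    Triple B (insertUnit m) σ (m * (8 * m * 2 ^ m + 12) + 8)
      (HasUnits m E (U + Pi.single t 1)) := by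
  have hm : m ≤ B := (Nat.le_mul_of_pos_right m (by positivity)).trans hmB
  have hsum : ∑ s ∈ range (2 ^ m), (U + Pi.single t 1 : ℕ → ℕ) s < B := by
    simpa [sum_add_distrib, Pi.single_apply, ht] using hUB
  refine (Triple.seq (k' := 1 + (m * (m * 2 ^ m * 8 + 4) + 2 + 1)) ((pickLeast_spec hm h.types rfl
    (htype ▸ hex)).mono le_rfl fun τ _ hf hτ => ?_)).mono (by ring_nf; omega) fun _ _ _ h => h
  obtain ⟨htarget, hEt, hleast⟩ := htype ▸ hτ
  have hE := h.types.of_frame hf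
  have htype' : τ.var type = t := (hf.var_eq type).trans htype
  have hspread := h.spread.insert ht htarget hEt hleast
  have hcell := hspread.cell_le_sum ht htarget
  simp only [Pi.add_apply, Pi.single_eq_same] at hcell
  refine .store_seq (by simpa [htype'] using hf.arr_eq units ▸ hcell.trans hsum.le) ?_
  refine Triple.seq ((cascade_spec (E := E) (U := U + Pi.single t 1) (ρ := σ.arr unitCount) hmB hsum
    ?_ ?_ ?_ ?_).mono le_rfl fun υ _ hf' ⟨htarget', hυ⟩ => ?_)
  · simpa [HasTypes] using hE
  · simpa using hf.arr_eq unitCount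
  · simpa using htarget
  · simpa [htype', hf.arr_eq units, update_succ_eq_add_single] using hspread
  · have hcount : υ.arr unitCount = σ.arr unitCount :=
      (hf'.arr_eq unitCount).trans (by simpa using hf.arr_eq unitCount)
    refine .store (by simpa [hcount] using (hυ.le_sum htarget').trans hsum.le) ⟨?_, ?_⟩
    · have hE' : HasTypes m E (τ.setArr units (m * t + τ.var target)
          (σ.arr units (m * t + τ.var target) + 1)) := by simpa [HasTypes] using hE
      simpa [HasTypes] using hE'.of_frame (by simpa [htype', hf.arr_eq units] using hf')
    · simpa [hcount, update_succ_eq_add_single] using hυ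

theorem insertUnits_spec {N t : ℕ} (hmB : m * 2 ^ m ≤ B) (ht : t < 2 ^ m)
    (hNB : ∑ s ∈ range (2 ^ m), U s + N < B) (htype : σ.var type = t)
    (hN : (σ.arr typeTotal t + σ.var unitSize - 1) / σ.var unitSize = N)
    (hex : N ≠ 0 → ∃ i < m, E t i ≠ 0) (h : HasUnits m E U σ) :
    Triple B (insertUnits m) σ (N * (m * (8 * m * 2 ^ m + 12) + 10) + 2)
      (HasUnits m E (U + Pi.single t N)) := by
  refine .forLt (N := N) (fun u => HasUnits m E (U + Pi.single t u)) (of_decide_eq_true rfl)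
    (by simpa [htype] using hN) (by omega) ?_ (fun u hu τ _ hframe _ hτ => ?_) fun _ _ _ _ h => h
  · rw [Pi.single_zero, add_zero]
    exact ⟨h.1, h.2⟩
  · refine (insertUnit_spec hmB ?_ ht ((hframe.var_eq type).trans htype)
      (hex (Nat.ne_zero_of_lt hu)) hτ).mono le_rfl fun υ _ _ hυ => ?_
    · simp [sum_add_distrib, Pi.single_apply, ht]
      omega
    · rw [Pi.single_add, ← add_assoc]
      exact ⟨hυ.1, hυ.2⟩

theorem placeUnits_spec {N : ℕ → ℕ} (hm : 1 ≤ m) (hmB : m * 2 ^ m ≤ B) (hNB : 2 ^ m * n < B)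
    (hN : ∀ t, (σ.arr typeTotal t + σ.var unitSize - 1) / σ.var unitSize = N t)
    (hNn : ∀ t, N t ≤ n) (hex : ∀ t < 2 ^ m, N t ≠ 0 → ∃ i < m, E t i ≠ 0)
    (hE : HasTypes m E σ) (hunits : σ.arr units = 0) (hcount : σ.arr unitCount = 0) :
    Triple B (placeUnits m) σ (2 ^ m * (n * (m * (8 * m * 2 ^ m + 12) + 10) + 4) + 2) fun τ =>
      Spread m E N (τ.arr unitCount) (τ.arr units) 0 := by
  refine .forLt (N := 2 ^ m) (k := n * (m * (8 * m * 2 ^ m + 12) + 10) + 2)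
    (fun t => HasUnits m E (∑ s ∈ range t, Pi.single s (N s))) (of_decide_eq_true rfl) rfl
    ((Nat.le_mul_of_pos_left _ hm).trans hmB) ⟨hE, ?_⟩ (fun t ht τ _ hframe htype hτ => ?_)
    fun τ _ _ _ hτ => ⟨hτ.2.1, hτ.2.2, hτ.2.3, fun s hs => (hτ.2.row s hs).trans ?_⟩
  · simp only [Store.arr_setVar, hunits, hcount]
    constructor <;> simp
  · refine (insertUnits_spec hmB ht ?_ htype ?_ (hex t ht) hτ).mono (by have := hNn t; gcongr)
      fun υ _ _ hυ => ?_
    · have hprefix : ∑ s ∈ range (2 ^ m), (∑ t' ∈ range t, Pi.single t' (N t') : ℕ → ℕ) s =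
          ∑ t' ∈ range t, N t' := by
        simp only [Finset.sum_apply]
        rw [sum_comm]
        refine sum_congr rfl fun t' ht' => ?_
        simp [Pi.single_apply, (mem_range.1 ht').trans ht]
      calc _ = ∑ t' ∈ range (t + 1), N t' := by rw [hprefix, sum_range_succ]
        _ ≤ (t + 1) * n := by simpa using sum_le_card_nsmul (range (t + 1)) N n fun t' _ => hNn t'
        _ ≤ 2 ^ m * n := Nat.mul_le_mul_right n ht
        _ < B := hNB
    · rw [hframe.arr_eq typeTotal, hframe.var_eq unitSize, hN]
    · rw [sum_range_succ]
      exact ⟨hυ.1, hυ.2⟩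
  · simp [Finset.sum_apply, Pi.single_apply, hs]

end Spec

end Assignment

/-! ### Filling the units with jobs -/

namespace Assignment

open RAM RAM.Cmd RAM.Expr Finset Var Arr

section Loads

variable {m n s i : ℕ} {p y type : ℕ → ℕ}

/-- The load of machine `i` if job `j < n` is put on machine `y j`. -/
def loadOn (n : ℕ) (p y : ℕ → ℕ) (i : ℕ) : ℕ := ∑ j ∈ range n with y j = i, p j

/-- The part of the load of machine `i` that stems from jobs of type `s`. -/
def typeLoad (type : ℕ → ℕ) (n : ℕ) (p y : ℕ → ℕ) (s i : ℕ) : ℕ :=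
  ∑ j ∈ range n with type j = s ∧ y j = i, p j

theorem sum_machines_typeLoad (hy : ∀ j < n, y j < m) (s : ℕ) :
    ∑ i ∈ range m, typeLoad type n p y s i = ∑ j ∈ range n with type j = s, p j := by
  rw [← sum_fiberwise_of_maps_to (s := {j ∈ range n | type j = s}) (t := range m) (g := y)
    fun j hj => mem_range.2 (hy j (mem_range.1 (mem_filter.1 hj).1))]
  simp only [typeLoad, filter_filter]

theorem sum_types_typeLoad {N : ℕ} (htype : ∀ j < n, type j < N) (i : ℕ) :
    ∑ s ∈ range N, typeLoad type n p y s i = loadOn n p y i := by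
  rw [loadOn, ← sum_fiberwise_of_maps_to (s := {j ∈ range n | y j = i}) (t := range N) (g := type)
    fun j hj => mem_range.2 (htype j (mem_range.1 (mem_filter.1 hj).1))]
  simp only [typeLoad, filter_filter, and_comm]

@[simp] theorem typeLoad_zero : typeLoad type 0 p y s i = 0 := rfl

theorem typeLoad_succ_update {r c : ℕ} :
    typeLoad type (r + 1) p (Function.update y r c) s i =
      typeLoad type r p y s i + if type r = s ∧ c = i then p r else 0 := by
  rw [typeLoad, typeLoad, sum_filter, sum_range_succ, Function.update_self, sum_filter]
  refine congrArg (· + _) (sum_congr rfl fun j hj => ?_)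
  rw [Function.update_of_ne (mem_range.1 hj).ne]

end Loads

/-- Put the current job on an eligible machine, if possible on one with free room in a unit of the
type of that job. -/
def assignJob (m : ℕ) : Cmd Var Arr :=
  pick m (eligible (m * job + machine)) ;;
  pick m (units (m * mask job + machine) * unitSize - filled (m * mask job + machine)) ;;
  store output job target ;;
  store filled (m * mask job + target) (filled (m * mask job + target) + size job)

/-- Put all jobs on machines. -/
def distribute (m : ℕ) : Cmd Var Arr := forLt job jobs (assignJob m)

/-- The first `r` jobs have been distributed over the units, cell `k` of `C` counting the units of
size `q` in that cell. Only the last job put into a cell may exceed its units. -/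
structure Filled (m : ℕ) (p e C : ℕ → ℕ) (q r : ℕ) (σ : Store Var Arr) : Prop where
  output_lt : ∀ j < r, σ.arr output j < m
  eligible : ∀ j < r, e (m * j + σ.arr output j) ≠ 0
  used : ∀ j < r, 0 < p j → C (m * eligibilityMask m e j + σ.arr output j) ≠ 0
  filled_eq : ∀ s, ∀ i < m, σ.arr filled (m * s + i) =
    typeLoad (eligibilityMask m e) r p (σ.arr output) s i
  filled_le : ∀ s, ∀ i < m, σ.arr filled (m * s + i) ≤ C (m * s + i) * q + q

section Filled

variable {B m n q r c : ℕ} {p e C : ℕ → ℕ} {σ τ : Store Var Arr}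

theorem Filled.size_eq_zero (h : Filled m p e C q r σ) (hr : r < n)
    (hcap : ∑ j ∈ range n with eligibilityMask m e j = eligibilityMask m e r, p j ≤
      ∑ i ∈ range m, C (m * eligibilityMask m e r + i) * q)
    (hfull : ∀ i < m, C (m * eligibilityMask m e r + i) * q ≤
      σ.arr filled (m * eligibilityMask m e r + i)) : p r = 0 := by
  set s := eligibilityMask m e r
  have hsum : ∑ j ∈ range r with eligibilityMask m e j = s, p j + p r ≤
      ∑ j ∈ range n with eligibilityMask m e j = s, p j := by
    rw [add_comm, ← sum_insert (by simp)]
    refine sum_le_sum_of_subset fun j hj => ?_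
    obtain rfl | hj := mem_insert.1 hj
    · exact mem_filter.2 ⟨mem_range.2 hr, rfl⟩
    · rw [mem_filter, mem_range] at hj ⊢
      exact ⟨hj.1.trans hr, hj.2⟩
  have hle : ∑ i ∈ range m, C (m * s + i) * q ≤
      ∑ j ∈ range r with eligibilityMask m e j = s, p j := by
    rw [← sum_machines_typeLoad h.output_lt]
    exact sum_le_sum fun i hi =>
      (hfull i (mem_range.1 hi)).trans_eq (h.filled_eq s i (mem_range.1 hi))
  omega

theorem Filled.succ (h : Filled m p e C q r σ) (hc : c < m) (he : e (m * r + c) ≠ 0)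
    (hpq : p r ≤ q)
    (hroom : σ.arr filled (m * eligibilityMask m e r + c) <
      C (m * eligibilityMask m e r + c) * q ∨ p r = 0)
    (houtput : τ.arr output = Function.update (σ.arr output) r c)
    (hfilled : τ.arr filled = Function.update (σ.arr filled) (m * eligibilityMask m e r + c)
      (σ.arr filled (m * eligibilityMask m e r + c) + p r)) :
    Filled m p e C q (r + 1) τ where
  output_lt j hj := by
    rw [houtput, Function.update_apply]
    split_ifs with hjr
    exacts [hc, h.output_lt j (by omega)]
  eligible j hj := by
    rw [houtput, Function.update_apply]
    split_ifs with hjr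
    exacts [hjr ▸ he, h.eligible j (by omega)]
  used j hj hp := by
    rw [houtput, Function.update_apply]
    split_ifs with hjr
    · subst hjr
      exact left_ne_zero_of_mul (Nat.ne_zero_of_lt (hroom.resolve_right hp.ne'))
    · exact h.used j (by omega) hp
  filled_eq s i hi := by
    simp only [houtput, typeLoad_succ_update, hfilled, Function.update_apply,
      mul_add_eq_mul_add_iff hi hc, ← h.filled_eq s i hi]
    grind
  filled_le s i hi := by
    simp only [hfilled, Function.update_apply, mul_add_eq_mul_add_iff hi hc]
    have hle := h.filled_le s i hi
    split_ifs with hsi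
    · obtain ⟨rfl, rfl⟩ := hsi
      omega
    · exact hle

theorem assignJob_spec (hm : m ≤ B) (hr : σ.var job = r) (hpq : p r ≤ σ.var unitSize)
    (hσ : HasInput n p e σ) (hmask : σ.arr mask r = eligibilityMask m e r)
    (hex : ∃ i < m, e (m * r + i) ≠ 0)
    (hunits : ∀ i < m, σ.arr units (m * eligibilityMask m e r + i) ≠ 0 → e (m * r + i) ≠ 0)
    (hfull : (∀ i < m, σ.arr units (m * eligibilityMask m e r + i) * σ.var unitSize ≤
      σ.arr filled (m * eligibilityMask m e r + i)) → p r = 0)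
    (hB : ∀ i < m, σ.arr filled (m * eligibilityMask m e r + i) + p r ≤ B)
    (h : Filled m p e (σ.arr units) (σ.var unitSize) r σ) :
    Triple B (assignJob m) σ (8 * m + 6)
      (Filled m p e (σ.arr units) (σ.var unitSize) (r + 1)) := by
  set s := eligibilityMask m e r
  refine (Triple.seq (k' := m * 4 + 2 + (1 + 1)) ((pick_spec hm (f := fun i => e (m * r + i))
    fun τ hf _ => by simp [hf.arr_eq Arr.eligible, hf.var_eq job, hσ.eligible, hr]).mono le_rfl
    fun τ _ hf hτ => ?_)).mono (by omega) fun _ _ _ h => h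
  have helig : τ.var target < m ∧ e (m * r + τ.var target) ≠ 0 :=
    hτ.resolve_right fun h => hex.elim fun i hi => hi.2 (h.2 i hi.1)
  have hjob : τ.var job = r := (hf.var_eq job).trans hr
  refine Triple.seq ((pick_spec hm (f := fun i => σ.arr units (m * s + i) * σ.var unitSize -
    σ.arr filled (m * s + i)) fun υ hf' _ => by
      simp [hf'.arr_eq units, hf'.arr_eq mask, hf'.arr_eq filled, hf'.var_eq job,
        hf'.var_eq unitSize, hf.arr_eq units, hf.arr_eq mask, hf.arr_eq filled,
        hf.var_eq unitSize, hjob, hmask, s]).mono le_rfl fun υ hυB hf' hυ => ?_)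
  have htarget : υ.var target < m ∧ e (m * r + υ.var target) ≠ 0 ∧
      (σ.arr filled (m * s + υ.var target) <
        σ.arr units (m * s + υ.var target) * σ.var unitSize ∨ p r = 0) := by
    obtain ⟨hlt, hne⟩ | ⟨heq, hzero⟩ := hυ
    · have hlt' := Nat.lt_of_sub_ne_zero hne
      exact ⟨hlt, hunits _ hlt (left_ne_zero_of_mul (Nat.ne_zero_of_lt hlt')), .inl hlt'⟩
    · rw [heq]
      exact ⟨helig.1, helig.2, .inr (hfull fun i hi => Nat.sub_eq_zero_iff_le.1 (hzero i hi))⟩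
  have hjob' : υ.var job = r := (hf'.var_eq job).trans hjob
  have harr {T} (hT : T ∉ (pick m 0).arrays) : υ.arr T = σ.arr T :=
    (hf'.arr T hT).trans (hf.arr T hT)
  have hsize : υ.arr size = p := (harr (of_decide_eq_true rfl)).trans hσ.size
  have hmask' : υ.arr mask r = s := by rw [harr (of_decide_eq_true rfl), hmask]
  have hfilled : υ.arr filled = σ.arr filled := harr (of_decide_eq_true rfl)
  refine .store_seq (by simpa using hυB.var target) (.store ?_ (h.succ htarget.1 htarget.2.1 hpq
    htarget.2.2 ?_ ?_))
  · simpa [hfilled, hmask', hjob', hsize] using hB _ htarget.1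
  · simp [hjob', harr (T := output) (of_decide_eq_true rfl)]
  · simp [hfilled, hmask', hjob', hsize, s]

theorem distribute_spec (hm : m ≤ B) (hnB : n ≤ B) (hpB : ∑ j ∈ range n, p j ≤ B)
    (hσ : HasInput n p e σ) (hmask : ∀ j < n, σ.arr mask j = eligibilityMask m e j)
    (hpq : ∀ j < n, p j ≤ σ.var unitSize) (hex : ∀ j < n, ∃ i < m, e (m * j + i) ≠ 0)
    (hunits : ∀ j < n, ∀ i < m,
      σ.arr units (m * eligibilityMask m e j + i) ≠ 0 → e (m * j + i) ≠ 0)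
    (hcap : ∀ r < n, ∑ j ∈ range n with eligibilityMask m e j = eligibilityMask m e r, p j ≤
      ∑ i ∈ range m, σ.arr units (m * eligibilityMask m e r + i) * σ.var unitSize)
    (hfilled : σ.arr filled = 0) :
    Triple B (distribute m) σ (n * (8 * m + 8) + 2)
      (Filled m p e (σ.arr units) (σ.var unitSize) n) := by
  refine .forLt (N := n) (k := 8 * m + 6) (Filled m p e (σ.arr units) (σ.var unitSize))
    (of_decide_eq_true rfl) (by simp [hσ.jobs]) hnB
    ⟨by simp, by simp, by simp, by simp [hfilled], by simp [hfilled]⟩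
    (fun r hr τ _ hf hjob hτ => ?_) fun _ _ _ _ h => h
  have hsize : σ.var unitSize = τ.var unitSize := (hf.var_eq unitSize).symm
  have hunits_eq : σ.arr units = τ.arr units := (hf.arr_eq units).symm
  rw [hsize, hunits_eq] at hτ hcap ⊢
  refine (assignJob_spec hm hjob (hsize ▸ hpq r hr) (hσ.of_frame hf)
    (by rw [hf.arr_eq mask, hmask r hr]) (hex r hr) (hunits_eq ▸ hunits r hr)
    (hτ.size_eq_zero hr (hcap r hr)) (fun i hi => ?_) hτ).mono le_rfl fun υ _ _ h =>
      ⟨h.1, h.2, h.3, h.4, h.5⟩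
  calc _ = typeLoad (eligibilityMask m e) r p (τ.arr output) (eligibilityMask m e r) i + p r := by
        rw [hτ.filled_eq _ i hi]
    _ ≤ ∑ j ∈ range r, p j + p r := by gcongr; exact sum_le_sum_of_subset (filter_subset _ _)
    _ = ∑ j ∈ range (r + 1), p j := (sum_range_succ p r).symm
    _ ≤ B := (sum_le_sum_of_subset (range_subset_range.2 hr)).trans hpB

end Filled

section Balance

variable {m n q : ℕ} {p e C N ρ : ℕ → ℕ} {E : ℕ → ℕ → ℕ} {σ : Store Var Arr}

/-- The imbalance of the schedule built from units of size `q`. -/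
def slack (m q : ℕ) : ℕ := (2 ^ m * (m + 2) + 1) * q

theorem Filled.loadOn_le (h : Filled m p e C q n σ) (hC : Spread m E N ρ C 0) (he : ∀ k, e k ≤ 1)
    {i : ℕ} (hi : i < m) : loadOn n p (σ.arr output) i ≤ ρ i * q + 2 ^ m * q := by
  have hcolumn : ∑ s ∈ range (2 ^ m), C (m * s + i) = ρ i := hC.column i hi
  rw [← sum_types_typeLoad (fun j _ => eligibilityMask_lt he j), ← hcolumn, sum_mul]
  calc _ ≤ ∑ s ∈ range (2 ^ m), (C (m * s + i) * q + q) :=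
        sum_le_sum fun s _ => (h.filled_eq s i hi).symm.trans_le (h.filled_le s i hi)
    _ = _ := by rw [sum_add_distrib, sum_const, card_range, smul_eq_mul]

theorem Filled.mul_le_typeLoad (h : Filled m p e C q n σ) (hC : Spread m E N ρ C 0) {s i : ℕ}
    (hs : s < 2 ^ m) (hN : N s * q ≤ ∑ j ∈ range n with eligibilityMask m e j = s, p j + q)
    (hi : i < m) :
    C (m * s + i) * q ≤
      typeLoad (eligibilityMask m e) n p (σ.arr output) s i + (m + 1) * q := by
  have hmem : i ∈ range m := mem_range.2 hi
  rw [← hC.row s hs, sum_mul, ← sum_machines_typeLoad h.output_lt, ← add_sum_erase _ _ hmem,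
    ← add_sum_erase _ _ hmem] at hN
  have hrest : ∑ i' ∈ (range m).erase i, typeLoad (eligibilityMask m e) n p (σ.arr output) s i' ≤
      ∑ i' ∈ (range m).erase i, (C (m * s + i') * q + q) := sum_le_sum fun i' hi' =>
    have hi' := mem_range.1 (mem_erase.1 hi').2
    (h.filled_eq s i' hi').symm.trans_le (h.filled_le s i' hi')
  rw [sum_add_distrib, sum_const, smul_eq_mul, card_erase_of_mem hmem, card_range] at hrest
  have := Nat.mul_le_mul_right q (Nat.sub_le m 1)
  rw [add_mul, one_mul]
  omega

theorem Filled.le_loadOn (h : Filled m p e C q n σ) (hC : Spread m E N ρ C 0) (he : ∀ k, e k ≤ 1)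
    (hN : ∀ s < 2 ^ m, N s * q ≤ ∑ j ∈ range n with eligibilityMask m e j = s, p j + q)
    {i : ℕ} (hi : i < m) : ρ i * q ≤ loadOn n p (σ.arr output) i + 2 ^ m * ((m + 1) * q) := by
  have hcolumn : ∑ s ∈ range (2 ^ m), C (m * s + i) = ρ i := hC.column i hi
  rw [← sum_types_typeLoad (fun j _ => eligibilityMask_lt he j), ← hcolumn, sum_mul]
  calc _ ≤ ∑ s ∈ range (2 ^ m), (typeLoad (eligibilityMask m e) n p (σ.arr output) s i +
          (m + 1) * q) := sum_le_sum fun s hs =>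
        h.mul_le_typeLoad hC (mem_range.1 hs) (hN s (mem_range.1 hs)) hi
    _ = _ := by rw [sum_add_distrib, sum_const, card_range, smul_eq_mul]

theorem Filled.loadOn_le_add_slack (h : Filled m p e C q n σ) (hC : Spread m E N ρ C 0)
    (he : ∀ k, e k ≤ 1)
    (hE : ∀ j < n, ∀ i < m, E (eligibilityMask m e j) i = e (m * j + i))
    (hN : ∀ s < 2 ^ m, N s * q ≤ ∑ j ∈ range n with eligibilityMask m e j = s, p j + q)
    {i j : ℕ} (hj : j < n) (hp : 0 < p j) (hi : i < m) (hei : e (m * j + i) ≠ 0) :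
    loadOn n p (σ.arr output) (σ.arr output j) ≤ loadOn n p (σ.arr output) i + slack m q := by
  have hy := h.output_lt j hj
  have hρ := Nat.mul_le_mul_right q (hC.le_add_one _ (eligibilityMask_lt he j) _ hy i hi
    (h.used j hj hp) (by rwa [hE j hj i hi]))
  have hupper := h.loadOn_le hC he hy
  have hlower := h.le_loadOn hC he hN hi
  have hslack : slack m q = 2 ^ m * ((m + 1) * q) + q + 2 ^ m * q := by unfold slack; ring
  rw [add_mul, one_mul] at hρ
  omega

end Balance

end Assignment

/-! ### Selecting the jobs to be rescheduled -/

namespace Assignment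

open RAM RAM.Cmd RAM.Expr Finset Var Arr

section Classes

variable {m j j' K n r κ : ℕ} {p e y key : ℕ → ℕ}

/-- The class of job `j`: its size, its eligible machines and its current machine, in one number. -/
def classKey (m : ℕ) (p e y : ℕ → ℕ) (j : ℕ) : ℕ := m * (2 ^ m * p j + eligibilityMask m e j) + y j

theorem classKey_eq_iff (he : ∀ k, e k ≤ 1) (hy : y j < m) (hy' : y j' < m) :
    classKey m p e y j = classKey m p e y j' ↔
      p j = p j' ∧ eligibilityMask m e j = eligibilityMask m e j' ∧ y j = y j' := by
  rw [classKey, classKey, mul_add_eq_mul_add_iff hy hy',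
    mul_add_eq_mul_add_iff (eligibilityMask_lt he j) (eligibilityMask_lt he j'), and_assoc]

theorem classKey_lt {q : ℕ} (he : ∀ k, e k ≤ 1) (hy : y j < m) (hp : p j < q) :
    classKey m p e y j < m * (2 ^ m * q) :=
  mul_add_lt_mul (mul_add_lt_mul hp (eligibilityMask_lt he j)) hy

/-- Job `j` is one of the first `K` jobs of its class. -/
def IsFree (K : ℕ) (key : ℕ → ℕ) (j : ℕ) : Prop := #{j' ∈ range j | key j' = key j} < K

instance (K : ℕ) (key : ℕ → ℕ) : DecidablePred (IsFree K key) := fun _ => Nat.decLt _ _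

theorem card_filter_range_succ (P : ℕ → Prop) [DecidablePred P] (r : ℕ) :
    #{j ∈ range (r + 1) | P j} = #{j ∈ range r | P j} + if P r then 1 else 0 := by
  simp only [card_filter, sum_range_succ]

theorem card_isFree_class (K : ℕ) (key : ℕ → ℕ) (κ r : ℕ) :
    #{j ∈ range r | IsFree K key j ∧ key j = κ} = min K #{j ∈ range r | key j = κ} := by
  induction r with
  | zero => simp
  | succ r ih =>
    rw [card_filter_range_succ, card_filter_range_succ, ih]
    by_cases hκ : key r = κ
    · simp only [hκ, and_true, if_true, IsFree]
      split_ifs <;> omega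
    · simp only [hκ, and_false, if_false, add_zero]

theorem card_isFree_le {L : ℕ} (hkey : ∀ j < n, key j < L) :
    #{j ∈ range n | IsFree K key j} ≤ K * L := by
  refine (card_le_mul_card_image_of_maps_to (t := range L) (f := key) (fun j hj => ?_) K
    fun κ _ => ?_).trans_eq (by rw [card_range])
  · rw [mem_filter, mem_range] at hj
    exact mem_range.2 (hkey j hj.1)
  · rw [filter_filter, card_isFree_class]
    exact min_le_left _ _

theorem sum_filter_le_mul {q : ℕ} (P : ℕ → Prop) [DecidablePred P] (hr : r ≤ n)
    (hp : ∀ j < n, p j ≤ q) : ∑ j ∈ range r with P j, p j ≤ n * q := by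
  refine (sum_le_card_nsmul _ _ q fun j hj => ?_).trans (Nat.mul_le_mul_right q ?_)
  · exact hp j ((mem_range.1 (mem_filter.1 hj).1).trans_le hr)
  · exact (card_filter_le _ _).trans ((card_range r).trans_le hr)

end Classes

/-- The class of the current job. -/
def classIndex (m : ℕ) : Expr Var Arr :=
  m * ((2 ^ m : ℕ) * size job + mask job) + output job

/-- Release the current job if its class has fewer than `quota` free jobs, and otherwise leave it
on its machine. -/
def selectJob (m : ℕ) : Cmd Var Arr :=
  .ite (quota - classCount (classIndex m))
    (store classCount (classIndex m) (classCount (classIndex m) + 1) ;;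
      store freeJob freeCount job ;; freeCount ::= freeCount + 1 ;;
      freeTotal ::= freeTotal + size job)
    (store fixedLoad (output job) (fixedLoad (output job) + size job))

/-- Set `quota` to `a * unitSize ^ (m + 1)`. -/
def computeQuota (m a : ℕ) : Cmd Var Arr :=
  quota ::= a ;; forLt machine (m + 1 : ℕ) (quota ::= quota * unitSize)

/-- Release up to `a * unitSize ^ (m + 1)` jobs of each class. -/
def select (m a : ℕ) : Cmd Var Arr := computeQuota m a ;; forLt job jobs (selectJob m)

/-- The selection has treated the first `r` jobs, which stood on the machines `y`. -/
structure Selected (K : ℕ) (p y key : ℕ → ℕ) (r : ℕ) (σ : Store Var Arr) : Prop where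
  classCount_eq : ∀ κ, σ.arr classCount κ = min K #{j ∈ range r | key j = κ}
  image_freeJob : (range (σ.var freeCount)).image (σ.arr freeJob) = {j ∈ range r | IsFree K key j}
  injOn_freeJob : Set.InjOn (σ.arr freeJob) (range (σ.var freeCount))
  freeTotal_eq : σ.var freeTotal = ∑ j ∈ range r with IsFree K key j, p j
  fixedLoad_eq : ∀ i, σ.arr fixedLoad i = ∑ j ∈ range r with ¬ IsFree K key j ∧ y j = i, p j

section Selected

variable {B K m n q r : ℕ} {p e y key : ℕ → ℕ} {σ τ : Store Var Arr}

theorem Selected.freeCount_eq (h : Selected K p y key r σ) :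
    σ.var freeCount = #{j ∈ range r | IsFree K key j} := by
  rw [← h.image_freeJob, card_image_of_injOn h.injOn_freeJob, card_range]

theorem Selected.freeCount_le (h : Selected K p y key r σ) : σ.var freeCount ≤ r :=
  h.freeCount_eq.trans_le ((card_filter_le _ _).trans_eq (card_range r))

theorem Selected.sum_freeJob (h : Selected K p y key r σ) (f : ℕ → ℕ) :
    ∑ k ∈ range (σ.var freeCount), f (σ.arr freeJob k) =
      ∑ j ∈ range r with IsFree K key j, f j := by
  rw [← h.image_freeJob, sum_image h.injOn_freeJob]

theorem Selected.freeJob_lt (h : Selected K p y key r σ) {k : ℕ} (hk : k < σ.var freeCount) :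
    σ.arr freeJob k < r := by
  have hmem := mem_image_of_mem (σ.arr freeJob) (mem_range.2 hk)
  rw [h.image_freeJob] at hmem
  exact mem_range.1 (mem_filter.1 hmem).1

theorem Selected.classCount_lt_iff (h : Selected K p y key r σ) :
    σ.arr classCount (key r) < K ↔ IsFree K key r := by
  rw [h.classCount_eq, IsFree]
  omega

theorem Selected.succ_of_isFree (h : Selected K p y key r σ) (hr : IsFree K key r)
    (hclass : τ.arr classCount =
      Function.update (σ.arr classCount) (key r) (σ.arr classCount (key r) + 1))
    (hjob : τ.arr freeJob = Function.update (σ.arr freeJob) (σ.var freeCount) r)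
    (hcount : τ.var freeCount = σ.var freeCount + 1)
    (htotal : τ.var freeTotal = σ.var freeTotal + p r)
    (hfixed : τ.arr fixedLoad = σ.arr fixedLoad) : Selected K p y key (r + 1) τ where
  classCount_eq κ := by
    have hκ := h.classCount_eq κ
    rw [hclass, card_filter_range_succ, Function.update_apply]
    obtain rfl | hne := eq_or_ne κ (key r)
    · rw [if_pos rfl, if_pos rfl]
      have : #{j ∈ range r | key j = key r} < K := hr
      omega
    · rw [if_neg hne, if_neg hne.symm, add_zero, hκ]
  image_freeJob := by
    rw [hcount, hjob, range_add_one, image_insert, Function.update_self, range_add_one,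
      filter_insert, if_pos hr, ← h.image_freeJob]
    refine congrArg (insert r) (image_congr fun k hk => ?_)
    exact Function.update_of_ne (mem_range.1 hk).ne _ _
  injOn_freeJob := by
    intro k hk k' hk' heq
    rw [hcount, coe_range, Set.mem_Iio] at hk hk'
    rw [hjob, Function.update_apply, Function.update_apply] at heq
    split_ifs at heq with hlast hlast' hlast'
    · omega
    · have := h.freeJob_lt (k := k') (by omega)
      omega
    · have := h.freeJob_lt (k := k) (by omega)
      omega
    · exact h.injOn_freeJob (by simp; omega) (by simp; omega) heq
  freeTotal_eq := by
    rw [htotal, range_add_one, filter_insert, if_pos hr, sum_insert (by simp), h.freeTotal_eq,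
      add_comm]
  fixedLoad_eq i := by
    rw [hfixed, range_add_one, filter_insert, if_neg fun h => h.1 hr, h.fixedLoad_eq]

theorem Selected.succ_of_not_isFree (h : Selected K p y key r σ) (hr : ¬ IsFree K key r)
    (hclass : τ.arr classCount = σ.arr classCount) (hjob : τ.arr freeJob = σ.arr freeJob)
    (hcount : τ.var freeCount = σ.var freeCount) (htotal : τ.var freeTotal = σ.var freeTotal)
    (hfixed : τ.arr fixedLoad =
      Function.update (σ.arr fixedLoad) (y r) (σ.arr fixedLoad (y r) + p r)) :
    Selected K p y key (r + 1) τ where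
  classCount_eq κ := by
    have hκ := h.classCount_eq κ
    rw [hclass, card_filter_range_succ, hκ]
    split_ifs with hκr
    · subst hκr
      rw [IsFree] at hr
      omega
    · rw [add_zero]
  image_freeJob := by
    rw [hcount, hjob, range_add_one, filter_insert, if_neg hr, h.image_freeJob]
  injOn_freeJob := by
    rw [hcount, hjob]
    exact h.injOn_freeJob
  freeTotal_eq := by rw [htotal, range_add_one, filter_insert, if_neg hr, h.freeTotal_eq]
  fixedLoad_eq i := by
    rw [hfixed, range_add_one, filter_insert, Function.update_apply]
    obtain rfl | hne := eq_or_ne i (y r)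
    · rw [if_pos rfl, if_pos ⟨hr, rfl⟩, sum_insert (by simp), h.fixedLoad_eq, add_comm]
    · rw [if_neg hne, if_neg fun h => hne h.2.symm, h.fixedLoad_eq]

theorem selectJob_spec (hnB : n + n * q ≤ B) (hKB : K ≤ B) (hpq : ∀ j < n, p j ≤ q) (hr : r < n)
    (hσ : HasInput n p e σ) (hjob : σ.var job = r) (hquota : σ.var quota = K)
    (hmask : σ.arr mask r = eligibilityMask m e r) (houtput : σ.arr output r = y r)
    (h : Selected K p y (classKey m p e y) r σ) :
    Triple B (selectJob m) σ 5 (Selected K p y (classKey m p e y) (r + 1)) := by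
  have hindex : (classIndex m).eval σ = classKey m p e y r := by
    simp [classIndex, classKey, hjob, hσ.size, hmask, houtput]
  have hcount := h.freeCount_le
  have hsize {P : ℕ → Prop} [DecidablePred P] := sum_filter_le_mul (r := r + 1) P hr hpq
  refine .ite (fun hroom => ?_) fun hfull => (Triple.store ?_ ?_).mono (by omega) fun _ _ _ h => h
  · simp only [eval_sub, eval_var, eval_cell, hindex, hquota] at hroom
    have hfree := h.classCount_lt_iff.1 (Nat.lt_of_sub_ne_zero hroom)
    refine (Triple.store_seq ?_ (.store_seq ?_ (.assign_seq ?_ (.assign ?_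
      (h.succ_of_isFree hfree ?_ ?_ ?_ ?_ ?_))))).mono (k := 1 + (1 + (1 + 1))) le_rfl
        fun _ _ _ h => h
    · simp [hindex]
      omega
    · simp [hjob]
      omega
    · simp
      omega
    · have htotal := hsize (P := IsFree K (classKey m p e y))
      rw [range_add_one, filter_insert, if_pos hfree, sum_insert (by simp)] at htotal
      simp [hjob, hσ.size, h.freeTotal_eq]
      omega
    all_goals simp [hindex, hjob, hσ.size]
  · simp only [eval_sub, eval_var, eval_cell, hindex, hquota] at hfull
    have hfixed := hsize (P := fun j => ¬ IsFree K (classKey m p e y) j ∧ y j = y r)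
    have hfree : ¬ IsFree K (classKey m p e y) r := fun hr =>
      hfull.not_gt (Nat.sub_pos_of_lt (h.classCount_lt_iff.2 hr))
    rw [range_add_one, filter_insert, if_pos ⟨hfree, rfl⟩, sum_insert (by simp)] at hfixed
    simp [hjob, houtput, hσ.size, h.fixedLoad_eq]
    omega
  · simp only [eval_sub, eval_var, eval_cell, hindex, hquota] at hfull
    refine h.succ_of_not_isFree (fun hr =>
      hfull.not_gt (Nat.sub_pos_of_lt (h.classCount_lt_iff.2 hr))) ?_ ?_ ?_ ?_ ?_
    all_goals simp [hjob, houtput, hσ.size]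

theorem computeQuota_spec {a : ℕ} (hmB : m + 1 ≤ B) (hq : 1 ≤ σ.var unitSize)
    (hK : a * σ.var unitSize ^ (m + 1) ≤ B) :
    Triple B (computeQuota m a) σ (3 * m + 6) fun τ =>
      τ.var quota = a * σ.var unitSize ^ (m + 1) := by
  have hpow {r} (hr : r ≤ m + 1) : a * σ.var unitSize ^ r ≤ B :=
    (Nat.mul_le_mul_left a (Nat.pow_le_pow_right hq hr)).trans hK
  refine (Triple.assign_seq (by simpa using hpow (Nat.zero_le _)) (.forLt (N := m + 1) (k := 1)
    (fun r τ => τ.var quota = a * σ.var unitSize ^ r) (of_decide_eq_true rfl)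
    (by simp) hmB (by simp) (fun r hr τ _ hf _ hτ => ?_) fun _ _ _ _ h => h)).mono (by omega)
      fun _ _ _ h => h
  have hsize : τ.var unitSize = σ.var unitSize := by simpa using hf.var_eq unitSize
  have heval : (quota * unitSize : Expr Var Arr).eval τ = a * σ.var unitSize ^ (r + 1) := by
    simp [hτ, hsize, pow_succ, mul_assoc]
  exact .assign (heval.trans_le (hpow hr)) (by simp [heval])

theorem select_spec {a : ℕ} (hmB : m + 1 ≤ B) (hnB : n + n * σ.var unitSize ≤ B)
    (hKB : a * σ.var unitSize ^ (m + 1) ≤ B) (hq : 1 ≤ σ.var unitSize)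
    (hpq : ∀ j < n, p j ≤ σ.var unitSize) (hσ : HasInput n p e σ)
    (hmask : ∀ j < n, σ.arr mask j = eligibilityMask m e j)
    (hcount : σ.var freeCount = 0) (htotal : σ.var freeTotal = 0)
    (hclass : σ.arr classCount = 0) (hfixed : σ.arr fixedLoad = 0) :
    Triple B (select m a) σ (7 * n + 3 * m + 8)
      (Selected (a * σ.var unitSize ^ (m + 1)) p (σ.arr output)
        (classKey m p e (σ.arr output)) n) := by
  set K := a * σ.var unitSize ^ (m + 1)
  refine (Triple.seq ((computeQuota_spec hmB hq hKB).mono le_rfl fun τ _ hf hτ => ?_)).mono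
    (k := 3 * m + 6 + (n * (5 + 2) + 2)) (by omega) fun _ _ _ h => h
  have hin := hσ.of_frame hf
  refine .forLt (Selected K p (σ.arr output) (classKey m p e (σ.arr output)))
    (of_decide_eq_true rfl) (by simp [hin.jobs]) (by omega) ?_ (fun r hr υ _ hf' hjob hυ => ?_)
      fun _ _ _ _ h => h
  · constructor <;> simp [hf.var_eq freeCount, hf.var_eq freeTotal, hf.arr_eq classCount,
      hf.arr_eq fixedLoad, hcount, htotal, hclass, hfixed]
  · refine (selectJob_spec hnB hKB hpq hr (hin.of_frame hf') hjob ((hf'.var_eq quota).trans hτ)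
      ?_ ?_ hυ).mono le_rfl fun _ _ _ h => ⟨h.1, h.2, h.3, h.4, h.5⟩
    · rw [hf'.arr_eq mask, hf.arr_eq mask, hmask r hr]
    · rw [hf'.arr_eq output, hf.arr_eq output]

end Selected

end Assignment

/-! ### Load vectors and their codes -/

namespace Assignment

open Finset

section LoadCode

variable {m b n N k i : ℕ} {a x x' : ℕ → ℕ}

/-- The schedule `y` sends each of the `n` jobs to a machine that may process it. -/
def Feasible (m : ℕ) (ok : ℕ → ℕ → Prop) (n : ℕ) (y : ℕ → ℕ) : Prop :=
  ∀ j < n, y j < m ∧ ok j (y j)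

/-- The largest load when the jobs are scheduled on top of the loads `F`. -/
def peak (m n : ℕ) (p F y : ℕ → ℕ) : ℕ := (range m).sup fun i => loadOn n p y i + F i

/-- The schedule `y` has the smallest peak among the feasible ones. -/
def IsBest (m : ℕ) (ok : ℕ → ℕ → Prop) (n : ℕ) (p F y : ℕ → ℕ) : Prop :=
  Feasible m ok n y ∧ ∀ z, Feasible m ok n z → peak m n p F y ≤ peak m n p F z

/-- The weight of machine `i` in the code of a load vector. It vanishes for the last machine,
whose load is the total minus the other loads. -/
def machineWeight (m b i : ℕ) : ℕ := if i < m - 1 then b ^ i else 0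

/-- The load vector of the first `k` items, of sizes `a`, under the assignment `x`, encoded as a
number with `m - 1` digits in base `b`. -/
def loadCode (m b : ℕ) (a x : ℕ → ℕ) (k : ℕ) : ℕ :=
  ∑ k' ∈ range k, a k' * machineWeight m b (x k')

theorem loadOn_le_sum (hk : k ≤ N) (a x : ℕ → ℕ) (i : ℕ) :
    loadOn k a x i ≤ ∑ k ∈ range N, a k :=
  sum_le_sum_of_subset ((filter_subset _ _).trans (range_subset_range.2 hk))

theorem sum_loadOn (a : ℕ → ℕ) (hx : ∀ k < N, x k < m) :
    ∑ i ∈ range m, loadOn N a x i = ∑ k ∈ range N, a k :=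
  sum_fiberwise_of_maps_to (fun k hk => mem_range.2 (hx k (mem_range.1 hk))) a

theorem loadOn_last (hm : 1 ≤ m) (a : ℕ → ℕ) (hx : ∀ k < N, x k < m) :
    loadOn N a x (m - 1) = ∑ k ∈ range N, a k - ∑ i ∈ range (m - 1), loadOn N a x i := by
  have hsum := sum_loadOn a hx
  rw [← Nat.sub_add_cancel hm, sum_range_succ] at hsum
  exact Nat.eq_sub_of_add_eq' hsum

theorem loadCode_eq_sum (m b : ℕ) (a x : ℕ → ℕ) (k : ℕ) :
    loadCode m b a x k = ∑ i ∈ range (m - 1), loadOn k a x i * b ^ i := by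
  simp only [loadCode, loadOn, sum_filter, sum_mul]
  rw [sum_comm]
  simp [machineWeight, ite_mul]

theorem loadCode_lt (hb : ∑ k ∈ range N, a k < b) (hk : k ≤ N) (x : ℕ → ℕ) :
    loadCode m b a x k < b ^ (m - 1) := by
  rw [loadCode_eq_sum]
  exact sum_mul_pow_lt fun i _ => (loadOn_le_sum hk a x i).trans_lt hb

theorem loadCode_div_mod (hb : ∑ k ∈ range N, a k < b) (hi : i < m - 1) :
    loadCode m b a x N / b ^ i % b = loadOn N a x i := by
  rw [loadCode_eq_sum]
  exact sum_mul_pow_div_pow_mod (fun i _ => (loadOn_le_sum le_rfl a x i).trans_lt hb) hi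

theorem peak_eq_of_loadCode_eq (hb : ∑ k ∈ range N, a k < b) (hx : ∀ k < N, x k < m)
    (hx' : ∀ k < N, x' k < m) (h : loadCode m b a x N = loadCode m b a x' N) (F : ℕ → ℕ) :
    peak m N a F x = peak m N a F x' := by
  have hinit : ∀ i < m - 1, loadOn N a x i = loadOn N a x' i := fun i hi => by
    rw [← loadCode_div_mod hb hi, h, loadCode_div_mod hb hi]
  refine sup_congr rfl fun i hi => congrArg (· + F i) ?_
  rcases (Nat.le_sub_one_of_lt (mem_range.1 hi)).lt_or_eq with hlt | rfl
  · exact hinit i hlt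
  · have hm := Nat.one_le_of_lt (mem_range.1 hi)
    rw [loadOn_last hm a hx, loadOn_last hm a hx',
      sum_congr rfl fun i hi => hinit i (mem_range.1 hi)]

/-- `c` is the code of a load vector of the first `k` items. -/
def Reach (m b : ℕ) (a : ℕ → ℕ) (ok : ℕ → ℕ → Prop) (k c : ℕ) : Prop :=
  ∃ x, Feasible m ok k x ∧ loadCode m b a x k = c

end LoadCode

section Table

variable {m b k c i N : ℕ} {a : ℕ → ℕ} {ok : ℕ → ℕ → Prop}

theorem Reach.zero_iff : Reach m b a ok 0 c ↔ c = 0 :=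
  ⟨fun ⟨_, _, h⟩ => h.symm,
    fun h => ⟨fun _ => 0, fun _ hj => absurd hj (Nat.not_lt_zero _), h.symm⟩⟩

theorem Reach.succ (h : Reach m b a ok k c) (hi : i < m) (hok : ok k i) :
    Reach m b a ok (k + 1) (c + a k * machineWeight m b i) := by
  obtain ⟨x, hx, rfl⟩ := h
  refine ⟨Function.update x k i, fun k' hk' => ?_, ?_⟩
  · rcases (Nat.lt_succ_iff.1 hk').lt_or_eq with hlt | rfl
    · rw [Function.update_of_ne hlt.ne]
      exact hx k' hlt
    · rw [Function.update_self]
      exact ⟨hi, hok⟩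
  · rw [loadCode, sum_range_succ, Function.update_self]
    refine congrArg (· + _) (sum_congr rfl fun k' hk' => ?_)
    rw [Function.update_of_ne (mem_range.1 hk').ne]

theorem Reach.exists_of_succ (h : Reach m b a ok (k + 1) c) :
    ∃ c' i, i < m ∧ ok k i ∧ Reach m b a ok k c' ∧ c = c' + a k * machineWeight m b i := by
  obtain ⟨x, hx, rfl⟩ := h
  exact ⟨_, x k, (hx k k.lt_succ_self).1, (hx k k.lt_succ_self).2,
    ⟨x, fun k' hk' => hx k' (hk'.trans k.lt_succ_self), rfl⟩, sum_range_succ _ _⟩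

theorem Reach.lt (h : Reach m b a ok k c) (hb : ∑ k ∈ range N, a k < b) (hk : k ≤ N) :
    c < b ^ (m - 1) := by
  obtain ⟨x, -, rfl⟩ := h
  exact loadCode_lt hb hk x

/-- The table of the dynamic program, in layers of length `b ^ (m - 1)`. Entry `c` of layer
`k + 1` is `0`, or `i + 1` where machine `i` can be the machine of item `k` in a load vector with
code `c`. The triples of an item, a code and a machine in `treated` have been processed. -/
structure Table (m b : ℕ) (a : ℕ → ℕ) (ok : ℕ → ℕ → Prop) (treated : ℕ → ℕ → ℕ → Prop)
    (R : ℕ → ℕ) : Prop where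
  zero : ∀ c < b ^ (m - 1), R c ≠ 0 ↔ c = 0
  sound : ∀ k, ∀ c < b ^ (m - 1), R (b ^ (m - 1) * (k + 1) + c) ≠ 0 → ∃ c' i, i < m ∧ ok k i ∧
    Reach m b a ok k c' ∧ c = c' + a k * machineWeight m b i ∧
    R (b ^ (m - 1) * (k + 1) + c) = i + 1
  complete : ∀ k c i, treated k c i → Reach m b a ok k c → i < m → ok k i →
    R (b ^ (m - 1) * (k + 1) + (c + a k * machineWeight m b i)) ≠ 0

variable {P P' : ℕ → ℕ → ℕ → Prop} {R : ℕ → ℕ}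

theorem Table.mono (h : Table m b a ok P R)
    (hP : ∀ k c i, P' k c i → Reach m b a ok k c → i < m → ok k i → P k c i) :
    Table m b a ok P' R :=
  ⟨h.zero, h.sound, fun k c i hc hr hi hok => h.complete k c i (hP k c i hc hr hi hok) hr hi hok⟩

theorem Table.start (hb : 0 < b) :
    Table m b a ok (fun _ _ _ => False) (Function.update 0 0 1) where
  zero c _ := by by_cases h : c = 0 <;> simp [h]
  sound k c _ h := by
    have := Nat.pow_pos (n := m - 1) hb
    rw [Function.update_of_ne (by positivity)] at h
    exact absurd rfl h
  complete _ _ _ h := h.elim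

theorem Table.insert (h : Table m b a ok P R) (hr : Reach m b a ok k c) (hi : i < m)
    (hok : ok k i) (hlt : c + a k * machineWeight m b i < b ^ (m - 1)) :
    Table m b a ok (fun k' c' i' => P k' c' i' ∨ k' = k ∧ c' = c ∧ i' = i)
      (Function.update R (b ^ (m - 1) * (k + 1) + (c + a k * machineWeight m b i)) (i + 1)) where
  zero c' hc' := by
    rw [Function.update_of_ne (by grind)]
    exact h.zero c' hc'
  sound k' c' hc' h0 := by
    by_cases heq : b ^ (m - 1) * (k' + 1) + c' =
        b ^ (m - 1) * (k + 1) + (c + a k * machineWeight m b i)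
    · obtain ⟨hk, rfl⟩ := (mul_add_eq_mul_add_iff hc' hlt).1 heq
      obtain rfl := Nat.succ_injective hk
      exact ⟨c, i, hi, hok, hr, rfl, by rw [Function.update_self]⟩
    · rw [Function.update_of_ne heq] at h0 ⊢
      exact h.sound k' c' hc' h0
  complete k' c' i' hP hr' hi' hok' := by
    rw [Function.update_apply]
    split_ifs with heq
    · exact i.succ_ne_zero
    · refine h.complete k' c' i' (hP.resolve_right ?_) hr' hi' hok'
      rintro ⟨rfl, rfl, rfl⟩
      exact heq rfl

theorem Table.ne_zero_iff (h : Table m b a ok P R) (hP : ∀ k' < k, ∀ c i, P k' c i)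
    (hc : c < b ^ (m - 1)) : R (b ^ (m - 1) * k + c) ≠ 0 ↔ Reach m b a ok k c := by
  cases k with
  | zero => rw [mul_zero, zero_add, Reach.zero_iff, h.zero c hc]
  | succ k =>
    constructor
    · intro h0
      obtain ⟨c', i, hi, hok, hr, rfl, -⟩ := h.sound k c hc h0
      exact hr.succ hi hok
    · intro hr
      obtain ⟨c', i, hi, hok, hr', rfl⟩ := hr.exists_of_succ
      exact h.complete k c' i (hP k k.lt_succ_self c' i) hr' hi hok

end Table

end Assignment

/-! ### The dynamic program over load vectors -/

namespace Assignment

open RAM RAM.Cmd RAM.Expr Finset Var Arr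

section FillTable

/-- The store holds `N` items of sizes `a`; item `k` is job `f k`, and may go to machine `i` if
`ok k i` holds. -/
structure HasItems (m : ℕ) (a : ℕ → ℕ) (ok : ℕ → ℕ → Prop) (N : ℕ) (f : ℕ → ℕ)
    (σ : Store Var Arr) : Prop where
  freeCount : σ.var freeCount = N
  freeTotal : σ.var freeTotal = ∑ k ∈ range N, a k
  freeJob : σ.arr freeJob = f
  size (k : ℕ) : σ.arr size (f k) = a k
  eligible (k i : ℕ) : σ.arr eligible (m * f k + i) ≠ 0 ↔ ok k i

/-- The store holds the items and the weights of the machines in codes with digits below `b`. -/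
structure HasCodes (m b : ℕ) (a : ℕ → ℕ) (ok : ℕ → ℕ → Prop) (N : ℕ) (f : ℕ → ℕ)
    (σ : Store Var Arr) : Prop extends HasItems m a ok N f σ where
  total_lt : ∑ k ∈ range N, a k < b
  base : σ.var base = b
  codes : σ.var codes = b ^ (m - 1)
  weight : σ.arr weight = machineWeight m b

variable {B m b N k c i : ℕ} {a f : ℕ → ℕ} {ok : ℕ → ℕ → Prop} {σ τ : Store Var Arr}
  {P : ℕ → ℕ → ℕ → Prop}

theorem HasItems.of_frame {d : Cmd Var Arr} (h : HasItems m a ok N f σ) (hf : Frame d σ τ)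
    (hvars : ∀ x ∈ [Var.freeCount, Var.freeTotal], x ∉ d.vars := by exact of_decide_eq_true rfl)
    (harrs : ∀ T ∈ [Arr.freeJob, Arr.size, Arr.eligible], T ∉ d.arrays := by
      exact of_decide_eq_true rfl) :
    HasItems m a ok N f τ where
  freeCount := by rw [hf.var _ (hvars _ (by simp)), h.freeCount]
  freeTotal := by rw [hf.var _ (hvars _ (by simp)), h.freeTotal]
  freeJob := by rw [hf.arr _ (harrs _ (by simp)), h.freeJob]
  size k := by rw [hf.arr _ (harrs _ (by simp)), h.size]
  eligible k i := by rw [hf.arr _ (harrs _ (by simp)), h.eligible]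

theorem HasCodes.of_frame {d : Cmd Var Arr} (h : HasCodes m b a ok N f σ) (hf : Frame d σ τ)
    (hvars : ∀ x ∈ [Var.freeCount, Var.freeTotal, Var.base, Var.codes], x ∉ d.vars := by
      exact of_decide_eq_true rfl)
    (harrs : ∀ T ∈ [Arr.freeJob, Arr.size, Arr.eligible, Arr.weight], T ∉ d.arrays := by
      exact of_decide_eq_true rfl) :
    HasCodes m b a ok N f τ where
  toHasItems := h.toHasItems.of_frame hf (fun x hx => hvars x (by grind))
    fun T hT => harrs T (by grind)
  total_lt := h.total_lt
  base := by rw [hf.var _ (hvars _ (by simp)), h.base]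
  codes := by rw [hf.var _ (hvars _ (by simp)), h.codes]
  weight := by rw [hf.arr _ (harrs _ (by simp)), h.weight]

/-- Compute the weights of the machines in the codes of load vectors. -/
def computeWeights (m : ℕ) : Cmd Var Arr :=
  base ::= freeTotal + 1 ;; codes ::= 1 ;;
  forLt machine (m - 1 : ℕ) (store weight machine codes ;; codes ::= codes * base)

theorem computeWeights_spec (hmB : m ≤ B) (hbB : ∑ k ∈ range N, a k + 1 ≤ B)
    (hVB : (∑ k ∈ range N, a k + 1) ^ (m - 1) ≤ B) (h : HasItems m a ok N f σ)
    (hweight : σ.arr weight = 0) :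
    Triple B (computeWeights m) σ (4 * m + 4)
      (HasCodes m (∑ k ∈ range N, a k + 1) a ok N f) := by
  set b := ∑ k ∈ range N, a k + 1 with hb
  have hbase : (freeTotal + 1 : Expr Var Arr).eval σ = b := by simp [h.freeTotal, hb]
  suffices hspec : Triple B (computeWeights m) σ (4 * m + 4) fun τ => τ.var base = b ∧
      τ.var codes = b ^ (m - 1) ∧ τ.arr weight = machineWeight m b from
    hspec.mono le_rfl fun τ _ hf hτ =>
      ⟨h.of_frame hf, hb ▸ Nat.lt_succ_self _, hτ.1, hτ.2.1, hτ.2.2⟩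
  refine (Triple.assign_seq (hbase.trans_le hbB) (.assign_seq (by simp; omega)
    (.forLt (N := m - 1) (k := 1 + 1) (fun r τ => τ.var codes = b ^ r ∧
      τ.arr weight = fun i => if i < r then b ^ i else 0) (of_decide_eq_true rfl) (by simp)
      (by omega) (by simp [hweight]; rfl) (fun r hr τ hτ hf hmachine ⟨hcodes, hw⟩ => ?_)
      fun τ _ hf _ ⟨hcodes, hw⟩ => ⟨?_, hcodes, hw⟩))).mono (by omega) fun _ _ _ h => h
  · have hbτ : τ.var base = b := by simpa [hbase] using hf.var_eq base
    refine .store_seq (hτ.var codes) (.assign ?_ ⟨?_, ?_⟩)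
    · simpa [hcodes, hbτ, ← pow_succ] using (Nat.pow_le_pow_right (by omega) (by omega)).trans hVB
    · simp [hcodes, hbτ, pow_succ]
    · funext i
      simp only [Store.arr_setVar, Store.arr_setArr, if_true, eval_var, hw, hmachine, hcodes,
        Function.update_apply]
      grind
  · simpa [hbase] using hf.var_eq base

/-- Record that the current item may be put on the current machine on top of a load vector with
the current code. -/
def fillEntry (m : ℕ) : Cmd Var Arr :=
  .ite (eligible (m * freeJob item + machine))
    (store table (codes * (item + 1) + (code + size (freeJob item) * weight machine)) (machine + 1))
    .skip

/-- Process the current item and the current code. -/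
def fillRow (m : ℕ) : Cmd Var Arr :=
  .ite (table (codes * item + code)) (forLt machine m (fillEntry m)) .skip

/-- Fill the table layer by layer. -/
def fillTable (m : ℕ) : Cmd Var Arr :=
  store table 0 1 ;; forLt item freeCount (forLt code codes (fillRow m))

theorem fillEntry_spec (hmB : m ≤ B) (h : HasCodes m b a ok N f σ) (hk : k < N) (hi : i < m)
    (hitem : σ.var item = k) (hcode : σ.var code = c) (hmachine : σ.var machine = i)
    (hr : Reach m b a ok k c) (hT : Table m b a ok P (σ.arr table)) :
    Triple B (fillEntry m) σ 2 fun τ =>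
      Table m b a ok (fun k' c' i' => P k' c' i' ∨ k' = k ∧ c' = c ∧ i' = i) (τ.arr table) := by
  have heval : (eligible (m * freeJob item + machine) : Expr Var Arr).eval σ ≠ 0 ↔ ok k i := by
    simpa [h.freeJob, hitem, hmachine] using h.eligible k i
  refine .ite (fun hne => .store (by simp [hmachine]; omega) ?_) fun hzero => .skip ?_
  · have hok := heval.1 hne
    simpa [hitem, hcode, hmachine, h.codes, h.freeJob, h.size, h.weight] using
      hT.insert hr hi hok ((hr.succ hi hok).lt h.total_lt hk)
  · refine hT.mono fun k' c' i' hP _ _ hok => hP.resolve_right ?_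
    rintro ⟨rfl, rfl, rfl⟩
    exact heval.2 hok hzero

theorem fillRow_spec (hmB : m ≤ B) (h : HasCodes m b a ok N f σ) (hk : k < N)
    (hc : c < b ^ (m - 1)) (hitem : σ.var item = k) (hcode : σ.var code = c)
    (hT : Table m b a ok (fun k' c' _ => k' < k ∨ k' = k ∧ c' < c) (σ.arr table)) :
    Triple B (fillRow m) σ (4 * m + 3) fun τ =>
      Table m b a ok (fun k' c' _ => k' < k ∨ k' = k ∧ c' < c + 1) (τ.arr table) := by
  have hreach : (table (codes * item + code) : Expr Var Arr).eval σ ≠ 0 ↔ Reach m b a ok k c := by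
    simpa [h.codes, hitem, hcode] using hT.ne_zero_iff (fun k' hk' _ _ => .inl hk') hc
  refine (Triple.ite (k := m * (2 + 2) + 2) (fun hne => .forLt
    (fun i τ => Table m b a ok (fun k' c' i' => k' < k ∨ k' = k ∧ (c' < c ∨ c' = c ∧ i' < i))
      (τ.arr table)) (of_decide_eq_true rfl) rfl hmB ?_ (fun i hi τ _ hf hmachine hτ => ?_)
    fun τ _ _ _ hτ => ?_) fun hzero => (Triple.skip ?_).mono (by omega) fun _ _ _ h => h).mono
    (by omega) fun _ _ _ h => h
  · exact hT.mono fun k' c' i' hP _ _ _ => by omega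
  · refine (fillEntry_spec hmB (h.of_frame hf) hk hi ((hf.var_eq item).trans hitem)
      ((hf.var_eq code).trans hcode) hmachine (hreach.1 hne) hτ).mono le_rfl fun υ _ _ hυ => ?_
    exact hυ.mono fun k' c' i' hP _ _ _ => by omega
  · exact hτ.mono fun k' c' i' hP _ hi' _ => by omega
  · refine hT.mono fun k' c' i' hP hr _ _ => ?_
    have hne : ¬ (k' = k ∧ c' = c) := by
      rintro ⟨rfl, rfl⟩
      exact hreach.2 hr hzero
    omega

theorem fillTable_spec (hmB : m ≤ B) (hB : 1 ≤ B) (h : HasCodes m b a ok N f σ)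
    (htable : σ.arr table = 0) :
    Triple B (fillTable m) σ (N * (b ^ (m - 1) * (4 * m + 5) + 4) + 3) fun τ =>
      Table m b a ok (fun k _ _ => k < N) (τ.arr table) := by
  refine Triple.of_bdd fun hσ => ?_
  have hNB : N ≤ B := h.freeCount ▸ hσ.var freeCount
  have hVB : b ^ (m - 1) ≤ B := h.codes ▸ hσ.var codes
  refine (Triple.seq ((Triple.store (Q := fun υ => υ.arr table = Function.update (0 : ℕ → ℕ) 0 1) hB
    (by simp [htable])).mono le_rfl fun υ _ hfυ hυ => .forLt (N := N)
    (k := b ^ (m - 1) * (4 * m + 3 + 2) + 2)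
    (fun k τ => Table m b a ok (fun k' _ _ => k' < k) (τ.arr table)) (of_decide_eq_true rfl)
    (by simp [(h.of_frame hfυ).freeCount]) hNB ?_ (fun k hk τ _ hf hitem hτ => ?_)
    fun _ _ _ _ h => h)).mono (by ring_nf; rfl) fun _ _ _ h => h
  · simpa [hυ] using Table.start (Nat.zero_lt_of_lt h.total_lt)
  have hτcodes := (h.of_frame hfυ).of_frame hf
  refine .forLt (fun c τ => Table m b a ok (fun k' c' _ => k' < k ∨ k' = k ∧ c' < c)
    (τ.arr table)) (of_decide_eq_true rfl) (by simp [hτcodes.codes]) hVB ?_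
    (fun c hc υ _ hf' hcode hυ => ?_) fun υ _ _ _ hυ => ?_
  · exact hτ.mono fun k' c' i' hP _ _ _ => by omega
  · exact fillRow_spec hmB (hτcodes.of_frame hf') hk hc ((hf'.var_eq item).trans hitem) hcode hυ
  · refine hυ.mono fun k' c' i' hP hr _ _ => ?_
    rcases (Nat.lt_succ_iff.1 hP).lt_or_eq with hlt | rfl
    · exact .inl hlt
    · exact .inr ⟨rfl, hr.lt h.total_lt hk.le⟩

end FillTable

end Assignment

/-! ### The best load vector and its schedule -/

namespace Assignment

open RAM RAM.Cmd RAM.Expr Finset Var Arr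

variable {B m b N k c i r : ℕ} {a f F x y : ℕ → ℕ} {ok : ℕ → ℕ → Prop} {σ τ : Store Var Arr}
  {P : ℕ → ℕ → ℕ → Prop}

section FindBest

/-- Let `level` be at least the load of the current machine, which has free load `e`. -/
def raiseLevel (e : Expr Var Arr) : Cmd Var Arr :=
  .ite (e + fixedLoad machine - level) (level ::= e + fixedLoad machine) .skip

/-- Extract the load of the current machine from the current code. -/
def evalDigit : Cmd Var Arr :=
  digit ::= code / weight machine - base * (code / weight machine / base) ;;
  rest ::= rest - digit ;;
  raiseLevel digit

/-- Extract the loads of all machines but the last, whose load is then in `rest`. -/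
def evalDigits (m : ℕ) : Cmd Var Arr := forLt machine (m - 1 : ℕ) evalDigit

/-- Put the largest load of a load vector with the current code into `level`. -/
def evalCode (m : ℕ) : Cmd Var Arr :=
  rest ::= freeTotal ;; level ::= 0 ;; evalDigits m ;; raiseLevel rest

/-- Remember the current code if it is the best one so far. -/
def keepBetter : Cmd Var Arr :=
  .ite (1 - found + (bestLevel - level))
    (found ::= 1 ;; bestLevel ::= level ;; bestCode ::= code) .skip

/-- Find the best code in the last layer of the table. -/
def findBest (m : ℕ) : Cmd Var Arr :=
  found ::= 0 ;;
  forLt code codes (.ite (table (codes * freeCount + code)) (evalCode m ;; keepBetter) .skip)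

theorem raiseLevel_spec {e : Expr Var Arr} (he : e.eval σ + σ.arr fixedLoad (σ.var machine) ≤ B) :
    Triple B (raiseLevel e) σ 2 fun τ =>
      τ.var level = max (σ.var level) (e.eval σ + σ.arr fixedLoad (σ.var machine)) := by
  refine .ite (fun h => .assign (by simpa using he) ?_) fun h => .skip ?_
  · simp at h ⊢
    omega
  · simp at h ⊢
    omega

theorem evalDigit_spec (hB : ∑ k ∈ range N, a k + F i ≤ B) (h : HasCodes m b a ok N f σ)
    (hF : σ.arr fixedLoad = F) (hcode : σ.var code = loadCode m b a x N)
    (hmachine : σ.var machine = i) (hi : i < m - 1) :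
    Triple B evalDigit σ 4 fun τ => τ.var rest = σ.var rest - loadOn N a x i ∧
      τ.var level = max (σ.var level) (loadOn N a x i + F i) := by
  have hdigit : (code / weight machine - base * (code / weight machine / base) :
      Expr Var Arr).eval σ = loadOn N a x i := by
    rw [← loadCode_div_mod h.total_lt hi]
    simp [h.base, h.weight, hcode, hmachine, machineWeight, hi, Nat.mod_eq_sub_mul_div]
  have hload := (Nat.add_le_add_right (loadOn_le_sum le_rfl a x i) (F i)).trans hB
  refine Triple.of_bdd fun hσ => (Triple.assign_seq (by omega) (.assign_seq ?_
    ((raiseLevel_spec ?_).mono le_rfl fun τ _ hf hτ => ⟨?_, ?_⟩))).mono (by rfl) fun _ _ _ h => h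
  · simpa using (Nat.sub_le _ _).trans (hσ.var rest)
  · simpa [hdigit, hF, hmachine] using hload
  · simpa [hdigit] using hf.var_eq rest
  · simpa [hdigit, hF, hmachine] using hτ

theorem peak_succ (m N : ℕ) (a F x : ℕ → ℕ) :
    peak (m + 1) N a F x = max (peak m N a F x) (loadOn N a x m + F m) := by
  rw [peak, range_add_one, sup_insert, sup_comm]
  rfl

theorem evalDigits_spec (hm : 1 ≤ m) (hmB : m ≤ B) (hFB : ∀ i < m, ∑ k ∈ range N, a k + F i ≤ B)
    (h : HasCodes m b a ok N f σ) (hF : σ.arr fixedLoad = F) (hx : ∀ k < N, x k < m)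
    (hcode : σ.var code = loadCode m b a x N) (hrest : σ.var rest = ∑ k ∈ range N, a k)
    (hlevel : σ.var level = 0) :
    Triple B (evalDigits m) σ ((m - 1) * 6 + 2) fun τ => τ.var machine = m - 1 ∧
      τ.var rest = loadOn N a x (m - 1) ∧ τ.var level = peak (m - 1) N a F x := by
  refine .forLt (k := 4) (fun r τ =>
    τ.var rest = ∑ k ∈ range N, a k - ∑ i ∈ range r, loadOn N a x i ∧ τ.var level = peak r N a F x)
    (of_decide_eq_true rfl) (by simp) (by omega) (by simp [hrest, hlevel, peak])
    (fun r hr τ _ hf hmachine hτ => ?_) fun τ _ _ hmachine hτ => ⟨hmachine, ?_, hτ.2⟩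
  · refine (evalDigit_spec (hFB r (by omega)) (h.of_frame hf) ((hf.arr_eq fixedLoad).trans hF)
      ((hf.var_eq code).trans hcode) hmachine hr).mono le_rfl fun υ _ _ hυ => ⟨?_, ?_⟩
    · simpa [hτ.1, sum_range_succ, Nat.sub_sub] using hυ.1
    · simpa [hτ.2, peak_succ] using hυ.2
  · rw [hτ.1, loadOn_last hm a hx]

theorem evalCode_spec (hm : 1 ≤ m) (hmB : m ≤ B) (hFB : ∀ i < m, ∑ k ∈ range N, a k + F i ≤ B)
    (h : HasCodes m b a ok N f σ) (hF : σ.arr fixedLoad = F) (hx : ∀ k < N, x k < m)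
    (hcode : σ.var code = loadCode m b a x N) :
    Triple B (evalCode m) σ (6 * m) fun τ => τ.var level = peak m N a F x := by
  have htotalB := (Nat.le_add_right _ _).trans (hFB 0 hm)
  have hlastB := (Nat.add_le_add_right (loadOn_le_sum le_rfl a x (m - 1)) _).trans
    (hFB (m - 1) (by omega))
  refine (Triple.seq ((Triple.assign (Q := fun τ => τ.var rest = ∑ k ∈ range N, a k)
    (by simpa [h.freeTotal] using htotalB) (by simp [h.freeTotal])).mono le_rfl fun σ₁ _ hf₁ h₁ =>
    .seq ((Triple.assign (Q := fun τ => τ.var level = 0) (by simp) (by simp)).mono le_rfl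
      fun σ₂ _ hf₂ h₂ => .seq ((evalDigits_spec hm hmB hFB ((h.of_frame hf₁).of_frame hf₂) ?_ hx
      ?_ ((hf₂.var_eq rest).trans h₁) h₂).mono le_rfl fun τ _ hf hτ => (raiseLevel_spec ?_).mono
        (k := 2) le_rfl fun υ _ _ hυ => ?_)))).mono (by omega) fun _ _ _ h => h
  · rw [hf₂.arr_eq fixedLoad, hf₁.arr_eq fixedLoad, hF]
  · rw [hf₂.var_eq code, hf₁.var_eq code, hcode]
  all_goals
    have hload : τ.arr fixedLoad = F := by
      rw [hf.arr_eq fixedLoad, hf₂.arr_eq fixedLoad, hf₁.arr_eq fixedLoad, hF]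
  · simpa [hτ.1, hτ.2.1, hload] using hlastB
  · obtain ⟨m, rfl⟩ := Nat.exists_eq_add_of_le' hm
    simpa [hτ.1, hτ.2.1, hτ.2.2, hload, peak_succ] using hυ

/-- The best of the codes below `r` that belong to a load vector has been found. -/
structure BestBelow (m b : ℕ) (a : ℕ → ℕ) (ok : ℕ → ℕ → Prop) (N : ℕ) (F : ℕ → ℕ) (r : ℕ)
    (σ : Store Var Arr) : Prop where
  le_peak : ∀ z, Feasible m ok N z → loadCode m b a z N < r →
    σ.var found ≠ 0 ∧ σ.var bestLevel ≤ peak m N a F z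
  exists_eq : σ.var found ≠ 0 → ∃ x, Feasible m ok N x ∧
    loadCode m b a x N = σ.var bestCode ∧ peak m N a F x = σ.var bestLevel

theorem keepBetter_spec (hB : 1 ≤ B) (hb : ∑ k ∈ range N, a k < b) (hx : Feasible m ok N x)
    (hxr : loadCode m b a x N = r) (hcode : σ.var code = r)
    (hlevel : σ.var level = peak m N a F x) (h : BestBelow m b a ok N F r σ) :
    Triple B keepBetter σ 4 (BestBelow m b a ok N F (r + 1)) := by
  have hpeak {z} (hz : Feasible m ok N z) (hzr : loadCode m b a z N = r) :
      peak m N a F x = peak m N a F z :=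
    peak_eq_of_loadCode_eq hb (fun k hk => (hx k hk).1) (fun k hk => (hz k hk).1)
      (hxr.trans hzr.symm) F
  refine Triple.of_bdd fun hσ => .ite (fun hbetter => ?_) fun hworse =>
    (Triple.skip ⟨fun z hz hzr => ?_, h.exists_eq⟩).mono (by omega) fun _ _ _ h => h
  · refine Triple.assign_seq hB (.assign_seq (by simpa using hσ.var level)
      (.assign (by simpa using hσ.var code) ⟨fun z hz hzr => ?_, fun _ => ⟨x, hx, ?_, ?_⟩⟩))
    · refine ⟨by simp, ?_⟩
      rcases (Nat.lt_succ_iff.1 hzr).lt_or_eq with hlt | heq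
      · have hle := h.le_peak z hz hlt
        simp [hlevel] at hbetter ⊢
        omega
      · simp [hlevel, hpeak hz heq]
    · simp [hxr, hcode]
    · simp [hlevel]
  · rcases (Nat.lt_succ_iff.1 hzr).lt_or_eq with hlt | heq
    · exact h.le_peak z hz hlt
    · simp only [eval_add, eval_sub, eval_ofNat, eval_var, hlevel, hpeak hz heq] at hworse
      omega

theorem findBest_spec (hm : 1 ≤ m) (hmB : m ≤ B) (hFB : ∀ i < m, ∑ k ∈ range N, a k + F i ≤ B)
    (h : HasCodes m b a ok N f σ) (hF : σ.arr fixedLoad = F) (hex : ∃ y, Feasible m ok N y)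
    (hT : Table m b a ok (fun k _ _ => k < N) (σ.arr table)) :
    Triple B (findBest m) σ (b ^ (m - 1) * (6 * m + 7) + 3) fun τ =>
      ∃ x, IsBest m ok N a F x ∧ loadCode m b a x N = τ.var bestCode := by
  refine Triple.of_bdd fun hσ => ?_
  have hVB : b ^ (m - 1) ≤ B := h.codes ▸ hσ.var codes
  refine (Triple.seq ((Triple.assign (Q := fun τ => τ.var found = 0) (by simp) (by simp)).mono
    le_rfl fun σ₁ _ hf₁ h₁ => .forLt (N := b ^ (m - 1)) (k := 6 * m + 4 + 1)
    (BestBelow m b a ok N F) (of_decide_eq_true rfl) (by simp [(h.of_frame hf₁).codes]) hVB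
    ⟨by simp, by simp [h₁]⟩ (fun r hr τ _ hf hcode hτ => ?_) fun τ _ _ _ hτ => ?_)).mono
    (by ring_nf; rfl) fun _ _ _ h => h
  · have hτcodes := (h.of_frame hf₁).of_frame hf
    have htable : τ.arr table = σ.arr table :=
      (hf.arr_eq table).trans (hf₁.arr_eq table)
    have hreach : (table (codes * freeCount + code) : Expr Var Arr).eval τ ≠ 0 ↔
        Reach m b a ok N r := by
      simpa [hτcodes.codes, hτcodes.freeCount, hcode, htable] using
        hT.ne_zero_iff (fun k' hk' _ _ => hk') hr
    refine .ite (fun hne => ?_) fun hzero => (Triple.skip ⟨fun z hz hzr => ?_, ?_⟩).mono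
      (by omega) fun _ _ _ h => h
    · obtain ⟨x, hx, hxr⟩ := hreach.1 hne
      refine .seq ((evalCode_spec hm hmB hFB hτcodes ?_ (fun k hk => (hx k hk).1)
        (hcode.trans hxr.symm)).mono le_rfl fun υ _ hf' hυ => (keepBetter_spec (by omega)
        h.total_lt hx hxr ((hf'.var_eq code).trans hcode) hυ ?_).mono le_rfl
          fun _ _ _ h => ⟨h.1, h.2⟩)
      · rw [hf.arr_eq fixedLoad, hf₁.arr_eq fixedLoad, hF]
      · constructor <;> simp only [hf'.var_eq found, hf'.var_eq bestLevel, hf'.var_eq bestCode]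
        exacts [hτ.le_peak, hτ.exists_eq]
    · refine hτ.le_peak z hz ((Nat.lt_succ_iff.1 hzr).lt_of_ne ?_)
      rintro rfl
      exact hreach.2 ⟨z, hz, rfl⟩ hzero
    · exact hτ.exists_eq
  · have hle {z} (hz : Feasible m ok N z) := hτ.le_peak z hz (loadCode_lt h.total_lt le_rfl z)
    obtain ⟨y, hy⟩ := hex
    obtain ⟨x, hx, hcode, hpeak⟩ := hτ.exists_eq (hle hy).1
    exact ⟨x, ⟨hx, fun z hz => hpeak.trans_le (hle hz).2⟩, hcode⟩

end FindBest

section TraceBack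

/-- Read off the machine of the last item that has not been traced yet. -/
def traceItem : Cmd Var Arr :=
  layer ::= freeCount - item ;;
  machine ::= table (codes * layer + code) - 1 ;;
  job ::= freeJob (layer - 1) ;;
  store output job machine ;;
  code ::= code - size job * weight machine

/-- Schedule the items with a load vector that has the best code. -/
def traceBack : Cmd Var Arr := code ::= bestCode ;; forLt item freeCount traceItem

/-- All items from item `k` on have been scheduled, and `code` belongs to a load vector of the
first `k` items that leads to the code `c`. Outside the items, the schedule is still `y`. -/
structure Traced (m b : ℕ) (a : ℕ → ℕ) (ok : ℕ → ℕ → Prop) (N : ℕ) (f y : ℕ → ℕ) (c k : ℕ)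
    (σ : Store Var Arr) : Prop where
  reach : Reach m b a ok k (σ.var code)
  feasible : ∀ k', k ≤ k' → k' < N → σ.arr output (f k') < m ∧ ok k' (σ.arr output (f k'))
  code_eq : σ.var code + ∑ k' ∈ Ico k N, a k' * machineWeight m b (σ.arr output (f k')) = c
  output_eq : ∀ j, (∀ k < N, f k ≠ j) → σ.arr output j = y j

theorem Traced.step {c' : ℕ} (h : Traced m b a ok N f y c (k + 1) σ)
    (hf : Set.InjOn f (range N)) (hk : k < N) (hi : i < m) (hok : ok k i)
    (hr : Reach m b a ok k c') (hc : σ.var code = c' + a k * machineWeight m b i)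
    (hcode : τ.var code = c') (houtput : τ.arr output = Function.update (σ.arr output) (f k) i) :
    Traced m b a ok N f y c k τ := by
  have hself : τ.arr output (f k) = i := by rw [houtput, Function.update_self]
  have hne {k'} (hk' : k' < N) (hkk' : k' ≠ k) : τ.arr output (f k') = σ.arr output (f k') := by
    rw [houtput, Function.update_of_ne]
    exact fun heq => hkk' (hf (mem_range.2 hk') (mem_range.2 hk) heq)
  refine ⟨hcode ▸ hr, fun k' hkk' hk' => ?_, ?_, fun j hj => ?_⟩
  · rcases hkk'.lt_or_eq with hlt | rfl
    · rw [hne hk' hlt.ne']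
      exact h.feasible k' hlt hk'
    · exact hself.symm ▸ ⟨hi, hok⟩
  · rw [sum_eq_sum_Ico_succ_bot hk, hself, hcode, ← add_assoc, ← hc, ← h.code_eq]
    refine congrArg (_ + ·) (sum_congr rfl fun k' hk' => ?_)
    rw [hne (mem_Ico.1 hk').2 (Nat.ne_of_gt (mem_Ico.1 hk').1)]
  · rw [houtput, Function.update_of_ne (hj k hk).symm]
    exact h.output_eq j hj

theorem traceItem_spec (hmB : m ≤ B) (h : HasCodes m b a ok N f σ) (hf : Set.InjOn f (range N))
    (hT : Table m b a ok (fun k _ _ => k < N) (σ.arr table)) (hk : k < N)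
    (hitem : N - σ.var item = k + 1) (hσ : Traced m b a ok N f y c (k + 1) σ) :
    Triple B traceItem σ 5 (Traced m b a ok N f y c k) := by
  have hlt := hσ.reach.lt h.total_lt hk
  obtain ⟨c', i, hi, hok, hr, hc, hentry⟩ := hT.sound k _ hlt
    ((hT.ne_zero_iff (fun k' hk' _ _ => by omega) hlt).2 hσ.reach)
  have hlayer : (freeCount - item : Expr Var Arr).eval σ = k + 1 := by
    simpa [h.freeCount] using hitem
  refine Triple.of_bdd fun hB => (Triple.assign_seq ?_ (.assign_seq ?_ (.assign_seq ?_
    (.store_seq ?_ (.assign ?_ (hσ.step hf hk hi hok hr hc ?_ ?_)))))).mono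
      (k := 1 + (1 + (1 + (1 + 1)))) le_rfl fun _ _ _ h => h
  · rw [hlayer]
    exact hk.trans_le (h.freeCount ▸ hB.var freeCount)
  · simpa [hlayer, h.codes, hentry] using hi.le.trans hmB
  · simpa using hB.arr _ _
  · simpa [hlayer, h.codes, hentry] using hi.le.trans hmB
  · simpa using (Nat.sub_le _ _).trans (hB.var code)
  · simpa [hlayer, h.codes, hentry, h.freeJob, h.size, h.weight] using Nat.sub_eq_of_eq_add hc
  · simp [hlayer, h.codes, hentry, h.freeJob]

theorem traceBack_spec (hmB : m ≤ B) (h : HasCodes m b a ok N f σ) (hf : Set.InjOn f (range N))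
    (hT : Table m b a ok (fun k _ _ => k < N) (σ.arr table))
    (hx : Feasible m ok N x) (hcode : loadCode m b a x N = σ.var bestCode) :
    Triple B traceBack σ (7 * N + 3)
      (Traced m b a ok N f (σ.arr output) (loadCode m b a x N) 0) := by
  refine Triple.of_bdd fun hB => ?_
  have hNB : N ≤ B := h.freeCount ▸ hB.var freeCount
  refine (Triple.seq ((Triple.assign (Q := fun τ => τ.var code = loadCode m b a x N)
    (by simpa using hB.var bestCode) (by simp [hcode])).mono le_rfl fun τ _ hfτ hτ =>
    .forLt (N := N) (k := 5) (fun r υ => Traced m b a ok N f (σ.arr output)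
      (loadCode m b a x N) (N - r) υ) (of_decide_eq_true rfl)
    (by simp [(h.of_frame hfτ).freeCount]) hNB ⟨⟨x, hx, by simp [hτ]⟩, ?_, by simp [hτ], ?_⟩
    (fun r hr υ _ hfυ hitem hυ => ?_) fun υ _ _ _ hυ => by simpa using hυ)).mono
      (by omega) fun _ _ _ h => h
  · exact fun k' hle hlt => absurd hlt hle.not_gt
  · exact fun j _ => by simp [hfτ.arr_eq output]
  · refine (traceItem_spec (k := N - (r + 1)) hmB ((h.of_frame hfτ).of_frame hfυ) hf ?_ (by omega)
      (by omega) ?_).mono le_rfl fun _ _ _ h => ⟨h.1, h.2, h.3, h.4⟩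
    · rwa [hfυ.arr_eq table, hfτ.arr_eq table]
    · rwa [show N - (r + 1) + 1 = N - r by omega]

end TraceBack

end Assignment

/-! ### Optimality of the computed schedule -/

namespace Assignment

open RAM RAM.Cmd RAM.Expr Finset Var Arr

section Finish

variable {B m N b : ℕ} {a f F : ℕ → ℕ} {ok : ℕ → ℕ → Prop} {σ : Store Var Arr}

/-- Schedule the items optimally on top of the fixed loads by dynamic programming. -/
def finish (m : ℕ) : Cmd Var Arr := computeWeights m ;; fillTable m ;; findBest m ;; traceBack

theorem finish_spec (hm : 1 ≤ m) (hmB : m ≤ B) (hb : ∑ k ∈ range N, a k + 1 = b)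
    (hbB : b ≤ B) (hVB : b ^ (m - 1) ≤ B) (hFB : ∀ i < m, ∑ k ∈ range N, a k + F i ≤ B)
    (h : HasItems m a ok N f σ) (hF : σ.arr fixedLoad = F) (hf : Set.InjOn f (range N))
    (hex : ∃ y, Feasible m ok N y) (hweight : σ.arr weight = 0) (htable : σ.arr table = 0) :
    Triple B (finish m) σ ((N + 1) * (b ^ (m - 1) * (10 * m + 20))) fun τ =>
      IsBest m ok N a F (fun k => τ.arr output (f k)) ∧
        ∀ j, (∀ k < N, f k ≠ j) → τ.arr output j = σ.arr output j := by
  have hV : 1 ≤ b ^ (m - 1) := Nat.one_le_pow _ _ (hb ▸ Nat.succ_pos _)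
  have hcodes : Triple B (computeWeights m) σ (4 * m + 4) (HasCodes m b a ok N f) :=
    hb ▸ computeWeights_spec hmB (hb ▸ hbB) (hb ▸ hVB) h hweight
  refine (Triple.seq (hcodes.mono le_rfl
    fun σ₁ _ hf₁ h₁ => .seq ((fillTable_spec hmB (hm.trans hmB) h₁ ?_).mono le_rfl
    fun σ₂ _ hf₂ hT => .seq ((findBest_spec hm hmB hFB (h₁.of_frame hf₂) ?_ hex hT).mono le_rfl
    fun σ₃ _ hf₃ ⟨x, hx, hxcode⟩ => (traceBack_spec hmB ((h₁.of_frame hf₂).of_frame hf₃) hf ?_ hx.1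
      hxcode).mono le_rfl fun τ _ _ hτ => ?_)))).mono
        (by nlinarith only [hm, hV, Nat.mul_le_mul_left N hV, Nat.mul_le_mul_left m hV,
          Nat.zero_le (N * b ^ (m - 1) * m)])
        fun _ _ _ h => h
  · rw [hf₁.arr_eq table, htable]
  · rw [hf₂.arr_eq fixedLoad, hf₁.arr_eq fixedLoad, hF]
  · rwa [hf₃.arr_eq table]
  · have hcode : loadCode m b a (fun k => τ.arr output (f k)) N = loadCode m b a x N := by
      rw [← hτ.code_eq, Reach.zero_iff.1 hτ.reach, zero_add, loadCode, range_eq_Ico]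
    refine ⟨⟨fun k hk => hτ.feasible k k.zero_le hk, fun z hz => ?_⟩, fun j hj => ?_⟩
    · rw [peak_eq_of_loadCode_eq h₁.total_lt (fun k hk => (hτ.feasible k k.zero_le hk).1)
        (fun k hk => (hx.1 k hk).1) hcode]
      exact hx.2 z hz
    · rw [hτ.output_eq j hj, hf₃.arr_eq output, hf₂.arr_eq output, hf₁.arr_eq output]

end Finish

section Near

variable {m n q D K : ℕ} {p x y key : ℕ → ℕ} {ok : ℕ → ℕ → Prop}

theorem load_eq_loadOn (p : ℕ → ℕ) {z : Fin n → Fin m} (hz : ∀ j : Fin n, x j = z j) (i : Fin m) :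
    load (fun j : Fin n => p j) z i = loadOn n p x i := by
  rw [load, loadOn, sum_filter, sum_filter,
    ← Fin.sum_univ_eq_sum_range fun j => if x j = i then p j else 0]
  simp only [hz, Fin.ext_iff]

theorem maxLoad_eq_peak (p : ℕ → ℕ) {z : Fin n → Fin m} (hz : ∀ j : Fin n, x j = z j) :
    maxLoad (fun j : Fin n => p j) z = peak m n p 0 x := by
  refine le_antisymm (Finset.sup_le fun i _ => ?_) (Finset.sup_le fun i hi => ?_)
  · rw [load_eq_loadOn p hz]
    exact le_sup (f := fun i => loadOn n p x i + 0) (mem_range.2 i.2)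
  · rw [Pi.zero_apply, add_zero, ← load_eq_loadOn p hz ⟨i, mem_range.1 hi⟩]
    exact load_le_maxLoad _ z _

theorem IsOptimal.isBest {z : Fin n → Fin m}
    (h : IsOptimal (fun j : Fin n => p j) (fun j (i : Fin m) => ok j i) z)
    (hz : ∀ j : Fin n, x j = z j) :
    IsBest m ok n p 0 x := by
  refine ⟨fun j hj => ?_, fun x' hx' => ?_⟩
  · rw [hz ⟨j, hj⟩]
    exact ⟨(z _).2, h.eligible ⟨j, hj⟩⟩
  · rw [← maxLoad_eq_peak p hz,
      ← maxLoad_eq_peak p (z := fun j : Fin n => ⟨x' j, (hx' j j.2).1⟩) fun _ => rfl]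
    exact h.maxLoad_le _ fun j => (hx' j j.2).2

theorem IsFree.of_card_lt {j : Fin n} (h : #{j' : Fin n | j' < j ∧ key j' = key j} < K) :
    IsFree K key j := by
  refine (card_le_card_of_surjOn Fin.val fun j' hj' => ?_).trans_lt h
  simp only [coe_filter, mem_range, Set.mem_ofPred_eq] at hj'
  exact ⟨⟨j', hj'.1.trans j.2⟩, mem_coe.2 (mem_filter.2 ⟨mem_univ _, hj'⟩), rfl⟩

theorem exists_isBest_near (hq : 1 ≤ q) (hp : ∀ j < n, p j ≤ q) (hy : Feasible m ok n y)
    (hkey : ∀ j < n, ∀ j' < n, key j = key j' →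
      p j = p j' ∧ (∀ i < m, ok j i ↔ ok j' i) ∧ y j = y j')
    (hbal : ∀ j < n, 0 < p j → ∀ i < m, ok j i → loadOn n p y (y j) ≤ loadOn n p y i + D)
    (hK : m * moveBound m q D ≤ K) :
    ∃ x, IsBest m ok n p 0 x ∧ ∀ j < n, ¬ IsFree K key j → x j = y j := by
  let y' : Fin n → Fin m := fun j => ⟨y j, (hy j j.2).1⟩
  obtain ⟨x, hx, hnear⟩ := exists_isOptimal_near (p := fun j : Fin n => p j) (y := y')
    (E := fun j (i : Fin m) => ok j i) (q := q) (D := D) (fun j : Fin n => key j)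
    (fun j j' h => have ⟨hp, hok, hy⟩ := hkey j j.2 j' j'.2 h
      ⟨hp, funext fun i => propext (hok i i.2), Fin.ext hy⟩)
    hq (fun j => hp j j.2) (fun j => (hy j j.2).2) fun j hj i hi => by
      simpa only [load_eq_loadOn p (x := y) (z := y') fun _ => rfl] using hbal j j.2 hj i i.2 hi
  let x' : ℕ → ℕ := fun j => if h : j < n then x ⟨j, h⟩ else 0
  have hext (j : Fin n) : x' j = x j := by simp [x']
  refine ⟨x', hx.isBest hext, fun j hj hfree => (hext ⟨j, hj⟩).trans ?_⟩
  by_contra hne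
  refine hfree (IsFree.of_card_lt ((hnear ⟨j, hj⟩ fun h => hne ?_).trans_le (by simpa using hK)))
  rw [h]

end Near

section Selected

variable {K m n : ℕ} {p x y z key : ℕ → ℕ} {ok : ℕ → ℕ → Prop} {σ : Store Var Arr}

theorem Selected.loadOn_eq (h : Selected K p y key n σ)
    (hx : ∀ j < n, ¬ IsFree K key j → x j = y j) (i : ℕ) :
    loadOn n p x i = loadOn (σ.var freeCount) (fun k => p (σ.arr freeJob k))
      (fun k => x (σ.arr freeJob k)) i + σ.arr fixedLoad i := by
  rw [loadOn, loadOn, sum_filter, sum_filter, h.fixedLoad_eq,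
    h.sum_freeJob fun j => if x j = i then p j else 0,
    ← sum_filter_add_sum_filter_not (range n) (IsFree K key), ← filter_filter, sum_filter (y · = i)]
  refine congrArg (_ + ·) (sum_congr rfl fun j hj => ?_)
  rw [hx j (mem_range.1 (mem_filter.1 hj).1) (mem_filter.1 hj).2]

theorem Selected.peak_eq (h : Selected K p y key n σ)
    (hx : ∀ j < n, ¬ IsFree K key j → x j = y j) :
    peak m n p 0 x = peak m (σ.var freeCount) (fun k => p (σ.arr freeJob k)) (σ.arr fixedLoad)
      fun k => x (σ.arr freeJob k) :=
  sup_congr rfl fun i _ => h.loadOn_eq hx i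

theorem Selected.exists_freeJob_eq_iff (h : Selected K p y key n σ) {j : ℕ} (hj : j < n) :
    (∃ k < σ.var freeCount, σ.arr freeJob k = j) ↔ IsFree K key j := by
  simpa [hj] using Finset.ext_iff.1 h.image_freeJob j

theorem Selected.isBest (h : Selected K p y key n σ) (hy : Feasible m ok n y)
    (hx : IsBest m ok n p 0 x) (hxy : ∀ j < n, ¬ IsFree K key j → x j = y j)
    (hz : IsBest m (fun k i => ok (σ.arr freeJob k) i) (σ.var freeCount)
      (fun k => p (σ.arr freeJob k)) (σ.arr fixedLoad) fun k => z (σ.arr freeJob k))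
    (hzy : ∀ j, (∀ k < σ.var freeCount, σ.arr freeJob k ≠ j) → z j = y j) :
    IsBest m ok n p 0 z := by
  have hzy' : ∀ j < n, ¬ IsFree K key j → z j = y j := fun j hj hfree => hzy j fun k hk hkj =>
    hfree ((h.exists_freeJob_eq_iff hj).1 ⟨k, hk, hkj⟩)
  refine ⟨fun j hj => ?_, fun z' hz' => le_trans ?_ (hx.2 z' hz')⟩
  · by_cases hfree : IsFree K key j
    · obtain ⟨k, hk, rfl⟩ := (h.exists_freeJob_eq_iff hj).2 hfree
      exact hz.1 k hk
    · exact hzy' j hj hfree ▸ hy j hj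
  · rw [h.peak_eq hzy', h.peak_eq hxy]
    exact hz.2 _ fun k hk => hx.1 _ (h.freeJob_lt hk)

end Selected

end Assignment

/-! ### The program -/

namespace Assignment

open RAM RAM.Cmd RAM.Expr Finset Var Arr

section NumUnits

variable {m n q s : ℕ} {p e : ℕ → ℕ}

/-- The number of units of size `q` that make room for the jobs of type `s`. -/
def numUnits (m n q : ℕ) (p e : ℕ → ℕ) (s : ℕ) : ℕ :=
  (∑ j ∈ range n with eligibilityMask m e j = s, p j + q - 1) / q

theorem le_numUnits_mul (hq : 1 ≤ q) :
    ∑ j ∈ range n with eligibilityMask m e j = s, p j ≤ numUnits m n q p e s * q := by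
  have := Nat.lt_div_mul_add (a := ∑ j ∈ range n with eligibilityMask m e j = s, p j + q - 1) hq
  unfold numUnits
  omega

theorem numUnits_mul_le :
    numUnits m n q p e s * q ≤ ∑ j ∈ range n with eligibilityMask m e j = s, p j + q :=
  (Nat.div_mul_le_self _ _).trans (Nat.sub_le _ _)

theorem numUnits_le (hq : 1 ≤ q) (hp : ∀ j < n, p j ≤ q) : numUnits m n q p e s ≤ n := by
  have htotal := sum_filter_le_mul (fun j => eligibilityMask m e j = s) le_rfl hp
  rw [numUnits, ← Nat.lt_succ_iff, Nat.div_lt_iff_lt_mul hq, Nat.succ_mul]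
  omega

theorem exists_of_numUnits_ne_zero (h : numUnits m n q p e s ≠ 0) :
    ∃ j < n, eligibilityMask m e j = s := by
  by_contra! hne
  refine h ?_
  rw [numUnits, filter_false_of_mem fun j hj => hne j (mem_range.1 hj), sum_empty, zero_add]
  exact Nat.div_eq_zero_iff.2 (by omega)

end NumUnits

section Solve

variable {B m n q : ℕ} {p e : ℕ → ℕ} {σ : Store Var Arr}

/-- Build a balanced schedule. -/
def balance (m : ℕ) : Cmd Var Arr := placeUnits m ;; distribute m

/-- The feasible schedule `y` puts every nonempty job on a machine whose load exceeds that of any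
other machine eligible for this job by at most `slack m q`. -/
def IsBalanced (m n q : ℕ) (p : ℕ → ℕ) (ok : ℕ → ℕ → Prop) (y : ℕ → ℕ) : Prop :=
  Feasible m ok n y ∧ ∀ j < n, 0 < p j → ∀ i < m, ok j i →
    loadOn n p y (y j) ≤ loadOn n p y i + slack m q

theorem Scanned.eligible_witness (h : Scanned m p e n σ) (he : ∀ k, e k ≤ 1) {j i : ℕ} (hj : j < n)
    (hi : i < m) : e (m * σ.arr witness (eligibilityMask m e j) + i) = e (m * j + i) :=
  eq_of_eligibilityMask_eq he (h.mask_witness j hj) hi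

theorem balance_spec (hm : 1 ≤ m) (hq : 1 ≤ q) (hp : ∀ j < n, p j ≤ q) (he : ∀ k, e k ≤ 1)
    (hmB : m * 2 ^ m ≤ B) (hNB : 2 ^ m * n < B) (hnB : n * q ≤ B) (hσ : HasInput n p e σ)
    (h : Scanned m p e n σ) (hsize : σ.var unitSize = q) (hstuck : σ.var stuck = 0)
    (hunits : σ.arr units = 0) (hcount : σ.arr unitCount = 0) (hfilled : σ.arr filled = 0) :
    Triple B (balance m) σ
      (2 ^ m * (n * (m * (8 * m * 2 ^ m + 12) + 10) + 4) + 2 + (n * (8 * m + 8) + 2)) fun τ =>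
      IsBalanced m n q p (fun j i => e (m * j + i) ≠ 0) (τ.arr output) := by
  have hex : ∀ j < n, ∃ i < m, e (m * j + i) ≠ 0 := fun j hj =>
    eligibilityMask_ne_zero_iff.1 (h.stuck_eq_zero_iff.1 hstuck j hj)
  let E : ℕ → ℕ → ℕ := fun s i => e (m * σ.arr witness s + i)
  have hE : ∀ j < n, ∀ i < m, E (eligibilityMask m e j) i = e (m * j + i) := fun j hj i hi =>
    h.eligible_witness he hj hi
  refine Triple.seq ((placeUnits_spec (N := numUnits m n q p e) (E := E) hm hmB hNB
    (fun t => by rw [h.typeTotal_eq, hsize, numUnits]) (fun t => numUnits_le hq hp)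
    (fun t _ ht => ?_) (fun s i => by rw [hσ.eligible]) hunits hcount).mono le_rfl
    fun τ _ hf hC => (distribute_spec (p := p) (e := e) ?_ ?_ ?_ (hσ.of_frame hf) ?_ ?_ hex ?_ ?_
      ((hf.arr_eq filled).trans hfilled)).mono le_rfl fun υ _ _ hυ => ?_)
  · obtain ⟨j, hj, rfl⟩ := exists_of_numUnits_ne_zero ht
    exact (hex j hj).imp fun i hi => ⟨hi.1, by rw [hE j hj i hi.1]; exact hi.2⟩
  · exact (Nat.le_mul_of_pos_right m (Nat.two_pow_pos m)).trans hmB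
  · exact (Nat.le_mul_of_pos_right n hq).trans hnB
  · simpa using (sum_filter_le_mul (fun _ => True) le_rfl hp).trans hnB
  · simpa only [hf.arr_eq mask] using h.mask_eq
  · simpa only [hf.var_eq unitSize, hsize] using hp
  · exact fun j hj i hi hne => hE j hj i hi ▸ hC.eligible _ (eligibilityMask_lt he j) i hi hne
  · intro r _
    rw [← sum_mul, hC.row _ (eligibilityMask_lt he r), hf.var_eq unitSize, hsize]
    exact le_numUnits_mul hq
  · rw [hf.var_eq unitSize, hsize] at hυ
    exact ⟨fun j hj => ⟨hυ.output_lt j hj, hυ.eligible j hj⟩, fun j hj hpj i hi hei =>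
      hυ.loadOn_le_add_slack hC he hE (fun s _ => numUnits_mul_le) hj hpj hi hei⟩

/-- If `freeFactor m * q ^ (m + 1)` jobs of each class of a balanced schedule are released, then
the other jobs may stay where they are. -/
def freeFactor (m : ℕ) : ℕ := m * (m + m * m * (2 ^ m * (m + 2) + 1) + 2 * (m * m) + 1)

theorem mul_moveBound_slack_le (hm : 1 ≤ m) (hq : 1 ≤ q) :
    m * moveBound m q (slack m q) ≤ freeFactor m * q ^ (m + 1) := by
  obtain ⟨r, rfl⟩ : ∃ r, m = r + 1 := ⟨m - 1, by omega⟩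
  rw [freeFactor, mul_assoc]
  refine Nat.mul_le_mul_left _ ?_
  rw [moveBound, slack, Nat.add_sub_cancel]
  set s := 2 ^ (r + 1) * (r + 1 + 2) + 1
  set m := r + 1
  have hpow {i} (hi : i ≤ m + 1) : q ^ i ≤ q ^ (m + 1) := Nat.pow_le_pow_right hq hi
  calc m * (q ^ m + m * (s * q)) + q ^ r * (m * m * (q + 1)) * q + q ^ r
      ≤ m * (q ^ m + m * (s * q)) + q ^ r * (m * m * (q + q)) * q + q ^ r := by gcongr
    _ = m * q ^ m + m * m * s * q ^ 1 + 2 * (m * m) * q ^ (r + 1 + 1) + q ^ r := by ring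
    _ ≤ m * q ^ (m + 1) + m * m * s * q ^ (m + 1) + 2 * (m * m) * q ^ (m + 1) + q ^ (m + 1) := by
      gcongr ?_ + _ * ?_ + _ * ?_ + ?_
      · exact Nat.mul_le_mul_left _ (hpow (by omega))
      · exact hpow (by omega)
      · exact hpow (by omega)
      · exact hpow (by omega)
    _ = _ := by ring

/-- A bound on the number of released jobs. -/
def maxFree (m q : ℕ) : ℕ := freeFactor m * q ^ (m + 1) * (m * (2 ^ m * q))

theorem freeFactor_mul_pow_le_maxFree (hm : 1 ≤ m) (hq : 1 ≤ q) :
    freeFactor m * q ^ (m + 1) ≤ maxFree m q :=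
  Nat.le_mul_of_pos_right _ (by positivity)

theorem one_le_maxFree (hm : 1 ≤ m) (hq : 1 ≤ q) : 1 ≤ maxFree m q := by
  unfold maxFree freeFactor
  have := hm
  exact Nat.succ_le_of_lt (by positivity)

/-- Release some jobs of a balanced schedule, and schedule them optimally. -/
def improve (m : ℕ) : Cmd Var Arr := select m (freeFactor m) ;; finish m

section Selected

variable {K : ℕ} {y key : ℕ → ℕ}

theorem Selected.sum_freeJob_lt (h : Selected K p y key n σ) (hp : ∀ j < n, p j < q) {N : ℕ}
    (hN : σ.var freeCount ≤ N) (hN₁ : 1 ≤ N) (hq : 1 ≤ q) :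
    ∑ k ∈ range (σ.var freeCount), p (σ.arr freeJob k) < N * q := by
  have hsum : ∑ k ∈ range (σ.var freeCount), (p (σ.arr freeJob k) + 1) ≤ σ.var freeCount * q :=
    (sum_le_card_nsmul _ _ q fun k hk => hp _ (h.freeJob_lt (mem_range.1 hk))).trans_eq (by simp)
  rw [sum_add_distrib, sum_const, card_range, smul_eq_mul, mul_one] at hsum
  have hNq : σ.var freeCount * q ≤ N * q := Nat.mul_le_mul_right q hN
  obtain h₀ | h₀ := Nat.eq_zero_or_pos (σ.var freeCount)
  · rw [h₀, sum_range_zero]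
    exact Nat.mul_pos hN₁ hq
  · omega

theorem Selected.sum_freeJob_add_fixedLoad_le (h : Selected K p y key n σ) (hp : ∀ j < n, p j ≤ q)
    (i : ℕ) :
    ∑ k ∈ range (σ.var freeCount), p (σ.arr freeJob k) + σ.arr fixedLoad i ≤ n * q := by
  rw [h.sum_freeJob, h.fixedLoad_eq, ← filter_filter]
  calc _ ≤ ∑ j ∈ range n with IsFree K key j, p j + ∑ j ∈ range n with ¬ IsFree K key j, p j :=
        Nat.add_le_add_left (sum_le_sum_of_subset (filter_subset _ _)) _
    _ = ∑ j ∈ range n with True, p j := by rw [sum_filter_add_sum_filter_not, filter_true]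
    _ ≤ n * q := sum_filter_le_mul _ le_rfl hp

end Selected

theorem improve_spec (hm : 1 ≤ m) (hq : 1 ≤ q) (hp : ∀ j < n, p j < q) (he : ∀ k, e k ≤ 1)
    (hmB : m + 1 ≤ B) (hnB : n + n * q ≤ B) (hFB : maxFree m q * q ≤ B)
    (hVB : (maxFree m q * q) ^ (m - 1) ≤ B) (hσ : HasInput n p e σ)
    (hmask : ∀ j < n, σ.arr mask j = eligibilityMask m e j) (hsize : σ.var unitSize = q)
    (hbal : IsBalanced m n q p (fun j i => e (m * j + i) ≠ 0) (σ.arr output))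
    (hcount : σ.var freeCount = 0) (htotal : σ.var freeTotal = 0)
    (hclass : σ.arr classCount = 0) (hfixed : σ.arr fixedLoad = 0)
    (hweight : σ.arr weight = 0) (htable : σ.arr table = 0) :
    Triple B (improve m) σ (7 * n + 3 * m + 8 +
      (maxFree m q + 1) * ((maxFree m q * q) ^ (m - 1) * (10 * m + 20))) fun τ =>
      IsBest m (fun j i => e (m * j + i) ≠ 0) n p 0 (τ.arr output) := by
  obtain ⟨hy, hbal⟩ := hbal
  have hfree := one_le_maxFree hm hq
  obtain ⟨x, hx, hxy⟩ := exists_isBest_near (key := classKey m p e (σ.arr output)) hq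
    (fun j hj => (hp j hj).le) hy (fun j hj j' hj' hkey => by
      obtain ⟨hpj, hmaskj, hyj⟩ := (classKey_eq_iff he (hy j hj).1 (hy j' hj').1).1 hkey
      exact ⟨hpj, fun i hi => by rw [eq_of_eligibilityMask_eq he hmaskj hi], hyj⟩)
    hbal (mul_moveBound_slack_le hm hq)
  subst hsize
  refine Triple.seq ((select_spec hmB hnB (((freeFactor_mul_pow_le_maxFree hm hq).trans
    (Nat.le_mul_of_pos_right _ hq)).trans hFB) hq (fun j hj => (hp j hj).le) hσ hmask hcount
    htotal hclass hfixed).mono le_rfl fun τ _ hf h => ?_)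
  have hin := hσ.of_frame hf
  have hN : τ.var freeCount ≤ maxFree m (σ.var unitSize) := h.freeCount_eq.trans_le
    (card_isFree_le fun j hj => classKey_lt he (hy j hj).1 (hp j hj))
  have hb := h.sum_freeJob_lt hp hN hfree hq
  refine (finish_spec (ok := fun k i => e (m * τ.arr freeJob k + i) ≠ 0)
    (a := fun k => p (τ.arr freeJob k)) hm (by omega) rfl (hb.trans_le hFB)
    ((Nat.pow_le_pow_left hb _).trans hVB) (fun i _ => (h.sum_freeJob_add_fixedLoad_le
      (fun j hj => (hp j hj).le) i).trans (by omega))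
    ⟨rfl, ?_, rfl, fun k => ?_, fun k i => ?_⟩ rfl h.injOn_freeJob
    ⟨_, fun k hk => hy _ (h.freeJob_lt hk)⟩ ((hf.arr_eq weight).trans hweight)
    ((hf.arr_eq table).trans htable)).mono ?_ fun υ _ _ hυ => ?_
  · rw [h.freeTotal_eq, h.sum_freeJob]
  · rw [hin.size]
  · rw [hin.eligible]
  · gcongr
    exact hb
  · rw [hf.arr_eq output] at hυ
    exact h.isBest hy hx hxy hυ.1 hυ.2

/-- The program. If some job has no eligible machine, then every schedule is optimal. -/
def program (m : ℕ) : Cmd Var Arr := scan m ;; .ite stuck .skip (balance m ;; improve m)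

/-- A bound on all numbers that `program m` computes for `n` jobs of sizes below `q`. -/
def numberBound (m n q : ℕ) : ℕ :=
  2 ^ m * (n + m + 1) + n * (q + 1) + q + maxFree m q * q + (maxFree m q * q) ^ (m - 1)

/-- A bound on the running time of `program m` on `n` jobs of sizes below `q`. -/
def stepBound (m n q : ℕ) : ℕ :=
  n * (4 * m + 13) + 3 +
    (2 ^ m * (n * (m * (8 * m * 2 ^ m + 12) + 10) + 4) + 2 + (n * (8 * m + 8) + 2) +
      (7 * n + 3 * m + 8 +
        (maxFree m q + 1) * ((maxFree m q * q) ^ (m - 1) * (10 * m + 20))) + 1)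

theorem program_spec (hm : 1 ≤ m) (hq : q = (range n).sup p + 1) (he : ∀ k, e k ≤ 1)
    (hσ : HasInput n p e σ) (hvar : ∀ x ≠ jobs, σ.var x = 0)
    (harr : ∀ T, T ≠ size → T ≠ eligible → σ.arr T = 0) :
    Triple (numberBound m n q) (program m) σ (stepBound m n q) fun τ =>
      ((∃ j < n, ∀ i < m, e (m * j + i) = 0) ∧ τ.arr output = 0) ∨
        IsBest m (fun j i => e (m * j + i) ≠ 0) n p 0 (τ.arr output) := by
  have hp : ∀ j < n, p j < q := fun j hj => by
    rw [hq]
    exact Nat.lt_succ_of_le (le_sup (f := p) (mem_range.2 hj))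
  have hB : 2 ^ m * (n + m + 1) = 2 ^ m * n + m * 2 ^ m + 2 ^ m := by ring
  have hnB : n * (q + 1) = n * (range n).sup p + n + n := by rw [hq]; ring
  have hnq : n * (q + 1) = n * q + n := by ring
  have h2m : m < 2 ^ m := Nat.lt_two_pow_self
  unfold numberBound
  refine Triple.seq ((scan_spec (p := p) (e := e) (by omega) (by omega) (by omega) he hσ
    (by constructor <;> simp [hvar, harr])).mono le_rfl fun τ _ hf ⟨h, hsize⟩ =>
      .ite (fun hstuck => ?_) fun hstuck => .seq ((balance_spec hm (by omega)
        (fun j hj => (hp j hj).le) he (by omega) (by omega) (by omega) (hσ.of_frame hf) h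
        (hsize.trans hq.symm) hstuck ?_ ?_ ?_).mono le_rfl fun υ _ hf' hυ =>
          (improve_spec hm (by omega) hp he (by omega) (by omega) (by omega) (by omega)
            ((hσ.of_frame hf).of_frame hf') ?_ ?_ hυ ?_ ?_ ?_ ?_ ?_ ?_).mono le_rfl
              fun _ _ _ => Or.inr))
  · rw [eval_var, Ne, h.stuck_eq_zero_iff] at hstuck
    push Not at hstuck
    obtain ⟨j, hj, hmask⟩ := hstuck
    refine (Triple.skip (Or.inl ⟨⟨j, hj, ?_⟩, ?_⟩)).mono (by omega) fun _ _ _ h => h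
    · simpa using eligibilityMask_ne_zero_iff.not.1 (not_not.2 hmask)
    · rw [hf.arr_eq output]
      exact harr _ (by decide) (by decide)
  · rw [hf.arr_eq units, harr _ (by decide) (by decide)]
  · rw [hf.arr_eq unitCount, harr _ (by decide) (by decide)]
  · rw [hf.arr_eq filled, harr _ (by decide) (by decide)]
  · simpa only [hf'.arr_eq mask] using h.mask_eq
  · rw [hf'.var_eq unitSize, hsize, hq]
  · rw [hf'.var_eq freeCount, hf.var_eq freeCount, hvar _ (by decide)]
  · rw [hf'.var_eq freeTotal, hf.var_eq freeTotal, hvar _ (by decide)]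
  · rw [hf'.arr_eq classCount, hf.arr_eq classCount, harr _ (by decide) (by decide)]
  · rw [hf'.arr_eq fixedLoad, hf.arr_eq fixedLoad, harr _ (by decide) (by decide)]
  · rw [hf'.arr_eq weight, hf.arr_eq weight, harr _ (by decide) (by decide)]
  · rw [hf'.arr_eq table, hf.arr_eq table, harr _ (by decide) (by decide)]

end Solve

end Assignment

/-! ### The running time -/

namespace RAM

variable {x : ℕ}

theorem len_add_le (a b : ℕ) : len (a + b) ≤ len a + len b := len_eval_le .add a b

theorem len_mul_le (a b : ℕ) : len (a * b) ≤ len a + len b := len_eval_le .mul a b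

theorem len_pow_le (x d : ℕ) : len (x ^ d) ≤ (d + 2) * len x := by
  induction d with
  | zero =>
    have hx := one_le_len x
    have h₁ : len 1 = 2 := rfl
    rw [pow_zero]
    omega
  | succ d ih =>
    have hmul := len_mul_le (x ^ d) x
    rw [pow_succ, Nat.add_right_comm, Nat.succ_mul]
    omega

theorem len_le_log (hx : 2 ≤ x) : len x ≤ 3 * Nat.log 2 x := by
  have hsize : x.size ≤ Nat.log 2 x + 1 := Nat.size_le.2 (Nat.lt_pow_succ_log_self one_lt_two x)
  have hlog : 0 < Nat.log 2 x := Nat.log_pos one_lt_two hx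
  rw [len]
  omega

end RAM

theorem IsSoftO.mono {α : Type*} {T f g : α → ℕ} (h : IsSoftO T f) (hfg : ∀ a, f a ≤ g a) :
    IsSoftO T g := by
  obtain ⟨c, d, hT⟩ := h
  refine ⟨c, d, fun a => (hT a).trans ?_⟩
  gcongr <;> exact hfg a

namespace Assignment

open RAM

variable {m : ℕ}

theorem add_one_pow_le (a E : ℕ) : (a + 1) ^ E ≤ 2 ^ E * (a ^ E + 1) := by
  obtain rfl | ha := Nat.eq_zero_or_pos a
  · rw [zero_add, one_pow]
    exact Nat.mul_pos (Nat.two_pow_pos E) (Nat.succ_pos _)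
  · calc (a + 1) ^ E ≤ (2 * a) ^ E := Nat.pow_le_pow_left (by omega) E
      _ = 2 ^ E * a ^ E := mul_pow 2 a E
      _ ≤ _ := Nat.mul_le_mul_left _ (Nat.le_succ _)

theorem maxFree_eq (m q : ℕ) : maxFree m q = freeFactor m * (m * 2 ^ m) * q ^ (m + 2) := by
  rw [maxFree]
  ring

theorem maxFree_mul_pow (hm : 1 ≤ m) (q : ℕ) : maxFree m q * (maxFree m q * q) ^ (m - 1) =
    (freeFactor m * (m * 2 ^ m)) ^ m * q ^ (m ^ 2 + 3 * m - 1) := by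
  obtain ⟨r, rfl⟩ : ∃ r, m = r + 1 := ⟨m - 1, by omega⟩
  have hE : (r + 1) ^ 2 + 3 * (r + 1) - 1 = (r + 3) * (r + 1) + r := by
    rw [Nat.sub_eq_iff_eq_add (by nlinarith)]
    ring
  rw [maxFree_eq, hE, Nat.add_sub_cancel, mul_pow _ q r, ← mul_assoc, ← pow_succ', mul_pow,
    ← pow_mul, mul_assoc, ← pow_add]

theorem stepBound_le (hm : 1 ≤ m) :
    ∃ c, ∀ n a, stepBound m n (a + 1) ≤ c * (a ^ (m ^ 2 + 3 * m - 1) + n + 1) := by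
  set E := m ^ 2 + 3 * m - 1 with hE
  set C := (freeFactor m * (m * 2 ^ m)) ^ m with hC
  refine ⟨12 * m + 28 + 2 ^ m * (m * (8 * m * 2 ^ m + 12) + 10) + (3 * m + 16 + 2 ^ m * 4) +
    2 * C * 2 ^ E * (10 * m + 20), fun n a => ?_⟩
  have hfree : (maxFree m (a + 1) + 1) * (maxFree m (a + 1) * (a + 1)) ^ (m - 1) ≤
      2 * C * 2 ^ E * (a ^ E + 1) :=
    calc _ ≤ 2 * maxFree m (a + 1) * (maxFree m (a + 1) * (a + 1)) ^ (m - 1) := by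
          gcongr
          linarith [one_le_maxFree hm (Nat.succ_pos a)]
      _ = 2 * C * (a + 1) ^ E := by rw [mul_assoc, maxFree_mul_pow hm, ← hE, ← hC, mul_assoc]
      _ ≤ 2 * C * (2 ^ E * (a ^ E + 1)) := Nat.mul_le_mul_left _ (add_one_pow_le a E)
      _ = _ := by ring
  calc stepBound m n (a + 1)
      = n * (12 * m + 28 + 2 ^ m * (m * (8 * m * 2 ^ m + 12) + 10)) + (3 * m + 16 + 2 ^ m * 4) * 1 +
        (maxFree m (a + 1) + 1) * (maxFree m (a + 1) * (a + 1)) ^ (m - 1) * (10 * m + 20) := by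
        rw [stepBound]
        ring
    _ ≤ (a ^ E + n + 1) * (12 * m + 28 + 2 ^ m * (m * (8 * m * 2 ^ m + 12) + 10)) +
        (3 * m + 16 + 2 ^ m * 4) * (a ^ E + n + 1) +
        2 * C * 2 ^ E * (a ^ E + n + 1) * (10 * m + 20) := by
        gcongr ?_ * _ + _ * ?_ + ?_ * _
        · omega
        · omega
        · exact hfree.trans (Nat.mul_le_mul_left _ (by omega))
    _ = _ := by ring

theorem len_maxFree_mul_le (m q : ℕ) :
    len (maxFree m q * q) ≤ len (freeFactor m * (m * 2 ^ m)) + (m + 5) * len q := by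
  rw [maxFree_eq, mul_assoc, ← pow_succ]
  exact (len_mul_le _ _).trans (Nat.add_le_add_left (len_pow_le q (m + 3)) _)

theorem len_numberBound_le (hm : 1 ≤ m) :
    ∃ c, ∀ n q, len (numberBound m n q) ≤ c * (len n + len q) := by
  set F := len (freeFactor m * (m * 2 ^ m))
  refine ⟨len (2 ^ m) + len (m + 1) + 4 + (m + 2) * (F + (m + 5)), fun n q => ?_⟩
  obtain ⟨r, rfl⟩ : ∃ r, m = r + 1 := ⟨m - 1, by omega⟩
  have hload := len_maxFree_mul_le (r + 1) q
  unfold numberBound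
  set w := maxFree (r + 1) q * q
  calc _ ≤ len (2 ^ (r + 1)) + (len n + len (r + 1 + 1)) + (len n + (len q + len 1)) + len q +
          len w + (r + 2) * len w := by
        refine (len_add_le _ _).trans (Nat.add_le_add ((len_add_le _ _).trans (Nat.add_le_add
          ((len_add_le _ _).trans (Nat.add_le_add ((len_add_le _ _).trans (Nat.add_le_add
          ((len_mul_le _ _).trans (Nat.add_le_add_left
            ((congrArg len (add_assoc n (r + 1) 1)).trans_le (len_add_le n _)) _))
          ((len_mul_le _ _).trans (Nat.add_le_add_left (len_add_le _ _) _)))) le_rfl)) le_rfl))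
          (len_pow_le w r))
    _ = (len (2 ^ (r + 1)) + len (r + 1 + 1) + 2) * 1 + 2 * (len n + len q) + (r + 3) * len w := by
        rw [show len 1 = 2 from rfl]
        ring
    _ ≤ (len (2 ^ (r + 1)) + len (r + 1 + 1) + 2) * (len n + len q) + 2 * (len n + len q) +
          (r + 3) * (F * (len n + len q) + (r + 1 + 5) * (len n + len q)) := by
        have hn := one_le_len n
        gcongr
        · omega
        · refine hload.trans (Nat.add_le_add (Nat.le_mul_of_pos_right _ (by omega))
            (Nat.mul_le_mul_left _ (by omega)))
    _ = _ := by ring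

theorem isSoftO_time (hm : 1 ≤ m) (k : ℕ) :
    IsSoftO (fun I : EligibilityInstance m =>
      stepBound m I.n (I.pmax + 1) * (k * len (numberBound m I.n (I.pmax + 1))))
      fun I => I.pmax ^ (m ^ 2 + 3 * m - 1) + I.n := by
  obtain ⟨c, hstep⟩ := stepBound_le hm
  obtain ⟨c', hlen⟩ := len_numberBound_le hm
  refine ⟨c * (k * (c' * 6)), 1, fun I => ?_⟩
  have hp : I.pmax ≤ I.pmax ^ (m ^ 2 + 3 * m - 1) := Nat.le_self_pow (by omega) _
  set f := I.pmax ^ (m ^ 2 + 3 * m - 1) + I.n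
  have hlog : len I.n + len (I.pmax + 1) ≤ 6 * Nat.log 2 (f + 2) := by
    have hn : len I.n ≤ len (f + 2) := len_mono (by omega)
    have hq : len (I.pmax + 1) ≤ len (f + 2) := len_mono (by omega)
    linarith [len_le_log (show 2 ≤ f + 2 by omega)]
  calc _ ≤ c * (f + 1) * (k * (c' * (6 * Nat.log 2 (f + 2)))) :=
        Nat.mul_le_mul (hstep _ _) (Nat.mul_le_mul_left _ ((hlen _ _).trans
          (Nat.mul_le_mul_left _ hlog)))
    _ = _ := by ring

theorem sq_add_add_one_le_two_pow (m : ℕ) : m ^ 2 + m + 1 ≤ 2 ^ (m + 1) := by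
  induction m with
  | zero => norm_num
  | succ m ih =>
    obtain rfl | rfl | hm : m = 0 ∨ m = 1 ∨ 2 ≤ m := by omega
    · norm_num
    · norm_num
    · rw [pow_succ 2]
      nlinarith

theorem pow_le_pow_two_pow_add (hm : 1 ≤ m) (x : ℕ) :
    x ^ (m ^ 2 + 3 * m - 1) ≤ x ^ (2 ^ (m + 1) + 2 * m - 2) := by
  have hle := sq_add_add_one_le_two_pow m
  obtain rfl | hx := Nat.eq_zero_or_pos x
  · rw [zero_pow (by omega)]
    exact Nat.zero_le _
  · exact Nat.pow_le_pow_right hx (by omega)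

end Assignment

/-! ### Instances as machine states -/

namespace RAM

open Encodable

variable {V A : Type*} [Encodable V] [Encodable A]

/-- The store that a machine state represents. -/
def Store.ofState (s : State) : Store V A where
  var x := s.reg (varReg x)
  arr T := s.mem (encode T)

theorem Cmd.Triple.exec [DecidableEq V] [DecidableEq A] {B k : ℕ} {c : Cmd V A} {s : State}
    {Q : Store V A → Prop} (h : Triple B c (.ofState s) k Q)
    (hs : (Store.ofState s : Store V A).Bdd B) :
    ∃ t s' τ, Exec (c.code 0) s t s' ∧ t ≤ k * (c.cost * len B) ∧ Represents s' τ ∧ Q τ := by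
  obtain ⟨hsafe, hsteps, hQ⟩ := h hs
  obtain ⟨t, s', hexec, ht, hrep, -⟩ := c.compiles 0 hs hsafe ⟨fun _ => rfl, fun _ => rfl⟩
  exact ⟨t, s', _, hexec, ht.trans (Nat.mul_le_mul_right _ hsteps), hrep, hQ⟩

end RAM

namespace EligibilityInstance

open RAM Assignment Finset

variable {m : ℕ} (I : EligibilityInstance m)

theorem input_size (j : Fin I.n) : I.input.mem 0 j = I.p j := by simp [input]

theorem sup_input_size : (range I.n).sup (I.input.mem 0) = I.pmax := by
  refine le_antisymm (Finset.sup_le fun j hj => ?_) (Finset.sup_le fun j _ => ?_)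
  · exact (I.input_size ⟨j, mem_range.1 hj⟩).trans_le (le_sup (f := I.p) (mem_univ _))
  · exact (I.input_size j).ge.trans (le_sup (f := I.input.mem 0) (mem_range.2 j.2))

theorem input_size_le_pmax (k : ℕ) : I.input.mem 0 k ≤ I.pmax := by
  obtain hk | hk := lt_or_ge k I.n
  · exact I.sup_input_size ▸ le_sup (f := I.input.mem 0) (mem_range.2 hk)
  · simp [input, hk.not_gt]

theorem input_eligible_le_one (k : ℕ) : I.input.mem 1 k ≤ 1 := by
  simp only [input, one_ne_zero, if_false, if_true]
  split_ifs <;> omega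

theorem input_eligible_ne_zero_iff (j : Fin I.n) (i : Fin m) :
    I.input.mem 1 (m * j + i) ≠ 0 ↔ i ∈ I.M j := by
  simp only [input, one_ne_zero, if_false, if_true, ne_eq, ite_eq_right_iff, imp_false, not_not]
  refine ⟨?_, fun h => ⟨j, i, h, rfl⟩⟩
  rintro ⟨j', i', h, heq⟩
  have hj := congrArg (· / m) heq
  have hi := congrArg (· % m) heq
  simp only [Nat.mul_add_div i.pos, Nat.div_eq_of_lt, Nat.mul_add_mod, Nat.mod_eq_of_lt, Fin.is_lt,
    add_zero] at hj hi
  rwa [Fin.ext hj, Fin.ext hi]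

theorem ofState_input_var (x : Var) (hx : x ≠ .jobs) :
    (Store.ofState I.input : Store Var Arr).var x = 0 := by
  cases x <;> first | exact absurd rfl hx | rfl

theorem ofState_input_arr (T : Arr) (hT : T ≠ .size) (hT' : T ≠ .eligible) :
    (Store.ofState I.input : Store Var Arr).arr T = 0 := by
  cases T <;> first | exact absurd rfl hT | exact absurd rfl hT' | rfl

theorem bdd_input :
    (Store.ofState I.input : Store Var Arr).Bdd (numberBound m I.n (I.pmax + 1)) := by
  have hn : I.n + m + 1 ≤ 2 ^ m * (I.n + m + 1) := Nat.le_mul_of_pos_left _ (by positivity)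
  unfold numberBound
  refine ⟨fun x => ?_, fun T k => ?_⟩
  · simp only [Store.ofState, input]
    split_ifs <;> omega
  · have hp := I.input_size_le_pmax k
    have he := I.input_eligible_le_one k
    simp only [Store.ofState, input] at hp he ⊢
    split_ifs at hp he ⊢ <;> omega

variable {I} {σ : Fin I.n → Fin m}

theorem makespan_eq_maxLoad (h : ∀ j, σ j ∈ I.M j) : I.makespan σ = maxLoad I.p σ := by
  have hload (i : Fin m) : I.load σ i = Assignment.load I.p σ i := by
    rw [load, Assignment.load, Nat.cast_sum]
    exact sum_congr rfl fun j hj => if_pos ((mem_filter.1 hj).2 ▸ h j)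
  rw [makespan, maxLoad,
    apply_sup_eq_sup_comp (Nat.cast : ℕ → ℕ∞) (fun _ _ => Nat.mono_cast.map_max) rfl]
  exact sup_congr rfl fun i _ => hload i

theorem makespan_eq_top {j : Fin I.n} (h : σ j ∉ I.M j) : I.makespan σ = ⊤ := by
  refine top_le_iff.1 ?_
  calc ⊤ = I.time (σ j) j := (if_neg h).symm
    _ ≤ I.load σ (σ j) := single_le_sum (f := I.time (σ j)) (fun _ _ => zero_le)
        (mem_filter.2 ⟨mem_univ j, rfl⟩)
    _ ≤ I.makespan σ := le_sup (f := I.load σ) (mem_univ _)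

theorem isOptimal_of_isBest {y : ℕ → ℕ}
    (h : IsBest m (fun j i => I.input.mem 1 (m * j + i) ≠ 0) I.n (I.input.mem 0) 0 y) :
    I.IsOptimal fun j => ⟨y j, (h.1 j j.2).1⟩ := by
  have hp : I.p = fun j : Fin I.n => I.input.mem 0 j := funext fun j => (I.input_size j).symm
  intro τ
  by_cases hτ : ∀ j, τ j ∈ I.M j
  · let z : ℕ → ℕ := fun j => if h : j < I.n then τ ⟨j, h⟩ else 0
    have hz (j : Fin I.n) : z j = τ j := by simp [z]
    rw [makespan_eq_maxLoad fun j => (I.input_eligible_ne_zero_iff j _).1 (h.1 j j.2).2,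
      makespan_eq_maxLoad hτ, Nat.cast_le, hp, maxLoad_eq_peak (x := y) _ fun _ => rfl,
      maxLoad_eq_peak _ hz]
    refine h.2 z fun j hj => ?_
    rw [hz ⟨j, hj⟩]
    exact ⟨(τ _).2, (I.input_eligible_ne_zero_iff ⟨j, hj⟩ _).2 (hτ _)⟩
  · push Not at hτ
    obtain ⟨j, hj⟩ := hτ
    exact le_top.trans_eq (makespan_eq_top hj).symm

theorem solvesInTime (hm : 1 ≤ m) : SolvesInTime m ((program m).code 0) fun I =>
    stepBound m I.n (I.pmax + 1) *
      ((program m).cost * len (numberBound m I.n (I.pmax + 1))) := by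
  intro I
  obtain ⟨t, s, τ, hexec, ht, hs, hτ⟩ := (program_spec (σ := .ofState I.input) (n := I.n)
    (p := I.input.mem 0) hm rfl I.input_eligible_le_one ⟨rfl, rfl, rfl⟩ I.ofState_input_var
    I.ofState_input_arr).exec (I.sup_input_size ▸ I.bdd_input)
  rw [I.sup_input_size] at ht
  have hout : s.mem 2 = τ.arr .output := hs.arr .output
  obtain ⟨⟨j, hj, hj₀⟩, hzero⟩ | hbest := hτ
  · refine ⟨t, s, fun _ => ⟨0, hm⟩, hexec, ht, fun j => by rw [hout, hzero, Pi.zero_apply],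
      fun σ => ?_⟩
    rw [makespan_eq_top (σ := σ) (j := ⟨j, hj⟩)]
    · exact le_top
    · rw [← I.input_eligible_ne_zero_iff, not_not]
      exact hj₀ _ (σ ⟨j, hj⟩).2
  · exact ⟨t, s, _, hexec, ht, fun j => by rw [hout], isOptimal_of_isBest hbest⟩

end EligibilityInstance

theorem mainTheorem5_general (m : ℕ) (hm : 1 ≤ m) :
    ∃ (P : RAM.Prog) (T : EligibilityInstance m → ℕ), SolvesInTime m P T ∧
      IsSoftO T (fun I => I.pmax ^ (m ^ 2 + 3 * m - 1) + I.n) :=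
  ⟨_, _, EligibilityInstance.solvesInTime hm, Assignment.isSoftO_time hm _⟩

theorem mainTheorem5 (m : ℕ) (hm : 1 ≤ m) :
    ∃ (P : RAM.Prog) (T : EligibilityInstance m → ℕ), SolvesInTime m P T ∧
      IsSoftO T (fun I => I.pmax ^ (2 ^ (m + 1) + 2 * m - 2) + I.n) := by
  obtain ⟨P, T, hP, hT⟩ := mainTheorem5_general m hm
  exact ⟨P, T, hP, hT.mono fun I => Nat.add_le_add_right (Assignment.pow_le_pow_two_pow_add hm _) _⟩
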